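/- Let $G$ be a compact Lie group and let $\rho\colon G\to \mathrm{GL}(V)$ be a smooth representation of $G$ on a finite-dimensional real vector space $V$ (a complex or quaternionic representation is regarded as a real one). A point $v\in V$ is called principal if its isotropy subgroup $G_v=\{g\in G:\rho(g)v=v\}$ is conjugate in $G$ to a subgroup of $G_w$ for every $w\in V$. Principal points exist, all their isotropy subgroups are conjugate, and all their orbits have the same dimension; write $H=G_v$ for the isotropy subgroup of a principal point $v$ and $c(G,V)=\dim_{\mathbb R} V-\dim (G\cdot v)$ for the cohomogeneity. For a compact Lie group $K$ let $\operatorname{rk} K$ be the dimension of a maximal torus of $K$. The homogeneity rank of the representation is the integer $$\operatorname{hrk}(G,V)=\operatorname{rk} G-\operatorname{rk} H-c(G,V).$$ Let $\rho_i\colon G\to\mathrm{GL}(V_i)$ $(i=1,2)$ be two finite-dimensional representations of a compact Lie group $G$ (not necessarily connected). Then, for the direct sum representation on $V_1\oplus V_2$, $$\operatorname{hrk}(G,V_1\oplus V_2)\le \operatorname{hrk}(G,V_1)+\operatorname{hrk}(G,V_2).$$ -/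

import Mathlib

open scoped Manifold ContDiff

/-- The rank of a compact Lie group `K`: the dimension of its maximal tori, i.e. the largest `n`
such that some subgroup of `K` is isomorphic, as a topological group, to the `n`-dimensional
torus. -/
noncomputable def torusRank (K : Type*) [Group K] [TopologicalSpace K] : ℕ :=
  sSup {n : ℕ | ∃ T : Subgroup K, Nonempty (T ≃ₜ* (Fin n → Circle))}

namespace Representation

section Isotropy

variable {G V : Type*} [Group G] [AddCommGroup V] [Module ℝ V]

/-- The isotropy subgroup `G_v`. -/
def isotropy (ρ : Representation ℝ G V) (v : V) : Subgroup G where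
  carrier := {g | ρ g v = v}
  one_mem' := by simp
  mul_mem' {a b} ha hb := by
    have ha' : ρ a v = v := ha
    have hb' : ρ b v = v := hb
    simp [ha', hb']
  inv_mem' {a} ha := by
    have ha' : ρ a v = v := ha
    have h : ρ a⁻¹ (ρ a v) = v := by simp
    rw [ha'] at h
    exact h

/-- `v` is a principal point: its orbit has the maximum orbit type, i.e. `G_v` is conjugate to a
subgroup of every isotropy subgroup. -/
def IsPrincipalPoint (ρ : Representation ℝ G V) (v : V) : Prop :=
  ∀ w : V, ∃ g : G, (ρ.isotropy v).map (MulAut.conj g).toMonoidHom ≤ ρ.isotropy w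

/-- A chosen principal point. For smooth finite-dimensional representations of compact Lie groups
principal points exist, and any two of them have conjugate isotropy subgroups and orbits of the
same dimension. -/
noncomputable def principalPoint (ρ : Representation ℝ G V) : V :=
  Classical.epsilon ρ.IsPrincipalPoint

end Isotropy

section Lie

variable {E H G V : Type*} [NormedAddCommGroup E] [NormedSpace ℝ E] [TopologicalSpace H]
  [TopologicalSpace G] [ChartedSpace H G] [Group G] [NormedAddCommGroup V] [NormedSpace ℝ V]

/-- The representation is smooth: all its orbit maps `g ↦ ρ(g) v` are smooth. In finite dimension
this says that `ρ : G → GL(V)` is a smooth map. -/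
def IsSmooth (I : ModelWithCorners ℝ E H) (ρ : Representation ℝ G V) : Prop :=
  ∀ v : V, ContMDiff I 𝓘(ℝ, V) ∞ (fun g : G => ρ g v)

/-- The tangent space at `v` of the orbit `G · v`: the image of the differential at the identity
of the orbit map `g ↦ ρ(g) v`. -/
noncomputable def orbitTangentSpace (I : ModelWithCorners ℝ E H) (ρ : Representation ℝ G V)
    (v : V) : Submodule ℝ V :=
  LinearMap.range (mfderiv I 𝓘(ℝ, V) (fun g : G => ρ g v) 1 : E →L[ℝ] V).toLinearMap

/-- The cohomogeneity `c(G, V)`: the codimension in `V` of the principal orbits. -/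
noncomputable def cohomogeneity (I : ModelWithCorners ℝ E H) (ρ : Representation ℝ G V) : ℤ :=
  (Module.finrank ℝ V : ℤ) - Module.finrank ℝ (ρ.orbitTangentSpace I ρ.principalPoint)

/-- The homogeneity rank `hrk(G, V) = rk G - rk H - c(G, V)`, with `H` a principal isotropy
subgroup. -/
noncomputable def hrk (I : ModelWithCorners ℝ E H) (ρ : Representation ℝ G V) : ℤ :=
  (torusRank G : ℤ) - torusRank (ρ.isotropy ρ.principalPoint) - ρ.cohomogeneity I

end Lie

end Representation

open Filter Topology

/-! Let `H₁`, `H₂`, `H` be principal isotropy groups of `V₁`, `V₂`, `V₁ ⊕ V₂`. An orbit has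
dimension `dim G` minus that of the isotropy group, so the claim is equivalent to `rk H₁ + rk H₂ +
dim H₁ + dim H₂ ≤ rk G + dim G + rk H + dim H`.

Maximal tori of `H₁` and `H₂` commute after conjugating one of them
(`IsTorusParam.exists_commute_conj`). The product map of the commuting tori has a torus of `G` as
image and their intersection as kernel, so for some `g` the group `K = gH₁g⁻¹ ∩ H₂` satisfies `rk H₁
+ rk H₂ ≤ rk G + rk K` (`exists_torusRank_add_le`). `K` is the isotropy group of `x = g v₁ + v₂` for
principal `v₁`, `v₂`. Since `K` fixes the normal spaces of the orbits of `g v₁` and `v₂` pointwise,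
its action on the normal space at `x` reduces to a complement `N'` of dimension `dim K + dim G - dim
H₁ - dim H₂`, with the same principal isotropy `H` (`IsNice.slice`).

It remains to see that a single representation has homogeneity rank at most zero, in the form `rk K
+ dim K ≤ rk H + dim H + dim N'` (`IsNice.torusRank_add_le`). A maximal torus of `K` acts on some
nonzero vector `w` with orbit of dimension at most one, so `rk K ≤ rk K_w + 1`. The slice at `w`,
with the line `ℝ w` removed, is a smaller representation of `K_w` with principal isotropy `H`, and
induction on the dimension applies.

Regular points are those whose isotropy group acts trivially on the normal space of the orbit
(`IsNice`); they exist (`exists_isNice`) and have the maximum orbit type (`IsNice.isPrincipalIn`).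
Isotropy groups are never given a manifold structure: their Lie algebras are the spaces `lieFix` of
directions killing given vectors, and integral curves of left-invariant fields realize these
directions inside the group. Tori are handled as continuous homomorphisms from `ℝⁿ` with kernel
`ℤⁿ`, so that questions about their subgroups become linear algebra over closed subgroups of `ℝⁿ`.
-/

/-! ### Closed subgroups of Euclidean space -/

theorem AddSubgroup.discreteTopology_of_isClosed {W : Type*} [NormedAddCommGroup W]
    [NormedSpace ℝ W] [FiniteDimensional ℝ W] (Λ : AddSubgroup W) (hΛ : IsClosed (Λ : Set W))
    (h : ∀ u : W, (∀ t : ℝ, t • u ∈ Λ) → u = 0) : DiscreteTopology Λ := by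
  have key : ∃ ε > 0, ∀ x ∈ Λ, ‖x‖ < ε → x = 0 := by
    by_contra! hcon
    have hpos : ∀ n : ℕ, (0 : ℝ) < 1 / ((n : ℝ) + 1) := fun n => Nat.one_div_pos_of_nat
    choose x hxΛ hxn hx0 using fun n : ℕ => hcon _ (hpos n)
    have hxne : ∀ n, ‖x n‖ ≠ 0 := fun n => norm_ne_zero_iff.2 (hx0 n)
    have hxlim : Tendsto (fun n => ‖x n‖) atTop (𝓝 0) :=
      squeeze_zero (fun n => norm_nonneg _) (fun n => (hxn n).le)
        tendsto_one_div_add_atTop_nhds_zero_nat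
    have hu : ∀ n, (‖x n‖)⁻¹ • x n ∈ Metric.sphere (0 : W) 1 := by
      intro n
      simp [norm_smul, hxne n]
    obtain ⟨u, hu1, φ, hφ, hlim⟩ := (isCompact_sphere (0 : W) 1).tendsto_subseq hu
    have hu0 : u = 0 := by
      apply h
      intro t
      -- The integer multiple of the short vector `x (φ n)` with length closest to `t` from below
      -- misses `t` by at most `‖x (φ n)‖`, so these elements of `Λ` converge to `t • u`; a closed
      -- `Λ` then contains the whole line through `u`.
      have hmem : ∀ n, (⌊t / ‖x (φ n)‖⌋ : ℤ) • x (φ n) ∈ Λ := fun n => Λ.zsmul_mem (hxΛ _) _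
      refine hΛ.mem_of_tendsto ?_ (Eventually.of_forall hmem) (b := atTop)
      have hs : ∀ n, (⌊t / ‖x (φ n)‖⌋ : ℤ) • x (φ n) =
          ((⌊t / ‖x (φ n)‖⌋ : ℝ) * ‖x (φ n)‖) • ((‖x (φ n)‖)⁻¹ • x (φ n)) := by
        intro n
        rw [smul_smul, mul_assoc, mul_inv_cancel₀ (hxne _), mul_one, Int.cast_smul_eq_zsmul]
      simp_rw [hs]
      refine Tendsto.smul ?_ hlim
      have hb : Tendsto (fun n => t - ‖x (φ n)‖) atTop (𝓝 t) := by
        simpa using tendsto_const_nhds.sub (hxlim.comp hφ.tendsto_atTop)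
      refine tendsto_of_tendsto_of_tendsto_of_le_of_le hb tendsto_const_nhds ?_ ?_
      · intro n
        have hp : 0 < ‖x (φ n)‖ := norm_pos_iff.2 (hx0 _)
        have := Int.lt_floor_add_one (t / ‖x (φ n)‖)
        rw [div_lt_iff₀ hp] at this
        simp only
        nlinarith
      · intro n
        have hp : 0 < ‖x (φ n)‖ := norm_pos_iff.2 (hx0 _)
        have := Int.floor_le (t / ‖x (φ n)‖)
        rwa [le_div_iff₀ hp] at this
    simp [hu0] at hu1
  obtain ⟨ε, hε, hx⟩ := key
  refine discreteTopology_of_isOpen_singleton_zero ?_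
  have : ({0} : Set Λ) = Subtype.val ⁻¹' Metric.ball (0 : W) ε := by
    ext y
    simp only [Set.mem_singleton_iff, Set.mem_preimage, mem_ball_zero_iff]
    refine ⟨fun h => by simp [h, hε], fun h => Subtype.ext (hx _ y.2 h)⟩
  rw [this]
  exact Metric.isOpen_ball.preimage continuous_subtype_val

/-- The lattice of integral points of `ι → ℝ`. -/
abbrev intLattice (ι : Type*) [Fintype ι] : Submodule ℤ (ι → ℝ) :=
  Submodule.span ℤ (Set.range (Pi.basisFun ℝ ι))

theorem mem_intLattice {ι : Type*} [Fintype ι] {x : ι → ℝ} :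
    x ∈ intLattice ι ↔ ∀ i, ∃ k : ℤ, (k : ℝ) = x i := by
  rw [intLattice, (Pi.basisFun ℝ ι).mem_span_iff_repr_mem ℤ]
  simp [Set.mem_range]

theorem exists_linearEquiv_intLattice {W : Type*} [NormedAddCommGroup W] [NormedSpace ℝ W]
    [FiniteDimensional ℝ W] (Λ : Submodule ℤ W) [DiscreteTopology Λ]
    (hspan : Submodule.span ℝ (Λ : Set W) = ⊤) :
    ∃ e : W ≃ₗ[ℝ] (Fin (Module.finrank ℝ W) → ℝ),
      ∀ x, x ∈ Λ ↔ e x ∈ intLattice (Fin (Module.finrank ℝ W)) := by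
  have : IsZLattice ℝ Λ := ⟨hspan⟩
  have : Module.Free ℤ Λ := ZLattice.module_free ℝ Λ
  have : Module.Finite ℤ Λ := ZLattice.module_finite ℝ Λ
  let b := (Module.finBasis ℤ Λ).reindex (finCongr (ZLattice.rank ℝ Λ))
  let b' := b.ofZLatticeBasis ℝ Λ
  refine ⟨b'.equivFun, fun x => ?_⟩
  have h : x ∈ Λ ↔ x ∈ Submodule.span ℤ (Set.range b') := by
    rw [b.ofZLatticeBasis_span ℝ]
  rw [h, b'.mem_span_iff_repr_mem ℤ, mem_intLattice]
  simp [Set.mem_range]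

/-- The largest linear subspace contained in an additive subgroup. -/
def AddSubgroup.linearPart {W : Type*} [AddCommGroup W] [Module ℝ W] (Λ : AddSubgroup W) :
    Submodule ℝ W where
  carrier := {u | ∀ t : ℝ, t • u ∈ Λ}
  zero_mem' t := by simp
  add_mem' {a b} ha hb t := by rw [smul_add]; exact Λ.add_mem (ha t) (hb t)
  smul_mem' c x hx t := by rw [smul_smul]; exact hx _

theorem AddSubgroup.linearPart_le {W : Type*} [AddCommGroup W] [Module ℝ W]
    {Λ : AddSubgroup W} {u : W} (h : u ∈ Λ.linearPart) : u ∈ Λ := by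
  simpa using h 1

/-- Structure of closed subgroups: on a complement of the linear part the subgroup is discrete,
hence a lattice, and `M` is the projection to that complement written in a lattice basis. -/
theorem AddSubgroup.exists_linearMap_comap_intLattice {F : Type*} [NormedAddCommGroup F]
    [NormedSpace ℝ F] [FiniteDimensional ℝ F] (Λ : AddSubgroup F) (hΛ : IsClosed (Λ : Set F))
    (hspan : Submodule.span ℝ (Λ : Set F) = ⊤) :
    ∃ (m : ℕ) (M : F →ₗ[ℝ] (Fin m → ℝ)), m + Module.finrank ℝ Λ.linearPart = Module.finrank ℝ F ∧
      Function.Surjective M ∧ M.ker = Λ.linearPart ∧ ∀ x, x ∈ Λ ↔ M x ∈ intLattice (Fin m) := by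
  obtain ⟨W, hW⟩ := Submodule.exists_isCompl Λ.linearPart
  let ΛW : AddSubgroup W := Λ.comap W.subtype.toAddMonoidHom
  have hmem : ∀ x : W, x ∈ ΛW ↔ (x : F) ∈ Λ := fun x => Iff.rfl
  have hcl : IsClosed (ΛW : Set W) := hΛ.preimage continuous_subtype_val
  have hd : DiscreteTopology ΛW := by
    refine ΛW.discreteTopology_of_isClosed hcl fun u hu => ?_
    have h1 : (u : F) ∈ Λ.linearPart := fun t => hu t
    exact Subtype.ext (Submodule.disjoint_def.1 hW.disjoint _ h1 u.2)
  let P : F →ₗ[ℝ] W := W.projectionOnto Λ.linearPart hW.symm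
  have hP : ∀ x, x - P x ∈ Λ.linearPart := by
    intro x
    have := (Submodule.ker_projectionOnto hW.symm : P.ker = Λ.linearPart)
    rw [← this, LinearMap.mem_ker, map_sub, sub_eq_zero]
    exact (Submodule.projectionOnto_apply_left hW.symm (P x)).symm
  have hPmem : ∀ x, x ∈ Λ ↔ P x ∈ ΛW := by
    intro x
    rw [hmem]
    constructor
    · intro hx
      have := Λ.sub_mem hx (linearPart_le (hP x))
      simpa using this
    · intro hx
      have := Λ.add_mem hx (linearPart_le (hP x))
      simpa using this
  have hPs : Function.Surjective P := fun w => ⟨w, by simp [P]⟩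
  have hspanW : Submodule.span ℝ ((AddSubgroup.toIntSubmodule ΛW : Submodule ℤ W) : Set W) = ⊤ := by
    rw [eq_top_iff]
    have h1 : Submodule.map P ⊤ = ⊤ := by rw [Submodule.map_top]; exact LinearMap.range_eq_top.2 hPs
    rw [← h1, ← hspan, Submodule.map_span, Submodule.span_le]
    rintro _ ⟨x, hx, rfl⟩
    exact Submodule.subset_span ((hPmem x).1 hx)
  have hd' : DiscreteTopology (AddSubgroup.toIntSubmodule ΛW : Submodule ℤ W) := hd
  obtain ⟨e, he⟩ := exists_linearEquiv_intLattice _ hspanW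
  refine ⟨Module.finrank ℝ W, e.toLinearMap ∘ₗ P, ?_, ?_, ?_, ?_⟩
  · rw [add_comm]; exact Submodule.finrank_add_eq_of_isCompl hW
  · exact e.surjective.comp hPs
  · rw [LinearMap.ker_comp, e.ker]
    exact Submodule.ker_projectionOnto hW.symm
  · intro x
    rw [hPmem]
    exact he (P x)

/-- The linear part is a rational subspace. Modulo it, `Λ` is a lattice of rank `m`, and `ℤ^ι` maps
onto a subgroup that still spans, hence also has rank `m`. The integral points in the linear part
therefore have rank equal to its dimension and span it; `L` is given by a basis of them. This makes
the linear part the Lie algebra of a subtorus. -/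
theorem AddSubgroup.exists_linearMap_range_linearPart {ι : Type*} [Fintype ι]
    (Λ : AddSubgroup (ι → ℝ)) (hΛ : IsClosed (Λ : Set (ι → ℝ)))
    (hZ : ∀ x ∈ intLattice ι, x ∈ Λ) :
    ∃ L : (Fin (Module.finrank ℝ Λ.linearPart) → ℝ) →ₗ[ℝ] (ι → ℝ),
      L.range = Λ.linearPart ∧
      ∀ z, L z ∈ intLattice ι ↔ z ∈ intLattice (Fin (Module.finrank ℝ Λ.linearPart)) := by
  have hZspan : Submodule.span ℝ (intLattice ι : Set (ι → ℝ)) = ⊤ := IsZLattice.span_top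
  have hspan : Submodule.span ℝ (Λ : Set (ι → ℝ)) = ⊤ := by
    rw [eq_top_iff, ← hZspan]
    exact Submodule.span_mono hZ
  obtain ⟨m, M, hm, hMs, hMk, hM⟩ := Λ.exists_linearMap_comap_intLattice hΛ hspan
  let Z := intLattice ι
  have : Module.Free ℤ Z := ZLattice.module_free ℝ Z
  have : Module.Finite ℤ Z := ZLattice.module_finite ℝ Z
  let f : Z →ₗ[ℤ] (Fin m → ℝ) := (M.restrictScalars ℤ) ∘ₗ Z.subtype
  have hfle : f.range ≤ intLattice (Fin m) := by
    rintro _ ⟨x, rfl⟩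
    exact (hM _).1 (hZ _ x.2)
  have hfd : DiscreteTopology f.range :=
    DiscreteTopology.of_subset (s := (intLattice (Fin m) : Set (Fin m → ℝ)))
      (inferInstanceAs (DiscreteTopology (intLattice (Fin m)))) hfle
  have hfspan : Submodule.span ℝ (f.range : Set (Fin m → ℝ)) = ⊤ := by
    rw [eq_top_iff]
    have h1 : Submodule.map M ⊤ = ⊤ := by rw [Submodule.map_top]; exact LinearMap.range_eq_top.2 hMs
    rw [← h1, ← hZspan, Submodule.map_span, Submodule.span_le]
    rintro _ ⟨x, hx, rfl⟩
    exact Submodule.subset_span ⟨⟨x, hx⟩, rfl⟩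
  have hfl : IsZLattice ℝ f.range := ⟨hfspan⟩
  have hrank : Module.finrank ℤ f.range = m := by rw [ZLattice.rank ℝ]; simp
  have hker : Module.finrank ℤ f.ker = Module.finrank ℝ Λ.linearPart := by
    have h1 := Submodule.finrank_quotient_add_finrank f.ker
    rw [f.quotKerEquivRange.finrank_eq, hrank, ZLattice.rank ℝ Z] at h1
    omega
  let Γ : Submodule ℤ (ι → ℝ) := f.ker.map Z.subtype
  have hΓ : ∀ x, x ∈ Γ ↔ x ∈ Λ.linearPart ∧ x ∈ Z := by
    intro x
    rw [← hMk]
    constructor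
    · rintro ⟨y, hy, rfl⟩
      exact ⟨hy, y.2⟩
    · rintro ⟨h1, h2⟩
      exact ⟨⟨x, h2⟩, h1, rfl⟩
  have hΓd : DiscreteTopology Γ :=
    DiscreteTopology.of_subset (s := (Z : Set (ι → ℝ)))
      (inferInstanceAs (DiscreteTopology Z)) (fun x hx => ((hΓ x).1 hx).2)
  have hΓr : Module.finrank ℤ Γ = Module.finrank ℝ Λ.linearPart := by
    rw [← hker]
    exact (Submodule.equivMapOfInjective Z.subtype Z.subtype_injective f.ker).finrank_eq.symm
  have hΓs : Submodule.span ℝ (Γ : Set (ι → ℝ)) = Λ.linearPart := by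
    refine Submodule.eq_of_le_of_finrank_eq
      (Submodule.span_le.2 fun x hx => ((hΓ x).1 hx).1) ?_
    have hd : DiscreteTopology (Submodule.span ℤ (Γ : Set (ι → ℝ))) := by
      rw [Submodule.span_eq]; exact hΓd
    have := Real.finrank_eq_int_finrank_of_discrete hd
    rw [Set.finrank, Set.finrank, Submodule.span_eq, hΓr] at this
    exact this
  let Γ' : Submodule ℤ Λ.linearPart := Γ.comap (Λ.linearPart.subtype.restrictScalars ℤ)
  have hΓ'd : DiscreteTopology Γ' := by
    have hinj : Function.Injective (fun x : Γ' => (⟨x.1.1, x.2⟩ : Γ)) := fun a b h => by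
      apply Subtype.ext; apply Subtype.ext; exact congrArg (fun x : Γ => (x : ι → ℝ)) h
    exact DiscreteTopology.of_continuous_injective (by fun_prop) hinj
  have hΓ's : Submodule.span ℝ (Γ' : Set Λ.linearPart) = ⊤ := by
    apply Submodule.map_injective_of_injective Λ.linearPart.subtype_injective
    rw [Submodule.map_span, Submodule.map_top, Submodule.range_subtype]
    refine Eq.trans (congrArg (Submodule.span ℝ) ?_) hΓs
    ext x
    constructor
    · rintro ⟨y, hy, rfl⟩
      exact hy
    · intro hx
      exact ⟨⟨x, ((hΓ x).1 hx).1⟩, hx, rfl⟩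
  obtain ⟨e, he⟩ := exists_linearEquiv_intLattice _ hΓ's
  refine ⟨Λ.linearPart.subtype ∘ₗ e.symm.toLinearMap, ?_, fun z => ?_⟩
  · rw [LinearMap.range_comp, e.symm.range, Submodule.map_top, Submodule.range_subtype]
  · have := he (e.symm z)
    rw [e.apply_symm_apply] at this
    rw [← this]
    simp only [LinearMap.comp_apply, Submodule.subtype_apply]
    change _ ↔ ((e.symm z : Λ.linearPart) : ι → ℝ) ∈ Γ
    rw [hΓ]
    exact ⟨fun h => ⟨(e.symm z).2, h⟩, fun h => h.2⟩

/-! ### Tori parametrized by Euclidean space -/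

/-- A continuous homomorphism from `ι → ℝ` whose kernel is the lattice of integral points: it
parametrizes a torus of dimension the cardinality of `ι`. -/
structure IsTorusParam {ι G : Type*} [Fintype ι] [Group G] [TopologicalSpace G]
    (ψ : (ι → ℝ) → G) : Prop where
  continuous : Continuous ψ
  map_add : ∀ x y, ψ (x + y) = ψ x * ψ y
  eq_one_iff : ∀ x, ψ x = 1 ↔ x ∈ intLattice ι

namespace IsTorusParam

variable {ι G : Type*} [Fintype ι] [Group G] [TopologicalSpace G] {ψ : (ι → ℝ) → G}

theorem map_zero (h : IsTorusParam ψ) : ψ 0 = 1 := (h.eq_one_iff 0).2 (zero_mem _)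

theorem map_neg (h : IsTorusParam ψ) (x : ι → ℝ) : ψ (-x) = (ψ x)⁻¹ := by
  rw [eq_inv_iff_mul_eq_one, ← h.map_add, neg_add_cancel, h.map_zero]

theorem map_sub (h : IsTorusParam ψ) (x y : ι → ℝ) : ψ (x - y) = ψ x * (ψ y)⁻¹ := by
  rw [sub_eq_add_neg, h.map_add, h.map_neg]

theorem conj [IsTopologicalGroup G] (h : IsTorusParam ψ) (g : G) :
    IsTorusParam (fun x => g * ψ x * g⁻¹) where
  continuous := by have := h.continuous; fun_prop
  map_add x y := by rw [h.map_add]; group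
  eq_one_iff x := by rw [← h.eq_one_iff, mul_inv_eq_one, mul_eq_left]

end IsTorusParam

/-- The covering of the standard torus by Euclidean space. -/
noncomputable def circleExpPi (n : ℕ) (x : Fin n → ℝ) : Fin n → Circle :=
  fun i => Circle.exp (2 * Real.pi * x i)

theorem circleExpPi_add (n : ℕ) (x y : Fin n → ℝ) :
    circleExpPi n (x + y) = circleExpPi n x * circleExpPi n y := by
  ext i
  simp [circleExpPi, mul_add, Circle.exp_add]

theorem circleExpPi_eq_one_iff (n : ℕ) (x : Fin n → ℝ) :
    circleExpPi n x = 1 ↔ x ∈ intLattice (Fin n) := by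
  rw [mem_intLattice, funext_iff]
  refine forall_congr' fun i => ?_
  rw [circleExpPi, Pi.one_apply, Circle.exp_eq_one]
  refine exists_congr fun k => ?_
  have : (2 * Real.pi) ≠ 0 := by positivity
  rw [mul_comm (k : ℝ), mul_right_inj' this, eq_comm]

theorem isTorusParam_circleExpPi (n : ℕ) : IsTorusParam (circleExpPi n) where
  continuous := continuous_pi fun i => Circle.exp.continuous.comp (by fun_prop)
  map_add := circleExpPi_add n
  eq_one_iff := circleExpPi_eq_one_iff n

theorem circleExpPi_surjective (n : ℕ) : Function.Surjective (circleExpPi n) := by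
  intro z
  choose x hx using fun i => Circle.exp_surjective (z i)
  refine ⟨fun i => x i / (2 * Real.pi), funext fun i => ?_⟩
  have : (2 * Real.pi) ≠ 0 := by positivity
  rw [circleExpPi, mul_div_cancel₀ _ this, hx]

theorem isOpenMap_circleExpPi (n : ℕ) : IsOpenMap (circleExpPi n) := by
  have h : IsOpenMap (fun x : ℝ => Circle.exp (2 * Real.pi * x)) :=
    isLocalHomeomorph_circleExp.isOpenMap.comp
      (Homeomorph.mulLeft₀ (2 * Real.pi) (by positivity)).isOpenMap
  exact IsOpenMap.piMap (fun _ => h) (Eventually.of_forall fun _ x => by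
    obtain ⟨y, hy⟩ := Circle.exp_surjective x
    refine ⟨y / (2 * Real.pi), ?_⟩
    have : (2 * Real.pi) ≠ 0 := by positivity
    simp only [mul_div_cancel₀ _ this, hy])

/-- From right to left, `ψ` descends along the open quotient map `circleExpPi n` to a continuous
injection of the compact torus into a Hausdorff group, which is a homeomorphism onto its image. -/
theorem exists_subgroup_equiv_torus_iff {K : Type*} [Group K] [TopologicalSpace K] [T2Space K]
    {n : ℕ} :
    (∃ T : Subgroup K, Nonempty (T ≃ₜ* (Fin n → Circle))) ↔
      ∃ ψ : (Fin n → ℝ) → K, IsTorusParam ψ := by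
  constructor
  · rintro ⟨T, ⟨e⟩⟩
    refine ⟨fun x => e.symm (circleExpPi n x), ?_, ?_, ?_⟩
    · exact continuous_subtype_val.comp
        (e.symm.continuous.comp (isTorusParam_circleExpPi n).continuous)
    · intro x y
      simp [circleExpPi_add]
    · intro x
      rw [OneMemClass.coe_eq_one, ← circleExpPi_eq_one_iff]
      exact EmbeddingLike.map_eq_one_iff
  · rintro ⟨ψ, hψ⟩
    have hq := isTorusParam_circleExpPi n
    have hquot : IsQuotientMap (circleExpPi n) :=
      (isOpenMap_circleExpPi n).isQuotientMap hq.continuous (circleExpPi_surjective n)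
    have hψq : ∀ x y, circleExpPi n x = circleExpPi n y ↔ ψ x = ψ y := by
      intro x y
      rw [← mul_inv_eq_one, ← hq.map_sub, hq.eq_one_iff, ← hψ.eq_one_iff, hψ.map_sub,
        mul_inv_eq_one]
    let s := Function.surjInv (circleExpPi_surjective n)
    have hs : ∀ z, circleExpPi n (s z) = z := Function.surjInv_eq _
    let f : (Fin n → Circle) →* K :=
      { toFun := fun z => ψ (s z)
        map_one' := by rw [hψ.eq_one_iff, ← hq.eq_one_iff, hs]
        map_mul' := fun a b => by
          rw [← hψ.map_add]
          apply (hψq _ _).1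
          rw [hs, hq.map_add, hs, hs] }
    have hfq : ∀ x, f (circleExpPi n x) = ψ x := fun x => (hψq _ _).1 (hs _)
    have hfc : Continuous f := by
      rw [hquot.continuous_iff]
      exact hψ.continuous.congr fun x => (hfq x).symm
    have hfi : Function.Injective f := by
      intro a b hab
      have := (hψq (s a) (s b)).2 hab
      rwa [hs, hs] at this
    refine ⟨f.range, ⟨?_⟩⟩
    let e : (Fin n → Circle) ≃* f.range := MonoidHom.ofInjective hfi
    have hec : Continuous e := hfc.subtype_mk _
    exact ContinuousMulEquiv.symm
      { e with
        continuous_toFun := hec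
        continuous_invFun := (Continuous.homeoOfEquivCompactToT2 (f := e.toEquiv) hec).symm.continuous }

theorem torusRank_eq {K : Type*} [Group K] [TopologicalSpace K] [T2Space K] :
    torusRank K = sSup {n : ℕ | ∃ ψ : (Fin n → ℝ) → K, IsTorusParam ψ} := by
  simp_rw [torusRank, exists_subgroup_equiv_torus_iff]

/-- Some line through the origin is dense modulo the lattice of integral points. -/
theorem exists_dense_line (ι : Type*) [Fintype ι] :
    ∃ x : ι → ℝ, ∀ s : Set (ι → ℝ), IsClosed s →
      (∀ t : ℝ, ∀ z ∈ intLattice ι, t • x + z ∈ s) → s = Set.univ := by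
  -- A vector with rationally independent coordinates: countably many rational hyperplanes, each of
  -- measure zero, do not cover the space.
  obtain ⟨x, hx⟩ : ∃ x : ι → ℝ, ∀ k : ι → ℤ, k ≠ 0 → ∑ i, (k i : ℝ) * x i ≠ 0 := by
    let ℓ : (ι → ℤ) → ((ι → ℝ) →ₗ[ℝ] ℝ) := fun k =>
      ∑ i, (k i : ℝ) • LinearMap.proj i
    have hnull : ∀ k : {k : ι → ℤ // k ≠ 0},
        MeasureTheory.volume ((ℓ k).ker : Set (ι → ℝ)) = 0 := by
      intro k
      apply MeasureTheory.Measure.addHaar_submodule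
      intro htop
      apply k.2
      classical
      funext i
      have h1 : (Pi.single i 1 : ι → ℝ) ∈ (ℓ k).ker := htop ▸ Submodule.mem_top
      simpa [ℓ, Pi.single_apply] using h1
    have hU := MeasureTheory.measure_iUnion_null hnull
    by_contra! hcon
    have : (⋃ k : {k : ι → ℤ // k ≠ 0}, ((ℓ k).ker : Set (ι → ℝ))) = Set.univ := by
      refine Set.eq_univ_of_forall fun x => ?_
      obtain ⟨k, hk, hkx⟩ := hcon x
      exact Set.mem_iUnion.2 ⟨⟨k, hk⟩, by simpa [ℓ] using hkx⟩
    rw [this] at hU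
    exact isOpen_univ.measure_ne_zero MeasureTheory.volume Set.univ_nonempty hU
  refine ⟨x, fun s hs hsx => ?_⟩
  let Λ : AddSubgroup (ι → ℝ) :=
    ((ℝ ∙ x).toAddSubgroup ⊔ (intLattice ι).toAddSubgroup).topologicalClosure
  have hΛ : IsClosed (Λ : Set (ι → ℝ)) := AddSubgroup.isClosed_topologicalClosure _
  have hle : ∀ y ∈ (ℝ ∙ x).toAddSubgroup ⊔ (intLattice ι).toAddSubgroup, y ∈ Λ :=
    fun y hy => AddSubgroup.le_topologicalClosure _ hy
  have hZ : ∀ z ∈ intLattice ι, z ∈ Λ := fun z hz => hle z (AddSubgroup.mem_sup_right hz)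
  have hspan : Submodule.span ℝ (Λ : Set (ι → ℝ)) = ⊤ := by
    have : Submodule.span ℝ (intLattice ι : Set (ι → ℝ)) = ⊤ := IsZLattice.span_top
    rw [eq_top_iff, ← this]
    exact Submodule.span_mono hZ
  obtain ⟨m, M, -, hMs, -, hM⟩ := Λ.exists_linearMap_comap_intLattice hΛ hspan
  -- If a coordinate `j` existed, `M · j` would be a linear form with integer coefficients `k`. It
  -- is integer-valued on the line `ℝ x`, hence zero at `x`, so `k = 0` by independence; this
  -- contradicts surjectivity of `M`.
  have hm : m = 0 := by
    by_contra hm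
    have j : Fin m := ⟨0, Nat.pos_of_ne_zero hm⟩
    classical
    have hint : ∀ i, ∃ k : ℤ, (k : ℝ) = M (Pi.single i 1) j := by
      intro i
      refine mem_intLattice.1 ((hM _).1 (hZ _ ?_)) j
      rw [mem_intLattice]
      intro i'
      by_cases h : i' = i
      · subst h; exact ⟨1, by simp⟩
      · exact ⟨0, by simp [h]⟩
    choose k hk using hint
    have hMk : ∀ y, M y j = ∑ i, (k i : ℝ) * y i := by
      intro y
      conv_lhs => rw [pi_eq_sum_univ' y]
      simp [hk, mul_comm]
    have hline : ∀ t : ℝ, ∃ l : ℤ, (l : ℝ) = t * M x j := by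
      intro t
      have h1 : t • x ∈ Λ :=
        hle _ (AddSubgroup.mem_sup_left (Submodule.smul_mem _ t (Submodule.mem_span_singleton_self x)))
      obtain ⟨l, hl⟩ := mem_intLattice.1 ((hM _).1 h1) j
      exact ⟨l, by simpa using hl⟩
    have hMx : M x j = 0 := by
      by_contra h0
      obtain ⟨l, hl⟩ := hline ((2 * M x j)⁻¹)
      have : (2 : ℝ) * l = 1 := by rw [hl]; field_simp
      have h2 : (2 : ℤ) * l = 1 := by exact_mod_cast this
      omega
    by_cases hk0 : k = 0
    · obtain ⟨y, hy⟩ := hMs (Pi.single j 1)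
      have := hMk y
      rw [hy, hk0] at this
      simp at this
    · exact hx k hk0 (by rw [← hMk, hMx])
  subst hm
  refine Set.eq_univ_of_forall fun y => ?_
  have hy : y ∈ Λ := (hM y).2 (mem_intLattice.2 fun i => i.elim0)
  refine closure_minimal ?_ hs hy
  intro z hz
  obtain ⟨a, ha, b, hb, rfl⟩ := AddSubgroup.mem_sup.1 hz
  obtain ⟨t, rfl⟩ := Submodule.mem_span_singleton.1 ha
  exact hsx t b hb

/-! ### Lie groups through one chart at the identity -/

/-- A chart at the identity of a topological group in which multiplication and conjugation are
twice continuously differentiable near the origin. -/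
structure GroupChart (G E : Type*) [Group G] [TopologicalSpace G] [NormedAddCommGroup E]
    [NormedSpace ℝ E] where
  /-- The chart. -/
  chart : OpenPartialHomeomorph G E
  one_mem_source : (1 : G) ∈ chart.source
  map_one : chart 1 = 0
  contDiffAt_mul : ContDiffAt ℝ 2 (fun p : E × E => chart (chart.symm p.1 * chart.symm p.2)) 0
  contDiffAt_conj₂ : ContDiffAt ℝ 2
    (fun p : E × E => chart (chart.symm p.1 * chart.symm p.2 * (chart.symm p.1)⁻¹)) 0
  contDiffAt_conj : ∀ g : G, ContDiffAt ℝ 1 (fun x : E => chart (g * chart.symm x * g⁻¹)) 0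

namespace GroupChart

variable {G E V : Type*} [Group G] [TopologicalSpace G] [IsTopologicalGroup G]
  [NormedAddCommGroup E] [NormedSpace ℝ E]
  [NormedAddCommGroup V] [NormedSpace ℝ V]
  (C : GroupChart G E)

/-- Multiplication read in the chart. -/
def mul (p : E × E) : E := C.chart (C.chart.symm p.1 * C.chart.symm p.2)

omit [IsTopologicalGroup G] in
theorem symm_zero : C.chart.symm 0 = 1 := by
  rw [← C.map_one, C.chart.left_inv C.one_mem_source]

omit [IsTopologicalGroup G] in
theorem zero_mem_target : (0 : E) ∈ C.chart.target := by
  rw [← C.map_one]; exact C.chart.map_source C.one_mem_source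

omit [IsTopologicalGroup G] in
theorem tendsto_chart : Tendsto C.chart (𝓝 1) (𝓝 0) := by
  have := C.chart.continuousAt C.one_mem_source
  rwa [ContinuousAt, C.map_one] at this

omit [IsTopologicalGroup G] in
theorem tendsto_symm : Tendsto C.chart.symm (𝓝 0) (𝓝 1) := by
  have := C.chart.continuousAt_symm C.zero_mem_target
  rwa [ContinuousAt, C.symm_zero] at this

omit [IsTopologicalGroup G] in
theorem eventually_symm_chart : ∀ᶠ g in 𝓝 (1 : G), C.chart.symm (C.chart g) = g :=
  C.chart.eventually_left_inverse C.one_mem_source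

omit [IsTopologicalGroup G] in
theorem eventually_chart_symm : ∀ᶠ x in 𝓝 (0 : E), C.chart (C.chart.symm x) = x :=
  C.chart.eventually_right_inverse C.zero_mem_target

omit [IsTopologicalGroup G] in
theorem mul_zero_right : ∀ᶠ x in 𝓝 (0 : E), C.mul (x, 0) = x := by
  filter_upwards [C.eventually_chart_symm] with x hx
  rw [mul, C.symm_zero, mul_one, hx]

omit [IsTopologicalGroup G] in
theorem mul_zero_left : ∀ᶠ x in 𝓝 (0 : E), C.mul (0, x) = x := by
  filter_upwards [C.eventually_chart_symm] with x hx
  rw [mul, C.symm_zero, one_mul, hx]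

omit [IsTopologicalGroup G] in
theorem chart_mul {g h : G} (hg : C.chart.symm (C.chart g) = g) (hh : C.chart.symm (C.chart h) = h) :
    C.chart (g * h) = C.mul (C.chart g, C.chart h) := by
  simp only [mul, hg, hh]

omit [IsTopologicalGroup G] in
theorem fderiv_mul_zero :
    fderiv ℝ C.mul 0 = ContinuousLinearMap.fst ℝ E E + ContinuousLinearMap.snd ℝ E E := by
  have hd : HasFDerivAt C.mul (fderiv ℝ C.mul 0) (0, 0) :=
    (C.contDiffAt_mul.differentiableAt (by simp)).hasFDerivAt
  have h1 : HasFDerivAt (fun x : E => C.mul (x, 0))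
      ((fderiv ℝ C.mul 0).comp (ContinuousLinearMap.inl ℝ E E)) 0 :=
    HasFDerivAt.comp (𝕜 := ℝ) (g := C.mul) (f := fun x : E => (x, (0 : E))) 0 hd
      (hasFDerivAt_prodMk_left 0 0)
  have h2 : HasFDerivAt (fun x : E => C.mul (0, x))
      ((fderiv ℝ C.mul 0).comp (ContinuousLinearMap.inr ℝ E E)) 0 :=
    HasFDerivAt.comp (𝕜 := ℝ) (g := C.mul) (f := fun x : E => ((0 : E), x)) 0 hd
      (hasFDerivAt_prodMk_right 0 0)
  have h1' := h1.unique ((hasFDerivAt_id (𝕜 := ℝ) (0 : E)).congr_of_eventuallyEq C.mul_zero_right)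
  have h2' := h2.unique ((hasFDerivAt_id (𝕜 := ℝ) (0 : E)).congr_of_eventuallyEq C.mul_zero_left)
  ext x
  · simpa using congrArg (fun f : E →L[ℝ] E => f x) h1'
  · simpa using congrArg (fun f : E →L[ℝ] E => f x) h2'

omit [IsTopologicalGroup G] in
theorem hasStrictFDerivAt_mul : HasStrictFDerivAt C.mul
    (ContinuousLinearMap.fst ℝ E E + ContinuousLinearMap.snd ℝ E E) 0 := by
  rw [← C.fderiv_mul_zero]
  exact C.contDiffAt_mul.hasStrictFDerivAt (by simp)

/-- The left-invariant vector field with value `X` at the identity, read in the chart. -/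
noncomputable def field (X x : E) : E := fderiv ℝ C.mul (x, 0) (0, X)

omit [IsTopologicalGroup G] in
theorem field_zero (X : E) : C.field X 0 = X := by
  have h : ((0 : E), (0 : E)) = 0 := rfl
  simp [field, h, C.fderiv_mul_zero]

omit [IsTopologicalGroup G] in
theorem contDiffAt_field (X : E) : ContDiffAt ℝ 1 (C.field X) 0 := by
  have h : ContDiffAt ℝ 1 (fderiv ℝ C.mul) ((0 : E), (0 : E)) :=
    C.contDiffAt_mul.fderiv_right (by norm_num)
  have h2 : ContDiffAt ℝ 1 (fun x : E => fderiv ℝ C.mul (x, 0)) 0 :=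
    ContDiffAt.comp (g := fderiv ℝ C.mul) (f := fun x : E => (x, (0 : E))) 0 h (by fun_prop)
  exact h2.clm_apply contDiffAt_const

omit [IsTopologicalGroup G] in
/-- Right translates of curves through the identity are tangent to left-invariant fields. -/
theorem eventually_hasFDerivAt_mul :
    ∀ᶠ x in 𝓝 (0 : E), HasFDerivAt C.mul (fderiv ℝ C.mul (x, 0)) (x, 0) := by
  have h := (C.contDiffAt_mul.of_le (by norm_num : (1 : WithTop ℕ∞) ≤ 2)).eventually (by simp)
  have h2 : Tendsto (fun x : E => (x, (0 : E))) (𝓝 0) (𝓝 0) :=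
    Continuous.tendsto' (by fun_prop) _ _ rfl
  filter_upwards [h2.eventually h] with x hx
  exact (hx.differentiableAt (by simp)).hasFDerivAt

/-- A representation is smooth near the identity if its orbit maps are so in the chart. -/
def IsSmoothRep (ρ : Representation ℝ G V) : Prop :=
  ∀ v, ContDiffAt ℝ 1 (fun x : E => ρ (C.chart.symm x) v) 0

variable {C} {ρ : Representation ℝ G V}

/-- The differential of a smooth representation at the identity. -/
noncomputable def IsSmoothRep.diff (h : C.IsSmoothRep ρ) : E →ₗ[ℝ] V →ₗ[ℝ] V :=
  LinearMap.mk₂ ℝ (fun X v => fderiv ℝ (fun x : E => ρ (C.chart.symm x) v) 0 X)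
    (fun _ _ _ => map_add _ _ _) (fun _ _ _ => map_smul _ _ _)
    (fun X v w => by
      have h1 := (h v).differentiableAt (by simp)
      have h2 := (h w).differentiableAt (by simp)
      simp only [map_add]
      rw [fderiv_fun_add h1 h2]
      rfl)
    (fun c X v => by
      have h1 := (h v).differentiableAt (by simp)
      simp only [map_smul]
      rw [fderiv_fun_const_smul h1]
      rfl)

omit [IsTopologicalGroup G] in
theorem IsSmoothRep.diff_apply (h : C.IsSmoothRep ρ) (X : E) (v : V) :
    h.diff X v = fderiv ℝ (fun x : E => ρ (C.chart.symm x) v) 0 X := rfl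

omit [IsTopologicalGroup G] in
theorem IsSmoothRep.hasFDerivAt (h : C.IsSmoothRep ρ) (v : V) :
    HasFDerivAt (fun x : E => ρ (C.chart.symm x) v)
      (fderiv ℝ (fun x : E => ρ (C.chart.symm x) v) 0) 0 :=
  ((h v).differentiableAt (by simp)).hasFDerivAt

omit [IsTopologicalGroup G] in
theorem IsSmoothRep.hasDerivAt_of_hasDerivAt (h : C.IsSmoothRep ρ) (v : V) {c : ℝ → G} {X : E}
    (hc1 : c 0 = 1) (hc : ContinuousAt c 0) (hX : HasDerivAt (fun t => C.chart (c t)) X 0) :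
    HasDerivAt (fun t => ρ (c t) v) (h.diff X v) 0 := by
  have h1 : HasFDerivAt (fun x : E => ρ (C.chart.symm x) v)
      (fderiv ℝ (fun x : E => ρ (C.chart.symm x) v) 0) (C.chart (c 0)) := by
    rw [hc1, C.map_one]; exact h.hasFDerivAt v
  refine (h1.comp_hasDerivAt 0 hX).congr_of_eventuallyEq ?_
  rw [ContinuousAt, hc1] at hc
  filter_upwards [hc.eventually C.eventually_symm_chart] with t ht
  simp [ht]

variable [FiniteDimensional ℝ V]

theorem IsSmoothRep.continuous (h : C.IsSmoothRep ρ) (v : V) : Continuous (fun g => ρ g v) := by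
  have h1 : Tendsto (fun g => ρ g v) (𝓝 1) (𝓝 v) := by
    have h2 : Tendsto (fun x : E => ρ (C.chart.symm x) v) (𝓝 0) (𝓝 v) := by
      have := (h.hasFDerivAt v).continuousAt.tendsto
      simpa [C.symm_zero] using this
    refine (h2.comp C.tendsto_chart).congr' ?_
    filter_upwards [C.eventually_symm_chart] with g hg
    simp [hg]
  rw [continuous_iff_continuousAt]
  intro g
  have h3 : Tendsto (fun k : G => g⁻¹ * k) (𝓝 g) (𝓝 1) :=
    Continuous.tendsto' (by fun_prop) _ _ (by simp)
  have h4 : Continuous (ρ g) := (ρ g).continuous_of_finiteDimensional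
  have h5 := (h4.tendsto v).comp (h1.comp h3)
  refine h5.congr fun k => ?_
  simp only [Function.comp_apply, ← Module.End.mul_apply, ← map_mul, mul_inv_cancel_left]

/-- Differentiate `ρ (g k) v = ρ g (ρ k v)` in `k` at the identity. Consequently a vector killed by
`X` stays constant along integral curves of the left-invariant field of `X`. -/
theorem IsSmoothRep.fderiv_field (h : C.IsSmoothRep ρ) (X : E) (v : V) :
    ∀ᶠ x in 𝓝 (0 : E), fderiv ℝ (fun x : E => ρ (C.chart.symm x) v) x (C.field X x) =
      ρ (C.chart.symm x) (h.diff X v) := by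
  have hev := (h v).eventually (by simp)
  have htgt := C.chart.open_target.mem_nhds C.zero_mem_target
  filter_upwards [hev, htgt, C.eventually_hasFDerivAt_mul, C.mul_zero_right]
    with x hx hxt hmul hx0
  have hline : HasDerivAt (fun s : ℝ => (x, s • X)) ((0 : E), X) 0 := by
    refine (hasDerivAt_const (0 : ℝ) x).prodMk ?_
    simpa using (hasDerivAt_id (0 : ℝ)).smul_const X
  have h1 : HasDerivAt (fun s : ℝ => C.mul (x, s • X)) (C.field X x) 0 := by
    have : HasFDerivAt C.mul (fderiv ℝ C.mul (x, 0)) (x, (0 : ℝ) • X) := by simpa using hmul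
    exact this.comp_hasDerivAt 0 hline
  have h2 : HasDerivAt (fun s : ℝ => ρ (C.chart.symm (C.mul (x, s • X))) v)
      (fderiv ℝ (fun x : E => ρ (C.chart.symm x) v) x (C.field X x)) 0 := by
    have : HasFDerivAt (fun x : E => ρ (C.chart.symm x) v)
        (fderiv ℝ (fun x : E => ρ (C.chart.symm x) v) x) (C.mul (x, (0 : ℝ) • X)) := by
      rw [zero_smul, hx0]; exact (hx.differentiableAt (by simp)).hasFDerivAt
    exact this.comp_hasDerivAt 0 h1
  have h3 : HasDerivAt (fun s : ℝ => ρ (C.chart.symm x) (ρ (C.chart.symm (s • X)) v))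
      (ρ (C.chart.symm x) (h.diff X v)) 0 := by
    have h4 : HasDerivAt (fun s : ℝ => ρ (C.chart.symm (s • X)) v) (h.diff X v) 0 := by
      have h5 : HasDerivAt (fun s : ℝ => s • X) X 0 := by
        simpa using (hasDerivAt_id (0 : ℝ)).smul_const X
      have h6 : HasFDerivAt (fun x : E => ρ (C.chart.symm x) v)
          (fderiv ℝ (fun x : E => ρ (C.chart.symm x) v) 0) ((0 : ℝ) • X) := by
        simpa using h.hasFDerivAt v
      exact h6.comp_hasDerivAt 0 h5
    exact (LinearMap.toContinuousLinearMap (ρ (C.chart.symm x))).hasFDerivAt.comp_hasDerivAt 0 h4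
  refine h2.unique (h3.congr_of_eventuallyEq ?_)
  have hs : Tendsto (fun s : ℝ => C.chart.symm x * C.chart.symm (s • X)) (𝓝 0)
      (𝓝 (C.chart.symm x)) := by
    have h7 : Tendsto (fun s : ℝ => s • X) (𝓝 0) (𝓝 0) :=
      Continuous.tendsto' (by fun_prop) _ _ (by simp)
    simpa using (tendsto_const_nhds (x := C.chart.symm x)).mul (C.tendsto_symm.comp h7)
  filter_upwards [hs.eventually (C.chart.open_source.mem_nhds (C.chart.map_target hxt))] with s hs
  rw [mul, C.chart.left_inv hs, map_mul]
  rfl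

end GroupChart

/-! ### Integral curves and one-parameter subgroups -/

theorem eventually_eq_of_eventually_hasDerivAt_zero {V : Type*} [NormedAddCommGroup V]
    [NormedSpace ℝ V] {f : ℝ → V} {a : ℝ} (h : ∀ᶠ t in 𝓝 a, HasDerivAt f 0 t) :
    ∀ᶠ t in 𝓝 a, f t = f a := by
  obtain ⟨ε, hε, hb⟩ := Metric.eventually_nhds_iff_ball.1 h
  filter_upwards [Metric.ball_mem_nhds a hε] with t ht
  have := (convex_ball a ε).norm_image_sub_le_of_norm_hasDerivWithin_le (f := f) (f' := fun _ => 0)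
    (C := 0) (fun x hx => (hb x hx).hasDerivWithinAt) (by simp) (Metric.mem_ball_self hε) ht
  rw [zero_mul] at this
  exact sub_eq_zero.1 (norm_le_zero_iff.1 this)

namespace GroupChart

variable {G E V : Type*} [Group G] [TopologicalSpace G] [IsTopologicalGroup G]
  [NormedAddCommGroup E] [NormedSpace ℝ E]
  [NormedAddCommGroup V] [NormedSpace ℝ V]
  {C : GroupChart G E} {ρ : Representation ℝ G V}

/-- A direction killing a subspace `W` is tangent to a curve in the group fixing `W` pointwise. -/
theorem IsSmoothRep.exists_curve_fixing [CompleteSpace E] [FiniteDimensional ℝ V]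
    (h : C.IsSmoothRep ρ) {X : E} {W : Submodule ℝ V} (hX : ∀ w ∈ W, h.diff X w = 0) :
    ∃ c : ℝ → G, c 0 = 1 ∧ ContinuousAt c 0 ∧ HasDerivAt (fun t => C.chart (c t)) X 0 ∧
      ∀ᶠ t in 𝓝 0, ∀ w ∈ W, ρ (c t) w = w := by
  -- The curve is an integral curve of the left-invariant field of `X`; no exponential map is
  -- needed.
  obtain ⟨α, hα0, ε, hε, hα⟩ :=
    (C.contDiffAt_field X).exists_forall_mem_closedBall_exists_eq_forall_mem_Ioo_hasDerivAt₀ 0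
  have hev : ∀ᶠ t in 𝓝 (0 : ℝ), HasDerivAt α (C.field X (α t)) t := by
    filter_upwards [Ioo_mem_nhds (by linarith : 0 - ε < 0) (by linarith : 0 < 0 + ε)] with t ht
    exact hα t ht
  have hd0 : HasDerivAt α X 0 := by
    have := hev.self_of_nhds
    rwa [hα0, C.field_zero] at this
  have hαt : Tendsto α (𝓝 0) (𝓝 0) := by simpa [hα0] using hd0.continuousAt.tendsto
  have hc1 : C.chart.symm (α 0) = 1 := by rw [hα0, C.symm_zero]
  refine ⟨fun t => C.chart.symm (α t), hc1, ?_, ?_, ?_⟩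
  · rw [ContinuousAt, hc1]
    exact C.tendsto_symm.comp hαt
  · refine hd0.congr_of_eventuallyEq ?_
    filter_upwards [hαt.eventually C.eventually_chart_symm] with t ht using ht
  -- A finite generating set lets one neighbourhood of `0` serve all of `W`.
  · obtain ⟨s, hs⟩ : W.FG := IsNoetherian.noetherian W
    have hfix : ∀ w ∈ s, ∀ᶠ t in 𝓝 (0 : ℝ), ρ (C.chart.symm (α t)) w = w := by
      intro w hw
      have hw0 : h.diff X w = 0 := hX w (hs ▸ Submodule.subset_span hw)
      have h1 : ∀ᶠ t in 𝓝 (0 : ℝ), HasDerivAt (fun t => ρ (C.chart.symm (α t)) w) 0 t := by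
        filter_upwards [hev, hαt.eventually (h.fderiv_field X w),
          hαt.eventually ((h w).eventually (by simp))] with t h1 h2 h3
        have := (h3.differentiableAt (by simp)).hasFDerivAt.comp_hasDerivAt t h1
        rw [h2, hw0, map_zero] at this
        exact this
      filter_upwards [eventually_eq_of_eventually_hasDerivAt_zero h1] with t ht
      rw [ht, hc1, _root_.map_one]
      rfl
    filter_upwards [(Finset.eventually_all s).2 hfix] with t ht w hw
    have : W ≤ LinearMap.eqLocus (ρ (C.chart.symm (α t))) LinearMap.id := by
      rw [← hs, Submodule.span_le]
      exact fun w hw => ht w hw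
    exact this hw

/-- A continuous one-parameter subgroup. -/
structure _root_.IsOneParam (c : ℝ → G) : Prop where
  continuous : Continuous c
  map_add : ∀ s t, c (s + t) = c s * c t

omit [IsTopologicalGroup G] in
theorem _root_.IsOneParam.map_zero {c : ℝ → G} (hc : IsOneParam c) : c 0 = 1 := by
  have := hc.map_add 0 0
  simpa using this

omit [IsTopologicalGroup G] in
theorem _root_.IsOneParam.tendsto {c : ℝ → G} (hc : IsOneParam c) : Tendsto c (𝓝 0) (𝓝 1) := by
  simpa [hc.map_zero] using hc.continuous.tendsto 0

omit [IsTopologicalGroup G] in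
theorem _root_.IsOneParam.map_natCast_mul {c : ℝ → G} (hc : IsOneParam c) (n : ℕ) (t : ℝ) :
    c (n * t) = c t ^ n := by
  induction n with
  | zero => simp [hc.map_zero]
  | succ n ih => rw [pow_succ, ← ih, ← hc.map_add]; push_cast; ring_nf

-- Continuity is promoted to differentiability. In the chart, `ξ (a + b) - ξ a` equals `ξ b` up to
-- half its norm; averaging over `a` bounds `ξ b` linearly in `b`. Hence `ξ` is Lipschitz near `0`,
-- so differentiable at some `a` by Rademacher's theorem, and multiplication by `c (-a)` moves this
-- to `0`.
omit [IsTopologicalGroup G] in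
theorem differentiableAt_chart_oneParam [FiniteDimensional ℝ E] (C : GroupChart G E) {c : ℝ → G}
    (hc : IsOneParam c) : DifferentiableAt ℝ (fun t => C.chart (c t)) 0 := by
  set ξ : ℝ → E := fun t => C.chart (c t) with hξ
  have hξ0 : ξ 0 = 0 := by simp [hξ, hc.map_zero, C.map_one]
  -- Any constant below `1` would do: it leaves a positive fraction of `‖ξ b‖` to be bounded.
  obtain ⟨s, hs, happ⟩ := C.hasStrictFDerivAt_mul.approximates_deriv_on_nhds
    (c := 1 / 2) (Or.inr (by norm_num))
  have hdiff : ∀ᶠ p in 𝓝 (0 : E × E), DifferentiableAt ℝ C.mul p := by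
    filter_upwards [(C.contDiffAt_mul.of_le (by norm_num : (1 : WithTop ℕ∞) ≤ 2)).eventually
      (by simp)] with p hp
    exact hp.differentiableAt (by simp)
  obtain ⟨r, hr, hball⟩ := Metric.mem_nhds_iff.1 (inter_mem hs hdiff)
  have hsub : ∀ x y : E, ‖x‖ < r → ‖y‖ < r → (x, y) ∈ s ∧ DifferentiableAt ℝ C.mul (x, y) := by
    intro x y hx hy
    apply hball
    simp [Prod.norm_def, hx, hy]
  have hnear : ∀ᶠ t in 𝓝 (0 : ℝ), c t ∈ C.chart.source ∧ ‖ξ t‖ < r := by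
    have h1 := hc.tendsto.eventually (C.chart.open_source.mem_nhds C.one_mem_source)
    have h2 : Tendsto ξ (𝓝 0) (𝓝 0) := C.tendsto_chart.comp hc.tendsto
    have h3 := h2.norm.eventually (gt_mem_nhds (by simpa using hr))
    exact h1.and h3
  obtain ⟨δ', hδ', hδs⟩ := Metric.eventually_nhds_iff_ball.1 hnear
  obtain ⟨δ, hδ, hδδ⟩ : ∃ δ > 0, δ' = 3 * δ := ⟨δ' / 3, by linarith, by ring⟩
  have hsrc : ∀ t, |t| < 3 * δ → c t ∈ C.chart.source := fun t ht =>
    (hδs t (by simpa [hδδ] using ht)).1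
  have hnorm : ∀ t, |t| < 3 * δ → ‖ξ t‖ < r := fun t ht =>
    (hδs t (by simpa [hδδ] using ht)).2
  have hmul : ∀ a b, |a| < 3 * δ → |b| < 3 * δ → ξ (a + b) = C.mul (ξ a, ξ b) := by
    intro a b ha hb
    simp only [hξ, hc.map_add]
    exact C.chart_mul (C.chart.left_inv (hsrc a ha)) (C.chart.left_inv (hsrc b hb))
  have hzero : |(0 : ℝ)| < 3 * δ := by simp [hδ]
  have hest : ∀ a b, |a| < 3 * δ → |b| < 3 * δ → ‖ξ (a + b) - ξ a - ξ b‖ ≤ 1 / 2 * ‖ξ b‖ := by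
    intro a b ha hb
    have h1 : ξ (a + b) = C.mul (ξ b, ξ a) := by rw [add_comm, hmul b a hb ha]
    have h2 : ξ a = C.mul (0, ξ a) := by
      have := hmul 0 a hzero ha
      rwa [zero_add, hξ0] at this
    have := happ (ξ b, ξ a) (hsub _ _ (hnorm b hb) (hnorm a ha)).1 (0, ξ a)
      (hsub _ _ (by simpa using hr) (hnorm a ha)).1
    rw [← h1, ← h2] at this
    simpa using this
  have hcont : ContinuousOn ξ (Set.Ioo (-(3 * δ)) (3 * δ)) := by
    intro t ht
    exact ((C.chart.continuousAt (hsrc t (abs_lt.2 ht))).comp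
      hc.continuous.continuousAt).continuousWithinAt
  have hint : ∀ a b, |a| < 3 * δ → |b| < 3 * δ →
      IntervalIntegrable ξ MeasureTheory.volume a b := by
    intro a b ha hb
    refine (hcont.mono ?_).intervalIntegrable
    exact (Set.ordConnected_Ioo.uIcc_subset (abs_lt.1 ha) (abs_lt.1 hb))
  have hlip0 : ∀ t, |t| < δ → ‖ξ t‖ ≤ 4 * r / δ * |t| := by
    intro t ht
    have ht3 : |t| < 3 * δ := by linarith
    have hδ3 : |δ| < 3 * δ := by rw [abs_of_pos hδ]; linarith
    have hdt : |δ + t| < 3 * δ := by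
      have := abs_add_le δ t
      rw [abs_of_pos hδ] at this
      linarith
    have hI1 : IntervalIntegrable (fun s => ξ (s + t)) MeasureTheory.volume 0 δ := by
      have := (hint t (δ + t) ht3 hdt).comp_add_right t
      simpa using this
    -- The two integrals overlap except on intervals of length `|t|` at either end, which is where
    -- the factor `|t|` in the bound comes from.
    have hU : ∫ s in (0 : ℝ)..δ, (ξ (s + t) - ξ s) =
        (∫ s in δ..(δ + t), ξ s) - ∫ s in (0 : ℝ)..t, ξ s := by
      rw [intervalIntegral.integral_sub hI1 (hint 0 δ hzero hδ3),
        intervalIntegral.integral_comp_add_right, zero_add]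
      have h1 := intervalIntegral.integral_add_adjacent_intervals (hint 0 t hzero ht3)
        (hint t (δ + t) ht3 hdt)
      have h2 := intervalIntegral.integral_add_adjacent_intervals (hint 0 δ hzero hδ3)
        (hint δ (δ + t) hδ3 hdt)
      rw [← h1] at h2
      rw [sub_eq_sub_iff_add_eq_add, add_comm, ← h2, add_comm]
    have hb1 : ‖∫ s in δ..(δ + t), ξ s‖ ≤ r * |t| := by
      have := intervalIntegral.norm_integral_le_of_norm_le_const (f := ξ) (a := δ) (b := δ + t)
        (C := r) (fun x hx => (hnorm x (abs_lt.2 (Set.ordConnected_Ioo.uIcc_subset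
          (abs_lt.1 hδ3) (abs_lt.1 hdt) (Set.uIoc_subset_uIcc hx)))).le)
      simpa using this
    have hb2 : ‖∫ s in (0 : ℝ)..t, ξ s‖ ≤ r * |t| := by
      have := intervalIntegral.norm_integral_le_of_norm_le_const (f := ξ) (a := 0) (b := t)
        (C := r) (fun x hx => (hnorm x (abs_lt.2 (Set.ordConnected_Ioo.uIcc_subset
          (abs_lt.1 hzero) (abs_lt.1 ht3) (Set.uIoc_subset_uIcc hx)))).le)
      simpa using this
    have hb3 : ‖(∫ s in (0 : ℝ)..δ, (ξ (s + t) - ξ s)) - δ • ξ t‖ ≤ 1 / 2 * ‖ξ t‖ * δ := by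
      have h1 : (∫ s in (0 : ℝ)..δ, (ξ (s + t) - ξ s)) - δ • ξ t =
          ∫ s in (0 : ℝ)..δ, (ξ (s + t) - ξ s - ξ t) := by
        rw [intervalIntegral.integral_sub (hI1.sub (hint 0 δ hzero hδ3))
          intervalIntegrable_const, intervalIntegral.integral_const, sub_zero]
      rw [h1]
      have := intervalIntegral.norm_integral_le_of_norm_le_const
        (f := fun s => ξ (s + t) - ξ s - ξ t) (a := 0) (b := δ) (C := 1 / 2 * ‖ξ t‖)
        (fun x hx => hest x t (abs_lt.2 (Set.ordConnected_Ioo.uIcc_subset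
          (abs_lt.1 hzero) (abs_lt.1 hδ3) (Set.uIoc_subset_uIcc hx))) ht3)
      rwa [sub_zero, abs_of_pos hδ] at this
    have hb4 : δ * ‖ξ t‖ ≤ 2 * r * |t| + 1 / 2 * ‖ξ t‖ * δ := by
      have h1 : ‖δ • ξ t‖ = δ * ‖ξ t‖ := by rw [norm_smul, Real.norm_of_nonneg hδ.le]
      rw [← h1]
      have h2 := norm_sub_le (∫ s in (0 : ℝ)..δ, (ξ (s + t) - ξ s))
        ((∫ s in (0 : ℝ)..δ, (ξ (s + t) - ξ s)) - δ • ξ t)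
      rw [sub_sub_cancel] at h2
      have h3 : ‖∫ s in (0 : ℝ)..δ, (ξ (s + t) - ξ s)‖ ≤ 2 * r * |t| := by
        rw [hU]
        refine (norm_sub_le _ _).trans ?_
        linarith
      linarith
    rw [div_mul_eq_mul_div, le_div_iff₀ hδ]
    linarith
  have hK : 0 ≤ 6 * r / δ := by positivity
  have hlip : LipschitzOnWith (Real.toNNReal (6 * r / δ)) ξ (Set.Ioo (-(δ / 2)) (δ / 2)) := by
    refine LipschitzOnWith.of_dist_le_mul fun x hx y hy => ?_
    rw [Real.coe_toNNReal _ hK, dist_eq_norm, Real.dist_eq]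
    have hxy : |x - y| < δ := by
      rw [abs_lt]; constructor <;> linarith [hx.1, hx.2, hy.1, hy.2]
    have hy3 : |y| < 3 * δ := by
      rw [abs_lt]; constructor <;> linarith [hy.1, hy.2]
    have h1 := hest y (x - y) hy3 (by linarith)
    rw [add_sub_cancel] at h1
    have h2 := hlip0 (x - y) hxy
    have h3 : ‖ξ x - ξ y‖ ≤ ‖ξ x - ξ y - ξ (x - y)‖ + ‖ξ (x - y)‖ := by
      simpa using norm_add_le (ξ x - ξ y - ξ (x - y)) (ξ (x - y))
    calc ‖ξ x - ξ y‖ ≤ 3 / 2 * ‖ξ (x - y)‖ := by linarith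
      _ ≤ 3 / 2 * (4 * r / δ * |x - y|) := by gcongr
      _ = 6 * r / δ * |x - y| := by ring
  obtain ⟨a, ha, hda⟩ : ∃ a ∈ Set.Ioo (-(δ / 2)) (δ / 2), DifferentiableAt ℝ ξ a := by
    have hae := hlip.ae_differentiableWithinAt_real measurableSet_Ioo
    have hne : MeasureTheory.volume.restrict (Set.Ioo (-(δ / 2)) (δ / 2)) ≠ 0 := by
      rw [Ne, MeasureTheory.Measure.restrict_eq_zero, Real.volume_Ioo]
      simp
      linarith
    have : (MeasureTheory.ae
        (MeasureTheory.volume.restrict (Set.Ioo (-(δ / 2)) (δ / 2)))).NeBot :=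
      MeasureTheory.ae_neBot.2 hne
    obtain ⟨a, h1, h2⟩ := (hae.and (MeasureTheory.ae_restrict_mem measurableSet_Ioo)).exists
    exact ⟨a, h2, h1.differentiableAt (Ioo_mem_nhds h2.1 h2.2)⟩
  have ha3 : |a| < 3 * δ := by rw [abs_lt]; constructor <;> linarith [ha.1, ha.2]
  have hna3 : |-a| < 3 * δ := by rwa [abs_neg]
  have hd1 : DifferentiableAt ℝ (fun t => (ξ (-a), ξ (a + t))) 0 := by
    refine (differentiableAt_const _).prodMk ?_
    have : DifferentiableAt ℝ ξ (a + 0) := by simpa using hda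
    exact DifferentiableAt.comp (g := ξ) (0 : ℝ) this (by fun_prop)
  have hd2 : DifferentiableAt ℝ (fun t => C.mul (ξ (-a), ξ (a + t))) 0 := by
    have : DifferentiableAt ℝ C.mul (ξ (-a), ξ (a + 0)) := by
      rw [add_zero]; exact (hsub _ _ (hnorm _ hna3) (hnorm _ ha3)).2
    exact DifferentiableAt.comp (g := C.mul) (f := fun t => (ξ (-a), ξ (a + t))) (0 : ℝ) this hd1
  refine hd2.congr_of_eventuallyEq ?_
  filter_upwards [Metric.ball_mem_nhds (0 : ℝ) hδ] with t ht
  have ht' : |t| < δ := by simpa using ht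
  have hat : |a + t| < 3 * δ := by
    have := abs_add_le a t
    have : |a| < δ := by rw [abs_lt]; constructor <;> linarith [ha.1, ha.2]
    linarith
  rw [← hmul (-a) (a + t) hna3 hat, neg_add_cancel_left]

/-- The velocity at the identity of a one-parameter subgroup. -/
noncomputable def velocity (C : GroupChart G E) (c : ℝ → G) : E :=
  deriv (fun t => C.chart (c t)) 0

omit [IsTopologicalGroup G] in
theorem hasDerivAt_velocity [FiniteDimensional ℝ E] (C : GroupChart G E) {c : ℝ → G}
    (hc : IsOneParam c) : HasDerivAt (fun t => C.chart (c t)) (C.velocity c) 0 :=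
  (C.differentiableAt_chart_oneParam hc).hasDerivAt

omit [IsTopologicalGroup G] in
theorem IsSmoothRep.hasDerivAt_oneParam [FiniteDimensional ℝ E] [FiniteDimensional ℝ V]
    (h : C.IsSmoothRep ρ) {c : ℝ → G} (hc : IsOneParam c) (v : V) (t : ℝ) :
    HasDerivAt (fun t => ρ (c t) v) (ρ (c t) (h.diff (C.velocity c) v)) t := by
  have h1 := h.hasDerivAt_of_hasDerivAt v hc.map_zero hc.continuous.continuousAt
    (C.hasDerivAt_velocity hc)
  have h1' : HasDerivAt (fun s => ρ (c s) v) (h.diff (C.velocity c) v) (t - t) := by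
    rwa [sub_self]
  have h2 := h1'.comp_sub_const t t
  have h3 := (LinearMap.toContinuousLinearMap (ρ (c t))).hasFDerivAt.comp_hasDerivAt t h2
  refine h3.congr_of_eventuallyEq (Eventually.of_forall fun s => ?_)
  simp only [Function.comp_apply, LinearMap.coe_toContinuousLinearMap']
  rw [← Module.End.mul_apply, ← map_mul, ← hc.map_add, add_sub_cancel]

omit [IsTopologicalGroup G] in
theorem IsSmoothRep.oneParam_apply_eq [FiniteDimensional ℝ E] [FiniteDimensional ℝ V]
    (h : C.IsSmoothRep ρ) {c : ℝ → G} (hc : IsOneParam c) {v : V}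
    (hv : h.diff (C.velocity c) v = 0) (t : ℝ) : ρ (c t) v = v := by
  have h1 : ∀ s, HasDerivAt (fun t => ρ (c t) v) 0 s := by
    intro s
    have := h.hasDerivAt_oneParam hc v s
    rwa [hv, map_zero] at this
  have h2 := is_const_of_deriv_eq_zero (fun s => (h1 s).differentiableAt)
    (fun s => (h1 s).deriv) t 0
  simpa [hc.map_zero] using h2

omit [IsTopologicalGroup G] in
/-- One-parameter subgroups are determined by their velocity. -/
theorem oneParam_eq_of_velocity_eq [FiniteDimensional ℝ E] (C : GroupChart G E) {c c' : ℝ → G}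
    (hc : IsOneParam c) (hc' : IsOneParam c') (h : C.velocity c = C.velocity c') : c = c' := by
  -- By `b s = b t * b (s - t)`, a one-parameter subgroup is an integral curve of the left-invariant
  -- field of its velocity. Local uniqueness then gives equality near `0`.
  have hode : ∀ {b : ℝ → G}, IsOneParam b →
      ∀ᶠ t in 𝓝 (0 : ℝ), HasDerivAt (fun t => C.chart (b t))
        (C.field (C.velocity b) (C.chart (b t))) t := by
    intro b hb
    have htend : Tendsto (fun t => C.chart (b t)) (𝓝 0) (𝓝 0) := C.tendsto_chart.comp hb.tendsto
    filter_upwards [htend.eventually C.eventually_hasFDerivAt_mul,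
      hb.tendsto.eventually C.eventually_symm_chart] with t ht hts
    have h1 : HasDerivAt (fun s => C.chart (b s)) (C.velocity b) (t - t) := by
      rw [sub_self]; exact C.hasDerivAt_velocity hb
    have h2 := (hasDerivAt_const t (C.chart (b t))).prodMk (h1.comp_sub_const t t)
    have h3 : HasFDerivAt C.mul (fderiv ℝ C.mul (C.chart (b t), 0))
        (C.chart (b t), C.chart (b (t - t))) := by
      rw [sub_self, hb.map_zero, C.map_one]; exact ht
    refine (h3.comp_hasDerivAt t h2).congr_of_eventuallyEq ?_
    have hsub : Tendsto (fun s => b (s - t)) (𝓝 t) (𝓝 1) :=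
      hb.tendsto.comp (Continuous.tendsto' (by fun_prop) _ _ (by simp))
    filter_upwards [hsub.eventually C.eventually_symm_chart] with s hs
    simp only [Function.comp_apply]
    rw [← C.chart_mul hts hs, ← hb.map_add, add_sub_cancel]
  obtain ⟨K, s, hs, hlip⟩ := (C.contDiffAt_field (C.velocity c)).exists_lipschitzOnWith
  have hmem : ∀ {b : ℝ → G}, IsOneParam b → ∀ᶠ t in 𝓝 (0 : ℝ), C.chart (b t) ∈ s :=
    fun hb => (C.tendsto_chart.comp hb.tendsto).eventually hs
  have heq := ODE_solution_unique_of_eventually (v := fun _ => C.field (C.velocity c))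
    (s := fun _ => s) (t₀ := 0) (Eventually.of_forall fun _ => hlip)
    ((hode hc).and (hmem hc)) ((h ▸ hode hc').and (hmem hc')) (by simp [hc.map_zero, hc'.map_zero])
  have heq2 : ∀ᶠ t in 𝓝 (0 : ℝ), c t = c' t := by
    filter_upwards [heq, hc.tendsto.eventually C.eventually_symm_chart,
      hc'.tendsto.eventually C.eventually_symm_chart] with t h1 h2 h3
    rw [← h2, ← h3, h1]
  funext t
  -- Equality near `0` spreads to every `t` by taking powers of the value at `t / (n + 1)`.
  have hlim : Tendsto (fun n : ℕ => t / ((n : ℝ) + 1)) atTop (𝓝 0) := by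
    have := (tendsto_one_div_add_atTop_nhds_zero_nat (𝕜 := ℝ)).const_mul t
    simpa [div_eq_mul_inv] using this
  obtain ⟨n, hn⟩ := (hlim.eventually heq2).exists
  have hne : ((n + 1 : ℕ) : ℝ) * (t / ((n : ℝ) + 1)) = t := by
    push_cast
    field_simp
  rw [← hne, hc.map_natCast_mul, hc'.map_natCast_mul, hn]

end GroupChart

/-! ### Invariant inner products -/

theorem exists_linearEquiv_euclidean_of_posDef {V : Type*} [AddCommGroup V] [Module ℝ V]
    [FiniteDimensional ℝ V] (B : V →ₗ[ℝ] V →ₗ[ℝ] ℝ) (hsymm : ∀ v w, B v w = B w v)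
    (hpos : ∀ v, v ≠ 0 → 0 < B v v) :
    ∃ e : V ≃ₗ[ℝ] EuclideanSpace ℝ (Fin (Module.finrank ℝ V)),
      ∀ v w, inner ℝ (e v) (e w) = B v w := by
  have hnn : ∀ v, 0 ≤ B v v := by
    intro v
    by_cases h : v = 0
    · simp [h]
    · exact (hpos v h).le
  let core : InnerProductSpace.Core ℝ V :=
    { inner := fun v w => B v w
      conj_inner_symm := fun v w => by simpa using hsymm w v
      re_inner_nonneg := fun v => by simpa using hnn v
      add_left := fun u v w => by simp
      smul_left := fun u v r => by simp
      definite := fun v hv => by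
        by_contra h
        exact (hpos v h).ne' hv }
  let _ : NormedAddCommGroup V := core.toNormedAddCommGroup
  let _ : InnerProductSpace ℝ V := InnerProductSpace.ofCore core.toCore
  let e := (stdOrthonormalBasis ℝ V).repr
  exact ⟨e.toLinearEquiv, fun v w => e.inner_map_map v w⟩

/-- A continuous finite-dimensional representation of a compact group preserves a Euclidean
norm. -/
theorem Representation.exists_linearEquiv_euclidean {G V : Type*} [Group G] [TopologicalSpace G]
    [IsTopologicalGroup G] [CompactSpace G] [NormedAddCommGroup V] [NormedSpace ℝ V]
    [FiniteDimensional ℝ V] (ρ : Representation ℝ G V) (hρ : ∀ v, Continuous fun g => ρ g v) :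
    ∃ e : V ≃ₗ[ℝ] EuclideanSpace ℝ (Fin (Module.finrank ℝ V)),
      ∀ g v w, inner ℝ (e (ρ g v)) (e (ρ g w)) = inner ℝ (e v) (e w) := by
  borelize G
  let μ : MeasureTheory.Measure G := MeasureTheory.Measure.haar
  let e₀ : V ≃ₗ[ℝ] EuclideanSpace ℝ (Fin (Module.finrank ℝ V)) :=
    LinearEquiv.ofFinrankEq _ _ (by simp)
  have he₀ : Continuous e₀ := e₀.toLinearMap.continuous_of_finiteDimensional
  have hcont : ∀ v w, Continuous fun g : G => inner ℝ (e₀ (ρ g⁻¹ v)) (e₀ (ρ g⁻¹ w)) := fun v w =>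
    (he₀.comp ((hρ v).comp continuous_inv)).inner (he₀.comp ((hρ w).comp continuous_inv))
  have hint : ∀ v w, MeasureTheory.Integrable
      (fun g : G => inner ℝ (e₀ (ρ g⁻¹ v)) (e₀ (ρ g⁻¹ w))) μ := fun v w =>
    (hcont v w).integrable_of_hasCompactSupport (HasCompactSupport.of_compactSpace _)
  -- Haar averaging; the inverse turns the action on both vectors into a left translation of the
  -- integration variable.
  let B : V →ₗ[ℝ] V →ₗ[ℝ] ℝ := LinearMap.mk₂ ℝ
    (fun v w => ∫ g, inner ℝ (e₀ (ρ g⁻¹ v)) (e₀ (ρ g⁻¹ w)) ∂μ)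
    (fun v v' w => by
      simp only [map_add, inner_add_left]
      exact MeasureTheory.integral_add (hint v w) (hint v' w))
    (fun c v w => by
      simp only [map_smul, real_inner_smul_left]
      exact MeasureTheory.integral_const_mul _ _)
    (fun v w w' => by
      simp only [map_add, inner_add_right]
      exact MeasureTheory.integral_add (hint v w) (hint v w'))
    (fun c v w => by
      simp only [map_smul, real_inner_smul_right]
      exact MeasureTheory.integral_const_mul _ _)
  have hB : ∀ v w, B v w = ∫ g, inner ℝ (e₀ (ρ g⁻¹ v)) (e₀ (ρ g⁻¹ w)) ∂μ := fun v w => rfl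
  obtain ⟨e, he⟩ := exists_linearEquiv_euclidean_of_posDef B
    (fun v w => by simp only [hB, real_inner_comm])
    (fun v hv => by
      rw [hB]
      refine (hcont v v).integral_pos_of_hasCompactSupport_nonneg_nonzero
        (HasCompactSupport.of_compactSpace _) (fun g => real_inner_self_nonneg) (x := 1) ?_
      simpa using hv)
  refine ⟨e, fun g v w => ?_⟩
  rw [he, he, hB, hB]
  have := MeasureTheory.integral_mul_left_eq_self (μ := μ)
    (fun k : G => inner ℝ (e₀ (ρ k⁻¹ v)) (e₀ (ρ k⁻¹ w))) g⁻¹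
  rw [← this]
  congr 1
  funext k
  simp [mul_inv_rev, map_mul, Module.End.mul_apply]

/-! ### The adjoint representation -/

namespace GroupChart

variable {G E V : Type*} [Group G] [TopologicalSpace G] [IsTopologicalGroup G]
  [NormedAddCommGroup E] [NormedSpace ℝ E]
  [NormedAddCommGroup V] [NormedSpace ℝ V]
  {ρ : Representation ℝ G V}

omit [IsTopologicalGroup G] in
theorem velocity_mul [FiniteDimensional ℝ E] (C : GroupChart G E) {c c' : ℝ → G}
    (hc : IsOneParam c) (hc' : IsOneParam c') :
    C.velocity (fun t => c t * c' t) = C.velocity c + C.velocity c' := by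
  have h1 := (C.hasDerivAt_velocity hc).prodMk (C.hasDerivAt_velocity hc')
  have h2 : HasFDerivAt C.mul (ContinuousLinearMap.fst ℝ E E + ContinuousLinearMap.snd ℝ E E)
      (C.chart (c 0), C.chart (c' 0)) := by
    rw [hc.map_zero, hc'.map_zero, C.map_one]
    exact C.hasStrictFDerivAt_mul.hasFDerivAt
  have h3 := h2.comp_hasDerivAt 0 h1
  have h4 : HasDerivAt (fun t => C.chart (c t * c' t)) (C.velocity c + C.velocity c') 0 := by
    refine HasDerivAt.congr_of_eventuallyEq (by simpa using h3) ?_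
    filter_upwards [hc.tendsto.eventually C.eventually_symm_chart,
      hc'.tendsto.eventually C.eventually_symm_chart] with t ht ht'
    exact C.chart_mul ht ht'
  exact h4.deriv

omit [IsTopologicalGroup G] in
theorem velocity_comp_mul [FiniteDimensional ℝ E] (C : GroupChart G E) {c : ℝ → G}
    (hc : IsOneParam c) (a : ℝ) : C.velocity (fun t => c (t * a)) = a • C.velocity c := by
  have h1 : HasDerivAt (fun t => C.chart (c t)) (C.velocity c) ((0 : ℝ) * a) := by
    rw [zero_mul]; exact C.hasDerivAt_velocity hc
  have h2 := h1.scomp (0 : ℝ) ((hasDerivAt_id (0 : ℝ)).mul_const a)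
  rw [one_mul] at h2
  exact h2.deriv

omit [IsTopologicalGroup G] in
theorem _root_.isOneParam_line {F : Type*} [AddCommGroup F] [Module ℝ F] [TopologicalSpace F]
    [ContinuousSMul ℝ F] {ψ : F → G} (hψ : Continuous ψ) (hadd : ∀ x y, ψ (x + y) = ψ x * ψ y)
    (x : F) : IsOneParam fun t : ℝ => ψ (t • x) where
  continuous := hψ.comp (by fun_prop)
  map_add s t := by rw [add_smul, hadd]

/-- The differential of a continuous homomorphism from a vector space. -/
noncomputable def velocityMap [FiniteDimensional ℝ E] (C : GroupChart G E) {F : Type*}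
    [AddCommGroup F] [Module ℝ F] [TopologicalSpace F] [ContinuousSMul ℝ F] {ψ : F → G}
    (hψ : Continuous ψ) (hadd : ∀ x y, ψ (x + y) = ψ x * ψ y) : F →ₗ[ℝ] E where
  toFun x := C.velocity fun t => ψ (t • x)
  map_add' x y := by
    rw [← C.velocity_mul (isOneParam_line hψ hadd x) (isOneParam_line hψ hadd y)]
    simp only [smul_add, hadd]
  map_smul' a x := by
    rw [RingHom.id_apply, ← C.velocity_comp_mul (isOneParam_line hψ hadd x)]
    simp only [smul_smul]

theorem tendsto_conj_symm (C : GroupChart G E) (g : G) :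
    Tendsto (fun x : E => g * C.chart.symm x * g⁻¹) (𝓝 0) (𝓝 1) := by
  have h : Continuous fun k : G => g * k * g⁻¹ := by fun_prop
  exact (h.tendsto' 1 1 (by simp)).comp C.tendsto_symm

/-- The adjoint representation. -/
noncomputable def Ad (C : GroupChart G E) : Representation ℝ G E where
  toFun g := (fderiv ℝ (fun x : E => C.chart (g * C.chart.symm x * g⁻¹)) 0).toLinearMap
  map_one' := by
    have : HasFDerivAt (fun x : E => C.chart (1 * C.chart.symm x * 1⁻¹))
        (ContinuousLinearMap.id ℝ E) 0 := by
      refine (hasFDerivAt_id (0 : E)).congr_of_eventuallyEq ?_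
      filter_upwards [C.eventually_chart_symm] with x hx
      simpa using hx
    rw [this.fderiv]
    rfl
  map_mul' g h := by
    have hg : HasFDerivAt (fun x : E => C.chart (g * C.chart.symm x * g⁻¹))
        (fderiv ℝ (fun x : E => C.chart (g * C.chart.symm x * g⁻¹)) 0)
        (C.chart (h * C.chart.symm 0 * h⁻¹)) := by
      rw [C.symm_zero, mul_one, mul_inv_cancel, C.map_one]
      exact ((C.contDiffAt_conj g).differentiableAt (by simp)).hasFDerivAt
    have hh := ((C.contDiffAt_conj h).differentiableAt (by simp)).hasFDerivAt
    have hgh : HasFDerivAt (fun x : E => C.chart (g * h * C.chart.symm x * (g * h)⁻¹))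
        ((fderiv ℝ (fun x : E => C.chart (g * C.chart.symm x * g⁻¹)) 0).comp
          (fderiv ℝ (fun x : E => C.chart (h * C.chart.symm x * h⁻¹)) 0)) 0 := by
      refine (hg.comp 0 hh).congr_of_eventuallyEq ?_
      filter_upwards [(C.tendsto_conj_symm h).eventually C.eventually_symm_chart] with x hx
      simp only [Function.comp_apply, hx]
      simp only [mul_inv_rev, mul_assoc]
    rw [hgh.fderiv]
    rfl

omit [IsTopologicalGroup G] in
theorem hasFDerivAt_Ad (C : GroupChart G E) (g : G) :
    HasFDerivAt (fun x : E => C.chart (g * C.chart.symm x * g⁻¹))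
      (fderiv ℝ (fun x : E => C.chart (g * C.chart.symm x * g⁻¹)) 0) 0 :=
  ((C.contDiffAt_conj g).differentiableAt (by simp)).hasFDerivAt

theorem Ad_apply (C : GroupChart G E) (g : G) (X : E) :
    C.Ad g X = fderiv ℝ (fun x : E => C.chart (g * C.chart.symm x * g⁻¹)) 0 X := rfl

theorem velocity_conj [FiniteDimensional ℝ E] (C : GroupChart G E) {c : ℝ → G}
    (hc : IsOneParam c) (g : G) : C.velocity (fun t => g * c t * g⁻¹) = C.Ad g (C.velocity c) := by
  have h1 := C.hasFDerivAt_Ad g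
  have h2 : HasFDerivAt (fun x : E => C.chart (g * C.chart.symm x * g⁻¹))
      (fderiv ℝ (fun x : E => C.chart (g * C.chart.symm x * g⁻¹)) 0) (C.chart (c 0)) := by
    rwa [hc.map_zero, C.map_one]
  have h3 := h2.comp_hasDerivAt 0 (C.hasDerivAt_velocity hc)
  have h4 : HasDerivAt (fun t => C.chart (g * c t * g⁻¹)) (C.Ad g (C.velocity c)) 0 := by
    refine h3.congr_of_eventuallyEq ?_
    filter_upwards [hc.tendsto.eventually C.eventually_symm_chart] with t ht
    simp [ht]
  exact h4.deriv

theorem _root_.IsOneParam.conj {c : ℝ → G} (hc : IsOneParam c) (g : G) :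
    IsOneParam fun t => g * c t * g⁻¹ where
  continuous := by have := hc.continuous; fun_prop
  map_add s t := by rw [hc.map_add]; group

theorem IsSmoothRep.diff_Ad {C : GroupChart G E} [FiniteDimensional ℝ V] (h : C.IsSmoothRep ρ)
    (g : G) (X : E) (v : V) : h.diff (C.Ad g X) (ρ g v) = ρ g (h.diff X v) := by
  have h1 : HasFDerivAt (fun x : E => ρ (C.chart.symm x) (ρ g v))
      (fderiv ℝ (fun x : E => ρ (C.chart.symm x) (ρ g v)) 0)
      (C.chart (g * C.chart.symm 0 * g⁻¹)) := by
    rw [C.symm_zero, mul_one, mul_inv_cancel, C.map_one]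
    exact h.hasFDerivAt _
  have h2 := h1.comp 0 (C.hasFDerivAt_Ad g)
  have h3 := (LinearMap.toContinuousLinearMap (ρ g)).hasFDerivAt.comp 0 (h.hasFDerivAt v)
  have h4 := h2.unique (h3.congr_of_eventuallyEq ?_)
  · exact congrArg (fun f : E →L[ℝ] V => f X) h4
  · filter_upwards [(C.tendsto_conj_symm g).eventually C.eventually_symm_chart] with x hx
    simp only [Function.comp_apply, hx, LinearMap.coe_toContinuousLinearMap', ←
      Module.End.mul_apply, ← map_mul, inv_mul_cancel_right]

theorem isSmoothRep_Ad (C : GroupChart G E) : C.IsSmoothRep C.Ad := by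
  intro Z
  let Q : E × E → E := fun p =>
    C.chart (C.chart.symm p.1 * C.chart.symm p.2 * (C.chart.symm p.1)⁻¹)
  have hQ : ContDiffAt ℝ 1 (fderiv ℝ Q) ((0 : E), (0 : E)) :=
    C.contDiffAt_conj₂.fderiv_right (by norm_num)
  have h2 : ContDiffAt ℝ 1 (fun x : E => fderiv ℝ Q (x, 0)) 0 :=
    ContDiffAt.comp (g := fderiv ℝ Q) (f := fun x : E => (x, (0 : E))) 0 hQ (by fun_prop)
  refine (h2.clm_apply (contDiffAt_const (c := ((0 : E), Z)))).congr_of_eventuallyEq ?_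
  have hev := (C.contDiffAt_conj₂.of_le (by norm_num : (1 : WithTop ℕ∞) ≤ 2)).eventually (by simp)
  have ht : Tendsto (fun x : E => (x, (0 : E))) (𝓝 0) (𝓝 0) :=
    Continuous.tendsto' (by fun_prop) _ _ rfl
  filter_upwards [ht.eventually hev] with x hx
  have h3 : HasFDerivAt (fun y : E => Q (x, y))
      ((fderiv ℝ Q (x, 0)).comp (ContinuousLinearMap.inr ℝ E E)) 0 :=
    HasFDerivAt.comp (𝕜 := ℝ) (g := Q) (f := fun y : E => (x, y)) 0
      (hx.differentiableAt (by simp)).hasFDerivAt (hasFDerivAt_prodMk_right x 0)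
  rw [C.Ad_apply, (show HasFDerivAt (fun y : E =>
    C.chart (C.chart.symm x * C.chart.symm y * (C.chart.symm x)⁻¹)) _ 0 from h3).fderiv]
  simp

/-- Antisymmetry of the differential of the adjoint representation. -/
theorem diff_Ad_antisymm [FiniteDimensional ℝ E] (C : GroupChart G E) (W Z : E) :
    C.isSmoothRep_Ad.diff W Z = -C.isSmoothRep_Ad.diff Z W := by
  set D := fderiv ℝ (fderiv ℝ C.mul) 0 with hD
  have hsymm : ∀ p q, D p q = D q p := by
    have := C.contDiffAt_mul.isSymmSndFDerivAt (by simp)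
    exact fun p q => this p q
  have hD0 : HasFDerivAt (fderiv ℝ C.mul) D ((0 : E), (0 : E)) :=
    ((C.contDiffAt_mul.fderiv_right (m := 1) (by norm_num)).differentiableAt
      (by simp)).hasFDerivAt
  -- Obtained by differentiating `x y = (x y x⁻¹) x`, first in `y` and then in `x`. It expresses the
  -- bracket as `b W Z - b Z W`, where `b W Z = D (W, 0) (0, Z)` and `D` is symmetric.
  have key : ∀ W Z : E, D (W, 0) (0, Z) = D (0, W) (Z, 0) + C.isSmoothRep_Ad.diff W Z := by
    intro W Z
    have hl : HasFDerivAt (fun x : E => fderiv ℝ C.mul (x, 0))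
        (D.comp (ContinuousLinearMap.inl ℝ E E)) 0 :=
      HasFDerivAt.comp (𝕜 := ℝ) (g := fderiv ℝ C.mul) (f := fun x : E => (x, (0 : E))) 0 hD0
        (hasFDerivAt_prodMk_left 0 0)
    have hr : HasFDerivAt (fun x : E => fderiv ℝ C.mul (0, x))
        (D.comp (ContinuousLinearMap.inr ℝ E E)) 0 :=
      HasFDerivAt.comp (𝕜 := ℝ) (g := fderiv ℝ C.mul) (f := fun x : E => ((0 : E), x)) 0 hD0
        (hasFDerivAt_prodMk_right 0 0)
    have hA := C.isSmoothRep_Ad.hasFDerivAt Z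
    have hH := hl.clm_apply (hasFDerivAt_const ((0 : E), Z) (0 : E))
    have hK := hr.clm_apply (hA.prodMk (hasFDerivAt_const (0 : E) (0 : E)))
    have heq : ∀ᶠ x in 𝓝 (0 : E), fderiv ℝ C.mul (x, 0) (0, Z) =
        fderiv ℝ C.mul (0, x) (C.Ad (C.chart.symm x) Z, 0) := by
      have hev := (C.contDiffAt_mul.of_le (by norm_num : (1 : WithTop ℕ∞) ≤ 2)).eventually
        (by simp)
      have ht : Tendsto (fun x : E => ((0 : E), x)) (𝓝 0) (𝓝 0) :=
        Continuous.tendsto' (by fun_prop) _ _ rfl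
      filter_upwards [C.eventually_hasFDerivAt_mul, ht.eventually hev] with x hx1 hx2
      have h1 : HasFDerivAt (fun y : E => C.mul (x, y))
          ((fderiv ℝ C.mul (x, 0)).comp (ContinuousLinearMap.inr ℝ E E)) 0 :=
        HasFDerivAt.comp (𝕜 := ℝ) (g := C.mul) (f := fun y : E => (x, y)) 0 hx1
          (hasFDerivAt_prodMk_right x 0)
      have h2 := (C.hasFDerivAt_Ad (C.chart.symm x)).prodMk (hasFDerivAt_const x (0 : E))
      have h3 : HasFDerivAt C.mul (fderiv ℝ C.mul (0, x))
          (C.chart (C.chart.symm x * C.chart.symm 0 * (C.chart.symm x)⁻¹), x) := by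
        rw [C.symm_zero, mul_one, mul_inv_cancel, C.map_one]
        exact (hx2.differentiableAt (by simp)).hasFDerivAt
      have h4 := h3.comp 0 h2
      have h5 := h1.unique (h4.congr_of_eventuallyEq ?_)
      · simpa [C.Ad_apply] using congrArg (fun f : E →L[ℝ] E => f Z) h5
      · filter_upwards [(C.tendsto_conj_symm (C.chart.symm x)).eventually
          C.eventually_symm_chart] with y hy
        simp only [Function.comp_apply, mul, hy, inv_mul_cancel_right]
    have h6 := hH.unique (hK.congr_of_eventuallyEq heq)
    have h7 := congrArg (fun f : E →L[ℝ] E => f W) h6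
    have h00 : ((0 : E), (0 : E)) = 0 := rfl
    have hA0 : C.Ad (C.chart.symm 0) Z = Z := by rw [C.symm_zero, _root_.map_one]; rfl
    simp [h00, C.fderiv_mul_zero, hA0] at h7
    rw [h7, add_comm]
    rfl
  have h1 := key W Z
  have h2 := key Z W
  rw [hsymm (W, 0)] at h1
  rw [h1] at h2
  rw [hsymm (0, W)] at h2
  rw [add_assoc] at h2
  rw [eq_neg_iff_add_eq_zero]
  exact left_eq_add.1 h2

end GroupChart

/-! ### Commuting conjugates of tori -/

namespace IsTorusParam

variable {ι G E : Type*} [Fintype ι] [Group G] [TopologicalSpace G] [IsTopologicalGroup G]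
  [NormedAddCommGroup E] [NormedSpace ℝ E] [FiniteDimensional ℝ E] {ψ : (ι → ℝ) → G}

-- A direction of zero velocity gives the constant one-parameter subgroup, so a whole line would lie
-- in the lattice; the point with a coordinate equal to `1 / 2` does not.
omit [IsTopologicalGroup G] in
theorem velocityMap_injective (hψ : IsTorusParam ψ) (C : GroupChart G E) :
    Function.Injective (C.velocityMap hψ.continuous hψ.map_add) := by
  rw [injective_iff_map_eq_zero]
  intro x hx
  have h1 := isOneParam_line hψ.continuous hψ.map_add x
  have h2 : IsOneParam fun _ : ℝ => (1 : G) := ⟨continuous_const, by simp⟩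
  have h3 : C.velocity (fun _ : ℝ => (1 : G)) = 0 := by simp [GroupChart.velocity]
  have h4 := C.oneParam_eq_of_velocity_eq h1 h2 (by rw [h3]; exact hx)
  funext i
  by_contra hi
  have hi' : x i ≠ 0 := hi
  have h5 := (hψ.eq_one_iff ((2 * x i)⁻¹ • x)).1 (congrFun h4 _)
  obtain ⟨k, hk⟩ := mem_intLattice.1 h5 i
  have h6 : (2 : ℝ) * k = 1 := by rw [hk]; simp; field_simp
  have h7 : (2 : ℤ) * k = 1 := by exact_mod_cast h6
  omega

-- This bound makes the supremum defining `torusRank` an attained maximum.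
omit [IsTopologicalGroup G] in
theorem card_le (hψ : IsTorusParam ψ) (C : GroupChart G E) :
    Fintype.card ι ≤ Module.finrank ℝ E := by
  have := LinearMap.finrank_le_finrank_of_injective (hψ.velocityMap_injective C)
  simpa using this

/-- Any two tori of a compact group have commuting conjugates. -/
theorem exists_commute_conj [CompactSpace G] [T2Space G] {κ : Type*} [Fintype κ]
    {φ : (κ → ℝ) → G} (hψ : IsTorusParam ψ) (hφ : IsTorusParam φ) (C : GroupChart G E) :
    ∃ g : G, ∀ x y, Commute (g * ψ x * g⁻¹) (φ y) := by
  obtain ⟨x, hx⟩ := exists_dense_line ι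
  obtain ⟨y, hy⟩ := exists_dense_line κ
  have hAd := C.isSmoothRep_Ad
  obtain ⟨e, he⟩ := C.Ad.exists_linearEquiv_euclidean hAd.continuous
  have hec : Continuous e := e.toLinearMap.continuous_of_finiteDimensional
  have hx1 := isOneParam_line hψ.continuous hψ.map_add x
  have hy1 := isOneParam_line hφ.continuous hφ.map_add y
  set Y := C.velocity (fun t => φ (t • y)) with hY
  -- Hunt's argument: `X` and `Y` generate dense lines in the two tori, and `g` brings `Ad g` of the
  -- first generator as close to `Y` as possible for an invariant inner product. Criticality will
  -- force the bracket of the two to vanish.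
  obtain ⟨g, -, hg⟩ := isCompact_univ.exists_isMaxOn (Set.univ_nonempty (α := G))
    (f := fun g => inner ℝ (e (C.Ad g (C.velocity fun t => ψ (t • x)))) (e Y))
    ((hec.comp (hAd.continuous _)).inner continuous_const).continuousOn
  refine ⟨g, ?_⟩
  set X := C.Ad g (C.velocity fun t => ψ (t • x)) with hX
  have hmax : ∀ k, inner ℝ (e (C.Ad k X)) (e Y) ≤ inner ℝ (e X) (e Y) := by
    intro k
    have := hg (Set.mem_univ (k * g))
    simpa [map_mul, Module.End.mul_apply] using this
  have hcrit : ∀ W, inner ℝ (e (hAd.diff W X)) (e Y) = 0 := by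
    intro W
    -- With the zero subspace, this only provides a curve with velocity `W`.
    obtain ⟨c, hc1, hcc, hcW, -⟩ := hAd.exists_curve_fixing (X := W) (W := ⊥) (by simp)
    have h1 := hAd.hasDerivAt_of_hasDerivAt X hc1 hcc hcW
    have h2 := (LinearMap.toContinuousLinearMap e.toLinearMap).hasFDerivAt.comp_hasDerivAt 0 h1
    have h3 : HasDerivAt (fun t => inner ℝ (e (C.Ad (c t) X)) (e Y))
        (inner ℝ (e (hAd.diff W X)) (e Y)) 0 := by
      have := h2.inner ℝ (hasDerivAt_const (0 : ℝ) (e Y))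
      simpa using this
    have h4 : IsLocalMax (fun t => inner ℝ (e (C.Ad (c t) X)) (e Y)) 0 := by
      refine Eventually.of_forall fun t => ?_
      simpa [hc1] using hmax (c t)
    exact h4.hasDerivAt_eq_zero h3
  have hxg := hx1.conj g
  have hXv : C.velocity (fun t => g * ψ (t • x) * g⁻¹) = X := C.velocity_conj hx1 g
  have hskew : ∀ W, inner ℝ (e (hAd.diff X W)) (e Y) = -inner ℝ (e W) (e (hAd.diff X Y)) := by
    intro W
    have hd := fun Z => (LinearMap.toContinuousLinearMap e.toLinearMap).hasFDerivAt.comp_hasDerivAt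
      0 (hAd.hasDerivAt_oneParam hxg Z 0)
    have h1 := (hd W).inner ℝ (hd Y)
    have h2 := h1.unique ((hasDerivAt_const (0 : ℝ) (inner ℝ (e W) (e Y))).congr_of_eventuallyEq
      (Eventually.of_forall fun t => he _ W Y))
    rw [hXv] at h2
    simp [hψ.map_zero] at h2
    linarith
  -- Taking `W = [X, Y]` in the critical equation, antisymmetry and skewness turn it into `‖[X, Y]‖²
  -- = 0`.
  have hzero : hAd.diff X Y = 0 := by
    have h1 := hcrit (hAd.diff X Y)
    rw [C.diff_Ad_antisymm, _root_.map_neg, inner_neg_left, hskew, neg_neg] at h1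
    exact e.map_eq_zero_iff.1 (inner_self_eq_zero.1 h1)
  have hfix : ∀ t, C.Ad (g * ψ (t • x) * g⁻¹) Y = Y :=
    fun t => hAd.oneParam_apply_eq hxg (by rw [hXv, hzero]) t
  -- Conjugation by a point of the first line preserves the velocity `Y`, hence the one-parameter
  -- subgroup itself. Density then extends commutation to one torus at a time.
  have hline : ∀ t s : ℝ, Commute (g * ψ (t • x) * g⁻¹) (φ (s • y)) := by
    intro t s
    set k := g * ψ (t • x) * g⁻¹ with hk
    have h1 := C.oneParam_eq_of_velocity_eq (hy1.conj k) hy1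
      (by rw [C.velocity_conj hy1, ← hY, hfix])
    have h2 := congrFun h1 s
    exact mul_inv_eq_iff_eq_mul.1 h2
  have hψc := hψ.continuous
  have hφc := hφ.continuous
  have hφz : ∀ z ∈ intLattice κ, φ z = 1 := fun z hz => (hφ.eq_one_iff z).2 hz
  have hψz : ∀ z ∈ intLattice ι, ψ z = 1 := fun z hz => (hψ.eq_one_iff z).2 hz
  have hstep : ∀ t : ℝ, ∀ y', Commute (g * ψ (t • x) * g⁻¹) (φ y') := by
    intro t
    have hcl : IsClosed {y' | (g * ψ (t • x) * g⁻¹) * φ y' = φ y' * (g * ψ (t • x) * g⁻¹)} :=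
      isClosed_eq (by fun_prop) (by fun_prop)
    have := hy _ hcl (fun s z hz => by
      simp only [Set.mem_ofPred_eq, hφ.map_add, hφz z hz, mul_one]
      exact hline t s)
    exact fun y' => Set.eq_univ_iff_forall.1 this y'
  intro x' y'
  have hcl : IsClosed {x' | (g * ψ x' * g⁻¹) * φ y' = φ y' * (g * ψ x' * g⁻¹)} :=
    isClosed_eq (by fun_prop) (by fun_prop)
  have := hx _ hcl (fun s z hz => by
    simp only [Set.mem_ofPred_eq, hψ.map_add, hψz z hz, mul_one]
    exact hstep s y')
  exact Set.eq_univ_iff_forall.1 this x'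

end IsTorusParam

/-! ### Ranks of subgroups and of intersections -/

section Rank

variable {G E : Type*} [Group G] [TopologicalSpace G]
  [NormedAddCommGroup E] [NormedSpace ℝ E] [FiniteDimensional ℝ E]

theorem IsTorusParam.of_subgroup {ι : Type*} [Fintype ι] {K : Subgroup G} {ψ : (ι → ℝ) → K}
    (h : IsTorusParam ψ) : IsTorusParam fun x => (ψ x : G) where
  continuous := continuous_subtype_val.comp h.continuous
  map_add x y := by rw [h.map_add]; rfl
  eq_one_iff x := by rw [OneMemClass.coe_eq_one, h.eq_one_iff]

theorem IsTorusParam.codRestrict {ι : Type*} [Fintype ι] {K : Subgroup G} {ψ : (ι → ℝ) → G}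
    (h : IsTorusParam ψ) (hK : ∀ x, ψ x ∈ K) : IsTorusParam fun x => (⟨ψ x, hK x⟩ : K) where
  continuous := h.continuous.subtype_mk _
  map_add x y := Subtype.ext (h.map_add x y)
  eq_one_iff x := by rw [← h.eq_one_iff]; exact Subtype.ext_iff

variable [T2Space G]

theorem le_torusRank (C : GroupChart G E) {K : Subgroup G} {n : ℕ} {ψ : (Fin n → ℝ) → G}
    (hψ : IsTorusParam ψ) (hK : ∀ x, ψ x ∈ K) : n ≤ torusRank K := by
  rw [torusRank_eq]
  refine le_csSup ⟨Module.finrank ℝ E, ?_⟩ ⟨_, hψ.codRestrict hK⟩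
  rintro m ⟨φ, hφ⟩
  simpa using hφ.of_subgroup.card_le C

theorem exists_isTorusParam_torusRank (C : GroupChart G E) (K : Subgroup G) :
    ∃ ψ : (Fin (torusRank K) → ℝ) → G, IsTorusParam ψ ∧ ∀ x, ψ x ∈ K := by
  have hne : {n : ℕ | ∃ ψ : (Fin n → ℝ) → K, IsTorusParam ψ}.Nonempty := by
    refine ⟨0, fun _ => 1, continuous_const, by simp, fun x => ?_⟩
    simp [mem_intLattice]
  have hbdd : BddAbove {n : ℕ | ∃ ψ : (Fin n → ℝ) → K, IsTorusParam ψ} := by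
    refine ⟨Module.finrank ℝ E, ?_⟩
    rintro m ⟨φ, hφ⟩
    simpa using hφ.of_subgroup.card_le C
  have := Nat.sSup_mem hne hbdd
  rw [← torusRank_eq] at this
  obtain ⟨ψ, hψ⟩ := this
  exact ⟨_, hψ.of_subgroup, fun x => (ψ x).2⟩

theorem torusRank_le_of_conj [IsTopologicalGroup G] (C : GroupChart G E) {K L : Subgroup G} (g : G)
    (h : ∀ k ∈ K, g * k * g⁻¹ ∈ L) : torusRank K ≤ torusRank L := by
  obtain ⟨ψ, hψ, hK⟩ := exists_isTorusParam_torusRank C K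
  exact le_torusRank C (hψ.conj g) fun x => h _ (hK x)

theorem torusRank_top {G : Type*} [Group G] [TopologicalSpace G] [T2Space G] :
    torusRank (⊤ : Subgroup G) = torusRank G := by
  rw [torusRank_eq, torusRank_eq]
  congr 1
  ext n
  constructor
  · rintro ⟨ψ, hψ⟩
    exact ⟨_, hψ.of_subgroup⟩
  · rintro ⟨ψ, hψ⟩
    exact ⟨_, hψ.codRestrict fun _ => Subgroup.mem_top _⟩

/-- The torus in the closed subgroup `K` cut out by a closed subgroup of the Lie algebra of a
torus. -/
theorem finrank_linearPart_le_torusRank (C : GroupChart G E) {ι : Type*} [Fintype ι]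
    {ψ : (ι → ℝ) → G} (hc : Continuous ψ) (hadd : ∀ x y, ψ (x + y) = ψ x * ψ y)
    (Λ : AddSubgroup (ι → ℝ)) (hΛ : IsClosed (Λ : Set (ι → ℝ)))
    (hZ : ∀ x ∈ intLattice ι, x ∈ Λ) (hker : ∀ x ∈ Λ, ψ x = 1 ↔ x ∈ intLattice ι)
    {K : Subgroup G} (hK : ∀ x ∈ Λ, ψ x ∈ K) :
    Module.finrank ℝ Λ.linearPart ≤ torusRank K := by
  obtain ⟨L, hL, hLZ⟩ := Λ.exists_linearMap_range_linearPart hΛ hZ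
  have hLΛ : ∀ z, L z ∈ Λ := fun z =>
    AddSubgroup.linearPart_le (hL.le (LinearMap.mem_range_self L z))
  refine le_torusRank C (ψ := fun z => ψ (L z)) ⟨?_, ?_, ?_⟩ fun z => hK _ (hLΛ z)
  · exact hc.comp L.continuous_of_finiteDimensional
  · intro x y
    rw [map_add, hadd]
  · intro z
    rw [hker _ (hLΛ z), hLZ]

/-- The intersection of suitable conjugates of two subgroups contains a large torus. -/
theorem exists_torusRank_add_le [IsTopologicalGroup G] [CompactSpace G] (C : GroupChart G E)
    (K L : Subgroup G) :
    ∃ g : G, ∀ M : Subgroup G, (∀ k ∈ K, g * k * g⁻¹ ∈ L → g * k * g⁻¹ ∈ M) →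
      torusRank K + torusRank L ≤ torusRank G + torusRank M := by
  obtain ⟨ψ₀, hψ₀, hψ₀K⟩ := exists_isTorusParam_torusRank C K
  obtain ⟨φ, hφ, hφL⟩ := exists_isTorusParam_torusRank C L
  obtain ⟨g, hg⟩ := hψ₀.exists_commute_conj hφ C
  refine ⟨g, fun M hM => ?_⟩
  set ψ := fun x => g * ψ₀ x * g⁻¹ with hψdef
  have hψ : IsTorusParam ψ := hψ₀.conj g
  let ι := Fin (torusRank K) ⊕ Fin (torusRank L)
  let p₁ : (ι → ℝ) →ₗ[ℝ] (Fin (torusRank K) → ℝ) := LinearMap.funLeft ℝ ℝ Sum.inl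
  let p₂ : (ι → ℝ) →ₗ[ℝ] (Fin (torusRank L) → ℝ) := LinearMap.funLeft ℝ ℝ Sum.inr
  have hp₁ : Continuous p₁ := p₁.continuous_of_finiteDimensional
  have hp₂ : Continuous p₂ := p₂.continuous_of_finiteDimensional
  have hint : ∀ x, x ∈ intLattice ι ↔ p₁ x ∈ intLattice _ ∧ p₂ x ∈ intLattice _ := by
    intro x
    simp only [mem_intLattice, ι, Sum.forall]
    rfl
  -- Since the tori commute, `θ` is a homomorphism. The linear part of its kernel `Λ` parametrizes a
  -- torus in their intersection; the quotient by `Λ` parametrizes a torus of `G`. The two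
  -- dimensions add up to the sum of the ranks.
  let θ : (ι → ℝ) → G := fun x => ψ (p₁ x) * (φ (p₂ x))⁻¹
  have hθc : Continuous θ :=
    (hψ.continuous.comp hp₁).mul (hφ.continuous.comp hp₂).inv
  have hθadd : ∀ x y, θ (x + y) = θ x * θ y := by
    intro x y
    simp only [θ, map_add, hψ.map_add, hφ.map_add, mul_inv_rev]
    have h1 : Commute (ψ (p₁ y)) (φ (p₂ x))⁻¹ := (hg (p₁ y) (p₂ x)).inv_right
    have h2 : Commute (φ (p₂ y))⁻¹ (φ (p₂ x))⁻¹ := by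
      rw [← hφ.map_neg, ← hφ.map_neg, Commute, SemiconjBy, ← hφ.map_add, ← hφ.map_add, add_comm]
    calc ψ (p₁ x) * ψ (p₁ y) * ((φ (p₂ y))⁻¹ * (φ (p₂ x))⁻¹)
        = ψ (p₁ x) * (ψ (p₁ y) * (φ (p₂ x))⁻¹) * (φ (p₂ y))⁻¹ := by
          rw [h2.eq]; simp only [mul_assoc]
      _ = ψ (p₁ x) * (φ (p₂ x))⁻¹ * (ψ (p₁ y) * (φ (p₂ y))⁻¹) := by
          rw [h1.eq]; simp only [mul_assoc]
  have hθ1 : ∀ x, θ x = 1 ↔ ψ (p₁ x) = φ (p₂ x) := fun x => mul_inv_eq_one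
  let Λ : AddSubgroup (ι → ℝ) :=
    { carrier := {x | θ x = 1}
      zero_mem' := by simp [hθ1, hψ.map_zero, hφ.map_zero]
      add_mem' := fun {a b} (ha : θ a = 1) (hb : θ b = 1) => by
        simp [hθadd, ha, hb]
      neg_mem' := fun {a} (ha : θ a = 1) => by
        have ha' := (hθ1 a).1 ha
        simp [hθ1, hψ.map_neg, hφ.map_neg, ha'] }
  have hΛmem : ∀ x, x ∈ Λ ↔ θ x = 1 := fun x => Iff.rfl
  have hΛ : IsClosed (Λ : Set (ι → ℝ)) := isClosed_eq hθc continuous_const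
  have hZ : ∀ x ∈ intLattice ι, x ∈ Λ := by
    intro x hx
    obtain ⟨h1, h2⟩ := (hint x).1 hx
    rw [hΛmem, hθ1, (hψ.eq_one_iff _).2 h1, (hφ.eq_one_iff _).2 h2]
  have hspan : Submodule.span ℝ (Λ : Set (ι → ℝ)) = ⊤ := by
    have : Submodule.span ℝ (intLattice ι : Set (ι → ℝ)) = ⊤ := IsZLattice.span_top
    rw [eq_top_iff, ← this]
    exact Submodule.span_mono hZ
  have hM : Module.finrank ℝ Λ.linearPart ≤ torusRank M := by
    -- The map `ψ ∘ p₁` ignores the second factor, so its kernel is the lattice only on `Λ`: there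
    -- `ψ (p₁ x) = φ (p₂ x)`, and `p₁ x` is integral exactly when `p₂ x` is.
    refine finrank_linearPart_le_torusRank C (ψ := fun x => ψ (p₁ x)) (hψ.continuous.comp hp₁)
      (fun x y => by rw [map_add, hψ.map_add]) Λ hΛ hZ (fun x hx => ?_) (fun x hx => ?_)
    · rw [hΛmem, hθ1] at hx
      rw [hint, ← hψ.eq_one_iff, ← hφ.eq_one_iff, ← hx, and_self]
    · rw [hΛmem, hθ1] at hx
      refine hM _ (hψ₀K (p₁ x)) ?_
      rw [show g * ψ₀ (p₁ x) * g⁻¹ = φ (p₂ x) from hx]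
      exact hφL _
  obtain ⟨m, N, hm, hNs, -, hN⟩ := Λ.exists_linearMap_comap_intLattice hΛ hspan
  have hG : m ≤ torusRank (⊤ : Subgroup G) := by
    -- A linear section `R` of `N` realizes the quotient torus: `θ (R z) = 1` exactly when `N (R z)
    -- = z` is integral.
    obtain ⟨R, hR⟩ := LinearMap.exists_rightInverse_of_surjective N (LinearMap.range_eq_top.2 hNs)
    have hR' : ∀ z, N (R z) = z := fun z => congrArg (fun f => f z) hR
    refine le_torusRank C (ψ := fun z => θ (R z)) ⟨?_, ?_, ?_⟩ fun _ => Subgroup.mem_top _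
    · exact hθc.comp R.continuous_of_finiteDimensional
    · intro x y
      rw [map_add, hθadd]
    · intro z
      rw [← hΛmem, hN, hR']
  rw [torusRank_top] at hG
  have hcard : Module.finrank ℝ (ι → ℝ) = torusRank K + torusRank L := by simp [ι]
  omega

end Rank

/-! ### Fixators, regular points and slices -/

/-- The pointwise stabilizer of a set of vectors. -/
def Representation.fixator {G V : Type*} [Group G] [AddCommGroup V] [Module ℝ V]
    (ρ : Representation ℝ G V) (S : Set V) : Subgroup G where
  carrier := {g | ∀ s ∈ S, ρ g s = s}
  one_mem' := by simp
  mul_mem' {a b} ha hb s hs := by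
    rw [map_mul, Module.End.mul_apply, hb s hs, ha s hs]
  inv_mem' {a} ha s hs := by
    have h : ρ a⁻¹ (ρ a s) = s := by simp
    rwa [ha s hs] at h

theorem Representation.mem_fixator {G V : Type*} [Group G] [AddCommGroup V] [Module ℝ V]
    {ρ : Representation ℝ G V} {S : Set V} {g : G} :
    g ∈ ρ.fixator S ↔ ∀ s ∈ S, ρ g s = s := Iff.rfl

theorem Representation.mem_fixator_insert {G V : Type*} [Group G] [AddCommGroup V] [Module ℝ V]
    {ρ : Representation ℝ G V} {S : Set V} {n : V} {g : G} :
    g ∈ ρ.fixator (insert n S) ↔ ρ g n = n ∧ g ∈ ρ.fixator S := by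
  simp [Representation.mem_fixator]

/-- The range of `p` is the sum of the range of `q` and `p (ker q)`: these are orthogonal, and `ker
p ≤ ker q` makes their dimensions add up to that of the range of `p`. In the slice argument `p` and
`q` are infinitesimal actions at two points. -/
theorem inner_eq_zero_of_range_le {F V : Type*} [AddCommGroup F] [Module ℝ F]
    [FiniteDimensional ℝ F] [NormedAddCommGroup V] [InnerProductSpace ℝ V]
    [FiniteDimensional ℝ V] (p q : F →ₗ[ℝ] V) (hker : p.ker ≤ q.ker) (hrange : q.range ≤ p.range)
    (horth : ∀ x, ∀ y ∈ q.ker, inner ℝ (q x) (p y) = 0) {m : V}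
    (hmq : ∀ x, inner ℝ (q x) m = 0) (hmp : ∀ y ∈ q.ker, inner ℝ (p y) m = 0) (x : F) :
    inner ℝ (p x) m = 0 := by
  let r : q.ker →ₗ[ℝ] V := p ∘ₗ q.ker.subtype
  have hdisj : Disjoint q.range r.range := by
    rw [Submodule.disjoint_def]
    rintro _ ⟨a, rfl⟩ ⟨b, hb⟩
    have := horth a b b.2
    rw [show p b = q a from hb] at this
    exact inner_self_eq_zero.1 this
  have hle : q.range ⊔ r.range ≤ p.range := by
    refine sup_le hrange ?_
    rintro _ ⟨b, rfl⟩
    exact ⟨b, rfl⟩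
  have hr : Module.finrank ℝ r.ker = Module.finrank ℝ p.ker := by
    have : r.ker = p.ker.comap q.ker.subtype := LinearMap.ker_comp _ _
    rw [this]
    exact (Submodule.comapSubtypeEquivOfLe hker).finrank_eq
  have h1 := p.finrank_range_add_finrank_ker
  have h2 := q.finrank_range_add_finrank_ker
  have h3 := r.finrank_range_add_finrank_ker
  have h4 := Submodule.finrank_sup_add_finrank_inf_eq q.range r.range
  rw [hdisj.eq_bot, finrank_bot] at h4
  have heq : q.range ⊔ r.range = p.range := Submodule.eq_of_le_of_finrank_eq hle (by omega)
  have hx : p x ∈ q.range ⊔ r.range := heq ▸ LinearMap.mem_range_self p x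
  obtain ⟨_, ⟨a, rfl⟩, _, ⟨b, rfl⟩, hab⟩ := Submodule.mem_sup.1 hx
  rw [← hab, inner_add_left, hmq, show inner ℝ (r b) m = 0 from hmp b b.2, add_zero]

namespace GroupChart.IsSmoothRep

variable {G E V : Type*} [Group G] [TopologicalSpace G] [IsTopologicalGroup G]
  [NormedAddCommGroup E] [NormedSpace ℝ E] [FiniteDimensional ℝ E]
  [NormedAddCommGroup V] [InnerProductSpace ℝ V] [FiniteDimensional ℝ V]
  {C : GroupChart G E} {ρ : Representation ℝ G V}

/-- The directions killing a set of vectors: the Lie algebra of its fixator. -/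
def lieFix (h : C.IsSmoothRep ρ) (S : Set V) : Submodule ℝ E where
  carrier := {X | ∀ s ∈ S, h.diff X s = 0}
  zero_mem' := by simp
  add_mem' {a b} ha hb s hs := by simp [ha s hs, hb s hs]
  smul_mem' c X hX s hs := by simp [hX s hs]

omit [IsTopologicalGroup G] [FiniteDimensional ℝ E] [FiniteDimensional ℝ V] in
theorem mem_lieFix {h : C.IsSmoothRep ρ} {S : Set V} {X : E} :
    X ∈ h.lieFix S ↔ ∀ s ∈ S, h.diff X s = 0 := Iff.rfl

omit [IsTopologicalGroup G] [FiniteDimensional ℝ E] [FiniteDimensional ℝ V] in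
theorem mem_lieFix_insert {h : C.IsSmoothRep ρ} {S : Set V} {n : V} {X : E} :
    X ∈ h.lieFix (insert n S) ↔ h.diff X n = 0 ∧ X ∈ h.lieFix S := by
  simp [mem_lieFix]

/-- The tangent space at `n` of the orbit of the fixator of `S`. -/
noncomputable def tangent (h : C.IsSmoothRep ρ) (S : Set V) (n : V) : Submodule ℝ V :=
  (h.lieFix S).map (h.diff.flip n)

omit [IsTopologicalGroup G] [FiniteDimensional ℝ E] [FiniteDimensional ℝ V] in
theorem mem_tangent {h : C.IsSmoothRep ρ} {S : Set V} {n u : V} :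
    u ∈ h.tangent S n ↔ ∃ X ∈ h.lieFix S, h.diff X n = u := Iff.rfl

omit [IsTopologicalGroup G] [FiniteDimensional ℝ V] in
theorem finrank_tangent_add (h : C.IsSmoothRep ρ) (S : Set V) (n : V) :
    Module.finrank ℝ (h.tangent S n) + Module.finrank ℝ (h.lieFix (insert n S)) =
      Module.finrank ℝ (h.lieFix S) := by
  let f : h.lieFix S →ₗ[ℝ] V := h.diff.flip n ∘ₗ (h.lieFix S).subtype
  have h1 := f.finrank_range_add_finrank_ker
  have h2 : f.range = h.tangent S n := by
    rw [LinearMap.range_comp, Submodule.range_subtype]; rfl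
  have hle : h.lieFix (insert n S) ≤ h.lieFix S := fun X hX => (mem_lieFix_insert.1 hX).2
  have h3 : f.ker = (h.lieFix (insert n S)).comap (h.lieFix S).subtype := by
    ext X
    simp only [Submodule.mem_comap, Submodule.subtype_apply, mem_lieFix_insert, X.2, and_true]
    rfl
  rw [h2, h3, (Submodule.comapSubtypeEquivOfLe hle).finrank_eq] at h1
  exact h1

theorem exists_curve_fixator (h : C.IsSmoothRep ρ) {S : Set V} {X : E} (hX : X ∈ h.lieFix S) :
    ∃ c : ℝ → G, c 0 = 1 ∧ (∀ v, HasDerivAt (fun t => ρ (c t) v) (h.diff X v) 0) ∧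
      ∀ᶠ t in 𝓝 0, c t ∈ ρ.fixator S := by
  obtain ⟨c, hc1, hcc, hcX, hfix⟩ := h.exists_curve_fixing (X := X) (W := Submodule.span ℝ S)
    (by
      have : Submodule.span ℝ S ≤ (h.diff X).ker := Submodule.span_le.2 fun s hs => hX s hs
      exact fun w hw => this hw)
  refine ⟨c, hc1, fun v => h.hasDerivAt_of_hasDerivAt v hc1 hcc hcX, ?_⟩
  filter_upwards [hfix] with t ht s hs
  exact ht s (Submodule.subset_span hs)

theorem diff_eq_zero_of_fixed (h : C.IsSmoothRep ρ) {S : Set V} {X : E} (hX : X ∈ h.lieFix S)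
    {v : V} (hv : ∀ g ∈ ρ.fixator S, ρ g v = v) : h.diff X v = 0 := by
  obtain ⟨c, hc1, hcd, hcS⟩ := h.exists_curve_fixator hX
  refine (hcd v).unique ((hasDerivAt_const (0 : ℝ) v).congr_of_eventuallyEq ?_)
  filter_upwards [hcS] with t ht using hv _ ht

/-- Shows that `lieFix S` depends only on the group `ρ.fixator S`, although it is defined by
vectors. Each direction in it is tangent to a curve in the group. -/
theorem lieFix_le_of_fixator_le (h : C.IsSmoothRep ρ) {S S' : Set V}
    (hle : ρ.fixator S ≤ ρ.fixator S') : h.lieFix S ≤ h.lieFix S' :=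
  fun _ hX s hs => h.diff_eq_zero_of_fixed hX fun _ hg => hle hg s hs

omit [FiniteDimensional ℝ E] in
theorem Ad_mem_lieFix (h : C.IsSmoothRep ρ) {S : Set V} {X : E} (hX : X ∈ h.lieFix S) {g : G}
    (hg : g ∈ ρ.fixator S) : C.Ad g X ∈ h.lieFix S := by
  intro s hs
  have := h.diff_Ad g X s
  rwa [hg s hs, hX s hs, map_zero] at this

theorem diff_mem_of_invariant (h : C.IsSmoothRep ρ) {S : Set V} {N : Submodule ℝ V}
    (hN : ∀ g ∈ ρ.fixator S, ∀ v ∈ N, ρ g v ∈ N) {X : E} (hX : X ∈ h.lieFix S) {n : V}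
    (hn : n ∈ N) : h.diff X n ∈ N := by
  obtain ⟨c, hc1, hcd, hcS⟩ := h.exists_curve_fixator hX
  rw [← Submodule.orthogonal_orthogonal N, Submodule.mem_orthogonal']
  intro m hm
  have h1 : HasDerivAt (fun t => inner ℝ (ρ (c t) n) m) (inner ℝ (h.diff X n) m) 0 := by
    simpa using (hcd n).inner ℝ (hasDerivAt_const (0 : ℝ) m)
  refine h1.unique ((hasDerivAt_const (0 : ℝ) (0 : ℝ)).congr_of_eventuallyEq ?_)
  filter_upwards [hcS] with t ht
  exact Submodule.inner_right_of_mem_orthogonal (hN _ ht n hn) hm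

/-- First-order condition at the point of an orbit closest to `n`. -/
theorem inner_diff_eq_zero_of_max (h : C.IsSmoothRep ρ) {S : Set V} {w n : V}
    (hmax : ∀ g ∈ ρ.fixator S, inner ℝ (ρ g w) n ≤ inner ℝ w n) {X : E} (hX : X ∈ h.lieFix S) :
    inner ℝ (h.diff X w) n = 0 := by
  obtain ⟨c, hc1, hcd, hcS⟩ := h.exists_curve_fixator hX
  have h1 : HasDerivAt (fun t => inner ℝ (ρ (c t) w) n) (inner ℝ (h.diff X w) n) 0 := by
    simpa using (hcd w).inner ℝ (hasDerivAt_const (0 : ℝ) n)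
  refine IsLocalMax.hasDerivAt_eq_zero ?_ h1
  filter_upwards [hcS] with t ht
  simpa [hc1] using hmax _ ht

theorem inner_diff_left (h : C.IsSmoothRep ρ)
    (hρ : ∀ g v w, inner ℝ (ρ g v) (ρ g w) = inner ℝ v w) (X : E) (v w : V) :
    inner ℝ (h.diff X v) w = -inner ℝ v (h.diff X w) := by
  obtain ⟨c, hc1, hcd, -⟩ := h.exists_curve_fixator (S := ∅) (X := X) (by simp [mem_lieFix])
  have h1 := (hcd v).inner ℝ (hcd w)
  have h2 := h1.unique ((hasDerivAt_const (0 : ℝ) (inner ℝ v w)).congr_of_eventuallyEq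
    (Eventually.of_forall fun t => hρ _ v w))
  simp [hc1] at h2
  linarith

/-- `n` is a regular point for the action of the fixator of `S` on `N`: its isotropy group acts
trivially on the normal space of its orbit. -/
structure IsNice (h : C.IsSmoothRep ρ) (S : Set V) (N : Submodule ℝ V) (n : V) : Prop where
  mem : n ∈ N
  fixed : ∀ m ∈ N, (∀ X ∈ h.lieFix S, inner ℝ (h.diff X n) m = 0) →
    ∀ g ∈ ρ.fixator (insert n S), ρ g m = m

/-- Passage from `n` to the slice at a point `w` closest to `n` in its orbit. -/
theorem IsNice.slice {h : C.IsSmoothRep ρ} (hρ : ∀ g v w, inner ℝ (ρ g v) (ρ g w) = inner ℝ v w)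
    {S : Set V} {N : Submodule ℝ V} {n w : V} (hn : h.IsNice S N n)
    (hN : ∀ g ∈ ρ.fixator S, ∀ v ∈ N, ρ g v ∈ N) (hw : w ∈ N)
    (hmax : ∀ g ∈ ρ.fixator S, inner ℝ (ρ g w) n ≤ inner ℝ w n)
    {A : Submodule ℝ V} (hA : A ≤ N) (hAfix : ∀ g ∈ ρ.fixator (insert w S), ∀ a ∈ A, ρ g a = a)
    (hAperp : ∀ X ∈ h.lieFix S, ∀ a ∈ A, inner ℝ (h.diff X w) a = 0) :
    ∃ (N' : Submodule ℝ V) (n' : V), h.IsNice (insert w S) N' n' ∧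
      (∀ g ∈ ρ.fixator (insert w S), ∀ v ∈ N', ρ g v ∈ N') ∧
      ρ.fixator (insert n' (insert w S)) = ρ.fixator (insert n S) ∧
      Module.finrank ℝ N' + Module.finrank ℝ A + Module.finrank ℝ (h.lieFix S) =
        Module.finrank ℝ N + Module.finrank ℝ (h.lieFix (insert w S)) := by
  set S' := insert w S with hS'
  set T := h.tangent S w with hT
  have hTN : T ≤ N := by
    rintro _ ⟨X, hX, rfl⟩
    exact h.diff_mem_of_invariant hN hX hw
  have hS'S : ρ.fixator S' ≤ ρ.fixator S := fun g hg => (ρ.mem_fixator_insert.1 hg).2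
  have hlS'S : h.lieFix S' ≤ h.lieFix S := fun X hX => (mem_lieFix_insert.1 hX).2
  have hcrit : ∀ X ∈ h.lieFix S, inner ℝ (h.diff X w) n = 0 :=
    fun X hX => h.inner_diff_eq_zero_of_max hmax hX
  -- By skewness, `n` normal to the orbit at `w` makes `w` normal to the orbit at `n`; regularity of
  -- `n` then applies to `w`.
  have hHw : ∀ g ∈ ρ.fixator (insert n S), ρ g w = w :=
    hn.fixed w hw fun X hX => by
      rw [h.inner_diff_left hρ, real_inner_comm, hcrit X hX, neg_zero]
  have hHS' : ρ.fixator (insert n S) ≤ ρ.fixator S' := fun g hg =>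
    ρ.mem_fixator_insert.2 ⟨hHw g hg, (ρ.mem_fixator_insert.1 hg).2⟩
  -- The new representation is the normal space at `w` with the fixed part `A` removed; the new
  -- point is `n` without its component in `A`, which does not change the fixator.
  set a : V := A.starProjection n with ha
  have haA : a ∈ A := A.starProjection_apply_mem n
  set n' := n - a with hn'
  let N' : Submodule ℝ V := (T ⊔ A)ᗮ ⊓ N
  have hmemN' : ∀ v, v ∈ N' ↔ ((∀ X ∈ h.lieFix S, inner ℝ (h.diff X w) v = 0) ∧
      ∀ b ∈ A, inner ℝ b v = 0) ∧ v ∈ N := by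
    intro v
    rw [Submodule.mem_inf, ← Submodule.inf_orthogonal, Submodule.mem_inf, Submodule.mem_orthogonal,
      Submodule.mem_orthogonal]
    refine and_congr_left' (and_congr_left' ⟨fun H X hX => H _ ⟨X, hX, rfl⟩, ?_⟩)
    rintro H _ ⟨X, hX, rfl⟩
    exact H X hX
  have hinvN' : ∀ g ∈ ρ.fixator S', ∀ v ∈ N', ρ g v ∈ N' := by
    intro g hg v hv
    have hg' : g⁻¹ ∈ ρ.fixator S' := inv_mem hg
    have hmove : ∀ u v, inner ℝ u (ρ g v) = inner ℝ (ρ g⁻¹ u) v := by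
      intro u v
      rw [← hρ g (ρ g⁻¹ u) v]
      simp
    rw [hmemN'] at hv ⊢
    refine ⟨⟨fun X hX => ?_, fun b hb => ?_⟩, hN g (hS'S hg) v hv.2⟩
    · rw [hmove, ← h.diff_Ad, (ρ.mem_fixator_insert.1 hg').1]
      exact hv.1.1 _ (h.Ad_mem_lieFix hX (hS'S hg'))
    · rw [hmove, hAfix _ hg' b hb]
      exact hv.1.2 b hb
  have hn'N' : n' ∈ N' := by
    rw [hmemN']
    refine ⟨⟨fun X hX => ?_, fun b hb => ?_⟩, N.sub_mem hn.mem (hA haA)⟩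
    · rw [hn', inner_sub_right, hcrit X hX, hAperp X hX a haA, sub_zero]
    · exact Submodule.inner_right_of_mem_orthogonal hb (A.sub_starProjection_mem_orthogonal n)
  have hfixeq : ρ.fixator (insert n' S') = ρ.fixator (insert n S) := by
    ext g
    refine (ρ.mem_fixator_insert (S := S')).trans
      (Iff.trans ?_ (ρ.mem_fixator_insert (S := S)).symm)
    constructor
    · rintro ⟨h1, h2⟩
      refine ⟨?_, hS'S h2⟩
      rw [hn', map_sub, hAfix g h2 a haA] at h1
      exact sub_left_injective h1
    · rintro ⟨h1, h2⟩
      have hg : g ∈ ρ.fixator S' := hHS' (ρ.mem_fixator_insert.2 ⟨h1, h2⟩)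
      refine ⟨?_, hg⟩
      rw [hn', map_sub, hAfix g hg a haA, h1]
  have hdiffn' : ∀ X ∈ h.lieFix S', h.diff X n' = h.diff X n := by
    intro X hX
    rw [hn', map_sub, h.diff_eq_zero_of_fixed hX (fun g hg => hAfix g hg a haA), sub_zero]
  refine ⟨N', n', ⟨hn'N', ?_⟩, hinvN', hfixeq, ?_⟩
  · intro m hm hmX g hg
    rw [hfixeq] at hg
    -- Write `H` for the fixator of `insert n S`. The directions `Ad k Z - Z` with `k` in `H` are
    -- those through which `H` moves vectors of `N`.
    let c : Submodule ℝ E := Submodule.span ℝ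
      {Y | ∃ k ∈ ρ.fixator (insert n S), ∃ Z ∈ h.lieFix S, Y = C.Ad k Z - Z}
    have hcS : c ≤ h.lieFix S := by
      rw [Submodule.span_le]
      rintro _ ⟨k, hk, Z, hZ, rfl⟩
      exact sub_mem (h.Ad_mem_lieFix hZ (ρ.mem_fixator_insert.1 hk).2) hZ
    let p : c →ₗ[ℝ] V := h.diff.flip n ∘ₗ c.subtype
    let q : c →ₗ[ℝ] V := h.diff.flip w ∘ₗ c.subtype
    have hp : ∀ X : c, p X = h.diff X n := fun X => rfl
    have hq : ∀ X : c, q X = h.diff X w := fun X => rfl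
    -- Split `u` into a tangent vector `Z n` and a normal vector. `H` fixes the normal part, so `k u
    -- - u = (Ad k Z - Z) n`.
    have hstar : ∀ k ∈ ρ.fixator (insert n S), ∀ u ∈ N, ρ k u - u ∈ p.range := by
      intro k hk u hu
      obtain ⟨Z, hZ, hZu⟩ := mem_tangent.1
        ((h.tangent S n).starProjection_apply_mem u)
      have hperp : ∀ X ∈ h.lieFix S, inner ℝ (h.diff X n) (u - h.diff Z n) = 0 := by
        intro X hX
        rw [hZu]
        exact Submodule.inner_right_of_mem_orthogonal (mem_tangent.2 ⟨X, hX, rfl⟩)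
          ((h.tangent S n).sub_starProjection_mem_orthogonal u)
      have hfix := hn.fixed (u - h.diff Z n)
        (N.sub_mem hu (h.diff_mem_of_invariant hN hZ hn.mem)) hperp k hk
      refine ⟨⟨C.Ad k Z - Z, Submodule.subset_span ⟨k, hk, Z, hZ, rfl⟩⟩, ?_⟩
      have h1 := h.diff_Ad k Z n
      rw [(ρ.mem_fixator_insert.1 hk).1] at h1
      rw [hp, map_sub, LinearMap.sub_apply, h1]
      rw [map_sub] at hfix
      rw [sub_eq_sub_iff_add_eq_add] at hfix ⊢
      rw [add_comm, ← hfix, add_comm]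
    -- Orthogonality of `m` to `p.range` is enough, since `⟨u, g m - m⟩ = ⟨g⁻¹ u - u, m⟩` for `u` in
    -- `N`. For the hypotheses of the lemma, values of `q` are tangent at `w`, hence orthogonal to
    -- `N'`, and directions in `ker q` lie in `lieFix S'`, where `n` may be replaced by `n'`.
    have key := inner_eq_zero_of_range_le p q (m := m) ?_ ?_ ?_ ?_ ?_
    · have h1 : ∀ u ∈ N, inner ℝ u (ρ g m - m) = 0 := by
        intro u hu
        obtain ⟨X, hX⟩ := hstar g⁻¹ (inv_mem hg) u hu
        have h2 := key X
        rw [hX, inner_sub_left] at h2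
        have h3 := hρ g (ρ g⁻¹ u) m
        simp only [Representation.self_inv_apply] at h3
        rw [inner_sub_right, h3, h2]
      have h4 : ρ g m - m ∈ N :=
        N.sub_mem (hN g (ρ.mem_fixator_insert.1 hg).2 m ((hmemN' m).1 hm).2) ((hmemN' m).1 hm).2
      exact sub_eq_zero.1 (inner_self_eq_zero.1 (h1 _ h4))
    · intro X hX
      have h1 : (X : E) ∈ h.lieFix (insert n S) := mem_lieFix_insert.2 ⟨hX, hcS X.2⟩
      exact h.diff_eq_zero_of_fixed h1 hHw
    · have h1 : ∀ Y ∈ c, h.diff Y w ∈ p.range := by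
        intro Y hY
        induction hY using Submodule.span_induction with
        | mem Y hY =>
          obtain ⟨k, hk, Z, hZ, rfl⟩ := hY
          have h2 := h.diff_Ad k Z w
          rw [hHw k hk] at h2
          rw [map_sub, LinearMap.sub_apply, h2]
          exact hstar k hk _ (h.diff_mem_of_invariant hN hZ hw)
        | zero => simp
        | add Y Y' _ _ h1 h2 => rw [map_add]; exact add_mem h1 h2
        | smul r Y _ h1 => rw [map_smul]; exact Submodule.smul_mem _ r h1
      rintro _ ⟨X, rfl⟩
      exact h1 X X.2
    · intro X Y hY
      have hY' : (Y : E) ∈ h.lieFix S' := mem_lieFix_insert.2 ⟨hY, hcS Y.2⟩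
      rw [hp, ← hdiffn' _ hY']
      exact ((hmemN' _).1 (h.diff_mem_of_invariant hinvN' hY' hn'N')).1.1 X (hcS X.2)
    · intro X
      exact ((hmemN' m).1 hm).1.1 X (hcS X.2)
    · intro Y hY
      have hY' : (Y : E) ∈ h.lieFix S' := mem_lieFix_insert.2 ⟨hY, hcS Y.2⟩
      rw [hp, ← hdiffn' _ hY']
      exact hmX _ hY'
  · have h1 : Module.finrank ℝ (T ⊔ A : Submodule ℝ V) + Module.finrank ℝ N' =
        Module.finrank ℝ N := Submodule.finrank_add_inf_finrank_orthogonal (sup_le hTN hA)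
    have h2 : Disjoint T A := by
      rw [Submodule.disjoint_def]
      rintro _ ⟨X, hX, rfl⟩ hXA
      exact inner_self_eq_zero.1 (hAperp X hX _ hXA)
    have h3 := Submodule.finrank_sup_add_finrank_inf_eq T A
    rw [h2.eq_bot, finrank_bot] at h3
    have h4 := h.finrank_tangent_add S w
    rw [← hS', ← hT] at h4
    omega

end GroupChart.IsSmoothRep

/-! ### Nonpositivity of the homogeneity rank of one representation -/

/-- Commuting skew-adjoint operators have a common invariant subspace on which any symmetric
product of two of them is scalar; a vector of it spans an orbit of dimension at most one. -/
theorem exists_finrank_range_le_one_of_skew {F V : Type*} [AddCommGroup F] [Module ℝ F]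
    [NormedAddCommGroup V] [InnerProductSpace ℝ V] [FiniteDimensional ℝ V]
    (D : F →ₗ[ℝ] V →ₗ[ℝ] V) {N : Submodule ℝ V} (hN0 : N ≠ ⊥)
    (hN : ∀ x, ∀ v ∈ N, D x v ∈ N) (hskew : ∀ x v w, inner ℝ (D x v) w = -inner ℝ v (D x w))
    (hcomm : ∀ x y v, D x (D y v) = D y (D x v)) :
    ∃ w ∈ N, w ≠ 0 ∧ Module.finrank ℝ (D.flip w).range ≤ 1 := by
  let P : Set (Submodule ℝ V) := {M | M ≤ N ∧ M ≠ ⊥ ∧ ∀ x, ∀ v ∈ M, D x v ∈ M}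
  -- On a minimal invariant subspace each product `D x ∘ D y` is symmetric and commutes with every
  -- `D z`; an eigenspace is invariant, hence everything.
  obtain ⟨M, ⟨hMN, hM0, hM⟩, hmin⟩ := wellFounded_lt.has_min P ⟨N, le_rfl, hN0, hN⟩
  have hscal : ∀ x y, ∃ c : ℝ, ∀ v ∈ M, D x (D y v) = c • v := by
    intro x y
    let T : M →ₗ[ℝ] M := (D x ∘ₗ D y).restrict (fun v hv => hM x _ (hM y v hv))
    have hT : T.IsSymmetric := by
      intro v w
      change inner ℝ (D x (D y v)) (w : V) = inner ℝ (v : V) (D x (D y w))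
      rw [hskew, hskew, neg_neg, hcomm]
    have hnt : Nontrivial M := Submodule.nontrivial_iff_ne_bot.2 hM0
    have hev := hT.hasEigenvalue_iSup_of_finiteDimensional
    obtain ⟨v, hv⟩ := hev.exists_hasEigenvector
    set c : ℝ := _ 
    have hvc := hv.apply_eq_smul
    let M' : Submodule ℝ V := M ⊓ (D x ∘ₗ D y - c • LinearMap.id).ker
    have hmem : ∀ u, u ∈ M' ↔ u ∈ M ∧ D x (D y u) = c • u := by
      intro u
      simp [M', LinearMap.mem_ker, sub_eq_zero]
    have hM'P : M' ∈ P := by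
      refine ⟨inf_le_left.trans hMN, ?_, ?_⟩
      · intro hbot
        have h1 : (v : V) ∈ M' := (hmem v).2 ⟨v.2, congrArg Subtype.val hvc⟩
        rw [hbot, Submodule.mem_bot] at h1
        exact hv.2 (Subtype.ext h1)
      · intro z u hu
        obtain ⟨h1, h2⟩ := (hmem u).1 hu
        refine (hmem _).2 ⟨hM z u h1, ?_⟩
        rw [hcomm y z, hcomm x z, h2, map_smul]
    have hMM' : M' = M := by
      by_contra hne
      exact hmin M' hM'P (lt_of_le_of_ne inf_le_left hne)
    exact ⟨c, fun u hu => ((hmem u).1 (hMM' ▸ hu)).2⟩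
  obtain ⟨w, hwM, hw0⟩ := Submodule.exists_mem_ne_zero_of_ne_bot hM0
  refine ⟨w, hMN hwM, hw0, ?_⟩
  by_cases hall : ∀ x, D x w = 0
  · have : (D.flip w).range = ⊥ := by
      rw [LinearMap.range_eq_bot]
      ext x
      exact hall x
    rw [this, finrank_bot]
    exact zero_le_one
  push Not at hall
  obtain ⟨x₀, hx₀⟩ := hall
  obtain ⟨c₀, hc₀⟩ := hscal x₀ x₀
  have hc₀0 : c₀ ≠ 0 := by
    rintro rfl
    have h1 := hskew x₀ w (D x₀ w)
    rw [hc₀ w hwM, zero_smul, inner_zero_right, neg_zero] at h1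
    exact hx₀ (inner_self_eq_zero.1 h1)
  -- From `D x₀² = c₀` and `D y D x₀ = c` on `M` one gets `c₀ D y w = c D x₀ w`, with `c₀ ≠ 0` by
  -- skewness.
  have hle : (D.flip w).range ≤ ℝ ∙ (D x₀ w) := by
    rintro _ ⟨y, rfl⟩
    obtain ⟨c, hc⟩ := hscal y x₀
    rw [Submodule.mem_span_singleton]
    refine ⟨c₀⁻¹ * c, ?_⟩
    have h1 : D x₀ (D y (D x₀ w)) = c • D x₀ w := by rw [hc w hwM, map_smul]
    rw [hcomm y x₀, hcomm x₀ x₀, hc₀ _ (hM y w hwM)] at h1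
    rw [mul_smul, ← h1, smul_smul, inv_mul_cancel₀ hc₀0, one_smul]
    rfl
  exact (Submodule.finrank_mono hle).trans (finrank_span_singleton hx₀).le

namespace GroupChart.IsSmoothRep

variable {G E V : Type*} [Group G] [TopologicalSpace G] [IsTopologicalGroup G] [T2Space G]
  [NormedAddCommGroup E] [NormedSpace ℝ E] [FiniteDimensional ℝ E]
  [NormedAddCommGroup V] [InnerProductSpace ℝ V] [FiniteDimensional ℝ V]
  {C : GroupChart G E} {ρ : Representation ℝ G V}

/-- Some nonzero vector is fixed by a subtorus of codimension at most one of a maximal torus. -/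
theorem exists_torusRank_le_add_one (h : C.IsSmoothRep ρ)
    (hρ : ∀ g v w, inner ℝ (ρ g v) (ρ g w) = inner ℝ v w) {S : Set V} {N : Submodule ℝ V}
    (hN0 : N ≠ ⊥) (hN : ∀ g ∈ ρ.fixator S, ∀ v ∈ N, ρ g v ∈ N) :
    ∃ w ∈ N, w ≠ 0 ∧ torusRank (ρ.fixator S) ≤ torusRank (ρ.fixator (insert w S)) + 1 := by
  obtain ⟨ψ, hψ, hψS⟩ := exists_isTorusParam_torusRank C (ρ.fixator S)
  let A := C.velocityMap hψ.continuous hψ.map_add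
  have hline := isOneParam_line hψ.continuous hψ.map_add
  have hder : ∀ x v, HasDerivAt (fun t : ℝ => ρ (ψ (t • x)) v) (h.diff (A x) v) 0 := by
    intro x v
    have := h.hasDerivAt_oneParam (hline x) v 0
    simp only [zero_smul, hψ.map_zero, _root_.map_one, Module.End.one_apply] at this
    exact this
  have hAS : ∀ x, A x ∈ h.lieFix S := by
    intro x s hs
    refine (hder x s).unique ((hasDerivAt_const (0 : ℝ) s).congr_of_eventuallyEq ?_)
    exact Eventually.of_forall fun t => hψS _ s hs
  have hcomm1 : ∀ x y v, h.diff (A x) (ρ (ψ y) v) = ρ (ψ y) (h.diff (A x) v) := by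
    intro x y v
    have h1 := (LinearMap.toContinuousLinearMap (ρ (ψ y))).hasFDerivAt.comp_hasDerivAt 0 (hder x v)
    refine (hder x (ρ (ψ y) v)).unique (h1.congr_of_eventuallyEq (Eventually.of_forall fun t => ?_))
    simp only [Function.comp_apply, LinearMap.coe_toContinuousLinearMap', ← Module.End.mul_apply,
      ← map_mul, ← hψ.map_add, add_comm]
  have hcomm : ∀ x y v, h.diff (A x) (h.diff (A y) v) = h.diff (A y) (h.diff (A x) v) := by
    intro x y v
    have h1 := (LinearMap.toContinuousLinearMap (h.diff (A x))).hasFDerivAt.comp_hasDerivAt 0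
      (hder y v)
    refine h1.unique ((hder y (h.diff (A x) v)).congr_of_eventuallyEq
      (Eventually.of_forall fun t => ?_))
    exact hcomm1 x _ v
  obtain ⟨w, hwN, hw0, hw1⟩ := exists_finrank_range_le_one_of_skew (h.diff ∘ₗ A) hN0
    (fun x v hv => h.diff_mem_of_invariant hN (hAS x) hv)
    (fun x v w => h.inner_diff_left hρ _ v w) hcomm
  refine ⟨w, hwN, hw0, ?_⟩
  let Λ : AddSubgroup (Fin (torusRank (ρ.fixator S)) → ℝ) :=
    { carrier := {x | ρ (ψ x) w = w}
      zero_mem' := by simp [hψ.map_zero]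
      add_mem' := fun {a b} (ha : ρ (ψ a) w = w) (hb : ρ (ψ b) w = w) => by
        simp [hψ.map_add, ha, hb]
      neg_mem' := fun {a} (ha : ρ (ψ a) w = w) => by
        have h1 : ρ (ψ (-a)) (ρ (ψ a) w) = w := by simp [hψ.map_neg]
        rwa [ha] at h1 }
  have hmem : ∀ x, x ∈ Λ ↔ ρ (ψ x) w = w := fun x => Iff.rfl
  have hrank := finrank_linearPart_le_torusRank C hψ.continuous hψ.map_add Λ
    (isClosed_eq ((h.continuous w).comp hψ.continuous) continuous_const)
    (fun x hx => by rw [hmem, (hψ.eq_one_iff x).2 hx, _root_.map_one]; rfl)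
    (fun x _ => hψ.eq_one_iff x) (K := ρ.fixator (insert w S))
    (fun x hx => ρ.mem_fixator_insert.2 ⟨hx, hψS x⟩)
  -- Directions of the torus killing `w` have codimension at most one and fix `w` along their whole
  -- lines, so they give a torus in the isotropy group of `w`.
  have hker : ((h.diff ∘ₗ A).flip w).ker ≤ Λ.linearPart := by
    intro x hx t
    exact h.oneParam_apply_eq (hline x) hx t
  have h1 := Submodule.finrank_mono hker
  have h2 := ((h.diff ∘ₗ A).flip w).finrank_range_add_finrank_ker
  rw [Module.finrank_fin_fun] at h2
  omega

/-- Rank drops by at most the codimension of a regular orbit. -/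
theorem IsNice.torusRank_add_le [CompactSpace G] {h : C.IsSmoothRep ρ}
    (hρ : ∀ g v w, inner ℝ (ρ g v) (ρ g w) = inner ℝ v w)
    {S : Set V} {N : Submodule ℝ V} {n : V} (hn : h.IsNice S N n)
    (hN : ∀ g ∈ ρ.fixator S, ∀ v ∈ N, ρ g v ∈ N) :
    torusRank (ρ.fixator S) + Module.finrank ℝ (h.lieFix S) ≤
      torusRank (ρ.fixator (insert n S)) + Module.finrank ℝ (h.lieFix (insert n S)) +
        Module.finrank ℝ N := by
  induction hk : Module.finrank ℝ N using Nat.strong_induction_on generalizing S N n with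
  | _ k ih =>
    by_cases hN0 : N = ⊥
    · have hn0 : n = 0 := by simpa [hN0] using hn.mem
      have hle : ρ.fixator S ≤ ρ.fixator (insert n S) := fun g hg =>
        ρ.mem_fixator_insert.2 ⟨by simp [hn0], hg⟩
      have h1 := Submodule.finrank_mono (h.lieFix_le_of_fixator_le hle)
      have h2 : torusRank (ρ.fixator S) ≤ torusRank (ρ.fixator (insert n S)) :=
        torusRank_le_of_conj C 1 fun k hk => by simpa using hle hk
      omega
    obtain ⟨w₀, hw₀N, hw₀0, hrank⟩ := h.exists_torusRank_le_add_one hρ hN0 hN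
    have hclosed : IsClosed (ρ.fixator S : Set G) := by
      have : (ρ.fixator S : Set G) = ⋂ s ∈ S, {g | ρ g s = s} := by
        ext g; simp [Representation.mem_fixator]
      rw [this]
      exact isClosed_biInter fun s _ => isClosed_eq (h.continuous s) continuous_const
    -- `w₀` is moved within its orbit to the point closest to `n`, as the slice argument requires;
    -- its isotropy group only changes by conjugation.
    obtain ⟨g, hgS, hg⟩ := hclosed.isCompact.exists_isMaxOn ⟨1, one_mem _⟩
      (f := fun g => inner ℝ (ρ g w₀) n) ((h.continuous w₀).inner continuous_const).continuousOn
    set w := ρ g w₀ with hw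
    have hwN : w ∈ N := hN g hgS w₀ hw₀N
    have hw0 : w ≠ 0 := by
      intro h0
      apply hw₀0
      have := hρ g w₀ w₀
      rw [← hw, h0, inner_zero_left] at this
      exact inner_self_eq_zero.1 this.symm
    have hmax : ∀ k ∈ ρ.fixator S, inner ℝ (ρ k w) n ≤ inner ℝ w n := by
      intro k hk
      have := hg (show k * g ∈ (ρ.fixator S : Set G) from mul_mem hk hgS)
      simpa [map_mul, Module.End.mul_apply] using this
    -- Removing the line `ℝ w`, which is normal to the orbit, makes the dimension drop by at least
    -- one and pays for the loss of one in the rank.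
    obtain ⟨N', n', hn', hN', hfix, hdim⟩ := hn.slice hρ hN hwN hmax (A := ℝ ∙ w)
      (by rwa [Submodule.span_singleton_le_iff_mem])
      (fun k hk a ha => by
        obtain ⟨r, rfl⟩ := Submodule.mem_span_singleton.1 ha
        rw [map_smul, (ρ.mem_fixator_insert.1 hk).1])
      (fun X hX a ha => by
        obtain ⟨r, rfl⟩ := Submodule.mem_span_singleton.1 ha
        have h1 := h.inner_diff_left hρ X w w
        rw [real_inner_comm w] at h1
        rw [inner_smul_right, real_inner_comm]
        have : inner ℝ w (h.diff X w) = 0 := by linarith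
        simp [this])
    rw [finrank_span_singleton hw0] at hdim
    have hlt := h.finrank_tangent_add S w
    have h1 := ih _ (by omega) hn' hN' rfl
    have h2 : torusRank (ρ.fixator (insert w₀ S)) ≤ torusRank (ρ.fixator (insert w S)) := by
      refine torusRank_le_of_conj C g fun k hk => ?_
      obtain ⟨hk1, hk2⟩ := ρ.mem_fixator_insert.1 hk
      refine ρ.mem_fixator_insert.2 ⟨?_, mul_mem (mul_mem hgS hk2) (inv_mem hgS)⟩
      simp [hw, map_mul, Module.End.mul_apply, hk1]
    have h3 := Submodule.finrank_mono (h.lieFix_le_of_fixator_le hfix.le)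
    rw [hfix] at h1
    omega

end GroupChart.IsSmoothRep

/-! ### Tangent cones of orbits and existence of regular points -/

theorem HasFDerivAt.tendsto_smul_sub {E F : Type*} [NormedAddCommGroup E] [NormedSpace ℝ E]
    [NormedAddCommGroup F] [NormedSpace ℝ F] {f : E → F} {f' : E →L[ℝ] F} (hf : HasFDerivAt f f' 0)
    {ι : Type*} {l : Filter ι} {c : ι → ℝ} {d : ι → E} {v : E} (hd : Tendsto d l (𝓝 0))
    (hcd : Tendsto (fun i => c i • d i) l (𝓝 v)) :
    Tendsto (fun i => c i • (f (d i) - f 0)) l (𝓝 (f' v)) := by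
  simpa using (hasFDerivWithinAt_univ.2 hf).lim hd (Eventually.of_forall fun _ => Set.mem_univ _) hcd

theorem Ultrafilter.exists_tendsto_of_isCompact {ι X : Type*} [TopologicalSpace X]
    (l : Ultrafilter ι) {K : Set X} (hK : IsCompact K) {f : ι → X} (hf : ∀ᶠ i in l, f i ∈ K) :
    ∃ a ∈ K, Tendsto f l (𝓝 a) :=
  hK.ultrafilter_le_nhds (l.map f) (le_principal_iff.2 hf)

namespace GroupChart.IsSmoothRep

section Tangent

variable {G E V : Type*} [Group G] [TopologicalSpace G] [IsTopologicalGroup G]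
  [NormedAddCommGroup E] [NormedSpace ℝ E] [FiniteDimensional ℝ E]
  [NormedAddCommGroup V] [InnerProductSpace ℝ V] [FiniteDimensional ℝ V]
  {C : GroupChart G E} {ρ : Representation ℝ G V}

/-- Every vector of the tangent cone of an orbit is a value of the infinitesimal action. -/
theorem exists_diff_eq_of_tendsto [T2Space G] [CompactSpace G] (h : C.IsSmoothRep ρ) {ι : Type*}
    (l : Ultrafilter ι) {g : ι → G} {r : ι → ℝ} {w u : V}
    (hg : Tendsto g l (𝓝 1))
    (hu : Tendsto (fun i => r i • (ρ (g i) w - w)) l (𝓝 u)) : ∃ X, h.diff X w = u := by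
  obtain ⟨K, ⟨hK, hKc⟩, hKs⟩ := (compact_basis_nhds (1 : G)).mem_iff.1
    (C.chart.open_source.mem_nhds C.one_mem_source)
  -- Among the elements of `K` moving `w` to `g i w`, choose one closest to the identity in the
  -- chart. This discards useless motion inside the isotropy group of `w`.
  have hγ : ∀ i, ∃ γ : G, g i ∈ K → γ ∈ K ∧ ρ γ w = ρ (g i) w ∧
      ∀ γ' ∈ K, ρ γ' w = ρ (g i) w → ‖C.chart γ‖ ≤ ‖C.chart γ'‖ := by
    intro i
    by_cases hi : g i ∈ K
    · obtain ⟨γ, hγ, hmin⟩ := (hKc.inter_right (isClosed_eq (h.continuous w)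
        (continuous_const (y := ρ (g i) w)))).exists_isMinOn ⟨g i, hi, rfl⟩
        (f := fun γ => ‖C.chart γ‖)
        (C.chart.continuousOn.mono (Set.inter_subset_left.trans hKs)).norm
      exact ⟨γ, fun _ => ⟨hγ.1, hγ.2, fun γ' h1 h2 => hmin ⟨h1, h2⟩⟩⟩
    · exact ⟨1, fun h => absurd h hi⟩
  choose γ hγ using hγ
  have hgK : ∀ᶠ i in l, g i ∈ K := hg hK
  set x : ι → E := fun i => C.chart (γ i) with hxdef
  have hsx : ∀ᶠ i in l, C.chart.symm (x i) = γ i := by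
    filter_upwards [hgK] with i hi using C.chart.left_inv (hKs (hγ i hi).1)
  have hx : Tendsto x l (𝓝 0) := by
    rw [tendsto_zero_iff_norm_tendsto_zero]
    have h1 := (C.tendsto_chart.comp hg).norm
    rw [norm_zero] at h1
    refine squeeze_zero' (Eventually.of_forall fun i => norm_nonneg _) ?_ h1
    filter_upwards [hgK] with i hi using (hγ i hi).2.2 _ hi rfl
  have hγ1 : Tendsto γ l (𝓝 1) := (C.tendsto_symm.comp hx).congr' hsx
  have hval : ∀ᶠ i in l, ρ (C.chart.symm (x i)) w - ρ (C.chart.symm 0) w = ρ (g i) w - w := by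
    filter_upwards [hsx, hgK] with i h1 h2
    rw [h1, (hγ i h2).2.1, C.symm_zero, _root_.map_one, Module.End.one_apply]
  by_cases hx0 : ∀ᶠ i in l, x i = 0
  · refine ⟨0, ?_⟩
    rw [map_zero, LinearMap.zero_apply]
    refine tendsto_nhds_unique (tendsto_const_nhds.congr' ?_) hu
    filter_upwards [hval, hx0] with i h1 h2
    rw [← h1, h2, sub_self, smul_zero]
  replace hx0 : ∀ᶠ i in l, x i ≠ 0 := Ultrafilter.eventually_not.2 hx0
  obtain ⟨X, -, hX⟩ := l.exists_tendsto_of_isCompact (isCompact_closedBall (0 : E) 1)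
    (f := fun i => ‖x i‖⁻¹ • x i) (by
      filter_upwards [hx0] with i hi
      rw [mem_closedBall_zero_iff, norm_smul, norm_inv, norm_norm,
        inv_mul_cancel₀ (norm_ne_zero_iff.2 hi)])
  have ht : Tendsto (fun i => ‖x i‖) l (𝓝 0) := by simpa using hx.norm
  have hz : Tendsto (fun i => ‖x i‖⁻¹ • (ρ (g i) w - w)) l (𝓝 (h.diff X w)) := by
    refine ((h.hasFDerivAt w).tendsto_smul_sub hx hX).congr' ?_
    filter_upwards [hval] with i hi
    rw [hi]
  -- If the limiting direction `X` killed `w`, a curve with velocity `-X` in the isotropy group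
  -- would correct `γ i` to an element with the same value on `w` and chart norm `o(‖x i‖)`, against
  -- minimality.
  by_cases hX0 : h.diff X w = 0
  · obtain ⟨c, hc1, hcc, hcX, hcw⟩ := h.exists_curve_fixing (X := -X) (W := ℝ ∙ w) (by
      intro v hv
      obtain ⟨a, rfl⟩ := Submodule.mem_span_singleton.1 hv
      simp [hX0])
    have hc : Tendsto (fun i => c ‖x i‖) l (𝓝 1) := by
      have := hcc.tendsto.comp ht
      rwa [hc1] at this
    have hcd : Tendsto (fun i => ‖x i‖⁻¹ • C.chart (c ‖x i‖)) l (𝓝 (-X)) := by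
      have h1 := hcX.hasFDerivAt.tendsto_smul_sub (c := fun i => ‖x i‖⁻¹) (v := 1) ht (by
        refine tendsto_const_nhds.congr' ?_
        filter_upwards [hx0] with i hi
        rw [smul_eq_mul, inv_mul_cancel₀ (norm_ne_zero_iff.2 hi)])
      simpa [hc1, C.map_one] using h1
    have hp : Tendsto (fun i => (x i, C.chart (c ‖x i‖))) l (𝓝 (0 : E × E)) :=
      hx.prodMk_nhds (C.tendsto_chart.comp hc)
    have hm := C.hasStrictFDerivAt_mul.hasFDerivAt.tendsto_smul_sub hp
      (c := fun i => ‖x i‖⁻¹) (v := (X, -X)) (by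
        simpa only [Prod.smul_mk] using hX.prodMk_nhds hcd)
    have hm0 : C.mul 0 = 0 := C.mul_zero_right.self_of_nhds
    simp only [hm0, sub_zero, add_apply, ContinuousLinearMap.coe_fst',
      ContinuousLinearMap.coe_snd', add_neg_cancel] at hm
    have hm1 := hm.norm
    rw [norm_zero] at hm1
    have hcont := ge_of_tendsto hm1 (b := 1) (by
      have hγc : Tendsto (fun i => γ i * c ‖x i‖) l (𝓝 1) := by simpa using hγ1.mul hc
      filter_upwards [hgK, hx0, hγc.eventually_mem hK, ht.eventually hcw, hsx,
        hc.eventually C.eventually_symm_chart] with i h1 h2 h3 h4 h5 h6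
      have h7 := (hγ i h1).2.2 _ h3 (by
        rw [map_mul, Module.End.mul_apply, h4 w (Submodule.mem_span_singleton_self w),
          (hγ i h1).2.1])
      rw [C.chart_mul h5 h6] at h7
      rw [norm_smul, norm_inv, norm_norm, ← div_eq_inv_mul, one_le_div (norm_pos_iff.2 h2)]
      exact h7)
    exact absurd hcont (by norm_num)
  · set Z := h.diff X w with hZ
    have hZ0 : inner ℝ Z Z ≠ 0 := fun h0 => hX0 (inner_self_eq_zero.1 h0)
    have h1 : Tendsto (fun i => inner ℝ (‖x i‖⁻¹ • (ρ (g i) w - w)) Z) l (𝓝 (inner ℝ Z Z)) :=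
      hz.inner tendsto_const_nhds
    -- Otherwise the displacement of `w` has exact order `‖x i‖`, so the scale `r i` is comparable
    -- with `‖x i‖⁻¹` and `u` is a multiple of `h.diff X w`.
    have h2 : Tendsto (fun i => r i * ‖x i‖) l (𝓝 (inner ℝ u Z / inner ℝ Z Z)) := by
      refine ((hu.inner tendsto_const_nhds).div h1 hZ0).congr' ?_
      filter_upwards [hx0, h1.eventually_ne hZ0] with i h3 h4
      rw [Pi.div_apply, div_eq_iff h4, inner_smul_left, inner_smul_left]
      have := norm_ne_zero_iff.2 h3
      simp only [conj_trivial]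
      field_simp
    refine ⟨(inner ℝ u Z / inner ℝ Z Z) • X, ?_⟩
    rw [map_smul, LinearMap.smul_apply, ← hZ]
    refine tendsto_nhds_unique ((h2.smul hz).congr' ?_) hu
    filter_upwards [hx0] with i hi
    rw [smul_smul, mul_assoc, mul_inv_cancel₀ (norm_ne_zero_iff.2 hi), mul_one]

/-- Regular points exist. -/
theorem exists_isNice [T2Space G] [CompactSpace G] (h : C.IsSmoothRep ρ)
    (hρ : ∀ g v w, inner ℝ (ρ g v) (ρ g w) = inner ℝ v w) {N : Submodule ℝ V}
    (hN : ∀ g, ∀ v ∈ N, ρ g v ∈ N) : ∃ n, h.IsNice ∅ N n := by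
  have hnorm : ∀ g v, ‖ρ g v‖ = ‖v‖ := by
    intro g v
    rw [norm_eq_sqrt_real_inner, norm_eq_sqrt_real_inner, hρ]
  have hmove : ∀ g u v, inner ℝ u (ρ g⁻¹ v) = inner ℝ (ρ g u) v := by
    intro g u v
    rw [← hρ g u (ρ g⁻¹ v)]
    simp
  let F : V → Submodule ℝ V := fun w =>
    { carrier := {v | v ∈ N ∧ ∀ g, ρ g w = w → ρ g v = v}
      zero_mem' := ⟨N.zero_mem, by simp⟩
      add_mem' := fun {a b} ha hb => ⟨N.add_mem ha.1 hb.1, fun g hg => by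
        rw [map_add, ha.2 g hg, hb.2 g hg]⟩
      smul_mem' := fun c a ha => ⟨N.smul_mem c ha.1, fun g hg => by rw [map_smul, ha.2 g hg]⟩ }
  have hF : ∀ w v, v ∈ F w ↔ v ∈ N ∧ ∀ g, ρ g w = w → ρ g v = v := fun w v => Iff.rfl
  -- `F w` is the part of `N` fixed by the isotropy group of `w`; the regular point is one for which
  -- it has maximal dimension.
  obtain ⟨w, hwN, hwmax⟩ : ∃ w ∈ N, ∀ w' ∈ N,
      Module.finrank ℝ (F w') ≤ Module.finrank ℝ (F w) := by
    have hbdd : BddAbove ((fun w => Module.finrank ℝ (F w)) '' (N : Set V)) :=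
      ⟨Module.finrank ℝ V, by rintro _ ⟨w, -, rfl⟩; exact Submodule.finrank_le _⟩
    obtain ⟨w, hw, hweq⟩ := Nat.sSup_mem
      (Set.Nonempty.image (fun w => Module.finrank ℝ (F w)) ⟨0, N.zero_mem⟩) hbdd
    refine ⟨w, hw, fun w' hw' => ?_⟩
    have := le_csSup hbdd ⟨w', hw', rfl⟩
    rwa [← hweq] at this
  -- If `w` is the point of its orbit closest to `z`, anything fixing `w + z` fixes `w`. So `F w ≤ F
  -- (w + z)`, and maximality gives equality.
  have hK : ∀ z ∈ N, (∀ k, inner ℝ (ρ k w) z ≤ inner ℝ w z) → z ∈ F w := by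
    intro z hz hmax
    have hfix : ∀ k, ρ k (w + z) = w + z → ρ k w = w := by
      intro k hk
      have h1 := hρ k w (w + z)
      rw [hk, inner_add_right, inner_add_right] at h1
      have h2 := hmax k
      have h3 := norm_sub_sq_real (ρ k w) w
      rw [hnorm, ← real_inner_self_eq_norm_sq w] at h3
      have h4 : ‖ρ k w - w‖ ^ 2 ≤ 0 := by linarith
      have h5 : ‖ρ k w - w‖ = 0 := by nlinarith [norm_nonneg (ρ k w - w)]
      exact sub_eq_zero.1 (norm_eq_zero.1 h5)
    have hle : F w ≤ F (w + z) := fun v hv => ⟨hv.1, fun g hg => hv.2 g (hfix g hg)⟩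
    have heq : F w = F (w + z) :=
      Submodule.eq_of_le_of_finrank_le hle (hwmax _ (N.add_mem hwN hz))
    have hmem : w + z ∈ F w := heq ▸ ⟨N.add_mem hwN hz, fun g hg => hg⟩
    have hw : w ∈ F w := ⟨hwN, fun g hg => hg⟩
    simpa using (F w).sub_mem hmem hw
  refine ⟨w, hwN, fun m hm hperp g hg => ?_⟩
  suffices m ∈ F w from this.2 g (ρ.mem_fixator_insert.1 hg).1
  -- A normal vector `m` need not satisfy the global condition in `hK`. So `w + ε m` is moved back
  -- by the group until `w` becomes closest to it, and `ε` tends to `0`.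
  have hγ : ∀ ε : ℝ, ∃ γ, ∀ k, inner ℝ (ρ k w) (w + ε • m) ≤ inner ℝ (ρ γ w) (w + ε • m) := by
    intro ε
    obtain ⟨γ, -, hγ⟩ := isCompact_univ.exists_isMaxOn (Set.univ_nonempty (α := G))
      (f := fun k => inner ℝ (ρ k w) (w + ε • m))
      ((h.continuous w).inner continuous_const).continuousOn
    exact ⟨γ, fun k => hγ (Set.mem_univ k)⟩
  choose γ hγ using hγ
  let l : Ultrafilter ℝ := Ultrafilter.of (𝓝[>] 0)
  have hl : (l : Filter ℝ) ≤ 𝓝[>] 0 := Ultrafilter.of_le _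
  have hl0 : Tendsto (fun ε : ℝ => ε) l (𝓝 0) := hl.trans nhdsWithin_le_nhds
  have hlpos : ∀ᶠ ε : ℝ in l, 0 < ε := hl self_mem_nhdsWithin
  have hclose : ∀ ε, ‖ρ (γ ε) w - (w + ε • m)‖ ≤ ‖ε • m‖ := by
    intro ε
    have h1 := norm_sub_sq_real (ρ (γ ε) w) (w + ε • m)
    have h2 := norm_sub_sq_real w (w + ε • m)
    have h3 := hγ ε 1
    rw [_root_.map_one, Module.End.one_apply] at h3
    rw [hnorm] at h1
    rw [sub_add_cancel_left, norm_neg] at h2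
    exact pow_le_pow_iff_left₀ (norm_nonneg _) (norm_nonneg _) two_ne_zero |>.1 (by linarith)
  obtain ⟨a, -, ha⟩ := l.exists_tendsto_of_isCompact isCompact_univ (f := γ)
    (Eventually.of_forall fun _ => Set.mem_univ _)
  have hεm : Tendsto (fun ε : ℝ => ε • m) l (𝓝 0) := by
    simpa using hl0.smul (tendsto_const_nhds (x := m))
  have haw : ρ a w = w := by
    have h1 : Tendsto (fun ε => ρ (γ ε) w - (w + ε • m)) l (𝓝 0) :=
      squeeze_zero_norm hclose (by simpa using hεm.norm)
    have h2 : Tendsto (fun ε => ρ (γ ε) w - (w + ε • m)) l (𝓝 (ρ a w - (w + 0))) :=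
      (((h.continuous w).tendsto a).comp ha).sub (tendsto_const_nhds.add hεm)
    have h3 := tendsto_nhds_unique h2 h1
    rwa [add_zero, sub_eq_zero] at h3
  let δ : ℝ → G := fun ε => γ ε * a⁻¹
  have hδw : ∀ ε, ρ (δ ε) w = ρ (γ ε) w := by
    intro ε
    have : ρ a⁻¹ w = w := by
      have h1 : ρ a⁻¹ (ρ a w) = w := by simp
      rwa [haw] at h1
    rw [map_mul, Module.End.mul_apply, this]
  have hδ1 : Tendsto δ l (𝓝 1) := by simpa using ha.mul_const a⁻¹
  let z : ℝ → V := fun ε => ρ (δ ε)⁻¹ (w + ε • m)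
  have hzmax : ∀ ε k, inner ℝ (ρ k w) (z ε) ≤ inner ℝ w (z ε) := by
    intro ε k
    rw [hmove, hmove, hδw, ← Module.End.mul_apply, ← map_mul]
    exact hγ ε _
  have hzN : ∀ ε, z ε ∈ N := fun ε => hN _ _ (N.add_mem hwN (N.smul_mem ε hm))
  have hzF : ∀ ε, z ε ∈ F w := fun ε => hK _ (hzN ε) (hzmax ε)
  have hzperp : ∀ ε X, inner ℝ (h.diff X w) (z ε) = 0 := fun ε X =>
    h.inner_diff_eq_zero_of_max (S := ∅) (fun k _ => hzmax ε k) (by simp [mem_lieFix])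
  have hwperp : ∀ X, inner ℝ (h.diff X w) w = 0 := by
    intro X
    have h1 := h.inner_diff_left hρ X w w
    rw [real_inner_comm (h.diff X w) w] at h1
    linarith
  have hδz : ∀ ε, ρ (δ ε) (z ε) = w + ε • m := fun ε => by simp [z]
  let ν : ℝ → V := fun ε => ε⁻¹ • (z ε - w)
  have hνF : ∀ ε, ν ε ∈ F w := fun ε =>
    (F w).smul_mem _ ((F w).sub_mem (hzF ε) ⟨hwN, fun g hg => hg⟩)
  have hν : ∀ ε, ‖z ε - w‖ ≤ ‖ε • m‖ := by
    intro ε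
    rw [← hnorm (δ ε), map_sub, hδz, hδw, norm_sub_rev]
    exact hclose ε
  obtain ⟨n₀, -, hn₀⟩ := l.exists_tendsto_of_isCompact (isCompact_closedBall (0 : V) ‖m‖)
    (f := ν) (by
      filter_upwards [hlpos] with ε hε
      rw [mem_closedBall_zero_iff, norm_smul, norm_inv, Real.norm_of_nonneg hε.le,
        inv_mul_le_iff₀ hε]
      have := hν ε
      rwa [norm_smul, Real.norm_of_nonneg hε.le] at this)
  have hn₀F : n₀ ∈ F w :=
    (Submodule.closed_of_finiteDimensional (F w)).mem_of_tendsto hn₀ (Eventually.of_forall hνF)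
  have hn₀perp : ∀ X, inner ℝ (h.diff X w) n₀ = 0 := by
    intro X
    refine tendsto_nhds_unique (tendsto_const_nhds.inner hn₀) (tendsto_const_nhds.congr fun ε => ?_)
    rw [inner_smul_right, inner_sub_right, hzperp, hwperp, sub_self, mul_zero]
  have hδν : Tendsto (fun ε => ρ (δ ε) (ν ε)) l (𝓝 n₀) := by
    have h1 : Tendsto (fun ε => ρ (δ ε) (ν ε - n₀)) l (𝓝 0) := by
      rw [tendsto_zero_iff_norm_tendsto_zero]
      simp only [hnorm]
      exact tendsto_iff_norm_sub_tendsto_zero.1 hn₀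
    have h2 : Tendsto (fun ε => ρ (δ ε) n₀) l (𝓝 n₀) := by
      have := ((h.continuous n₀).tendsto 1).comp hδ1
      rwa [_root_.map_one, Module.End.one_apply] at this
    simpa using h1.add h2
  -- The limit `n₀` of the rescaled moved-back points lies in `F w` and is normal, while `m - n₀` is
  -- in the tangent cone of the orbit. Being both normal and tangent, it vanishes.
  have hlim : Tendsto (fun ε : ℝ => ε⁻¹ • (ρ (δ ε) w - w)) l (𝓝 (m - n₀)) := by
    refine ((tendsto_const_nhds (x := m)).sub hδν).congr' ?_
    filter_upwards [hlpos] with ε hε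
    rw [map_smul, map_sub, hδz, eq_inv_smul_iff₀ hε.ne', smul_sub, smul_inv_smul₀ hε.ne']
    abel
  obtain ⟨X, hX⟩ := h.exists_diff_eq_of_tendsto l hδ1 hlim
  have h0 : inner ℝ (m - n₀) (m - n₀) = (0 : ℝ) := by
    rw [inner_sub_right, ← hX, hperp X (by simp [mem_lieFix]), hn₀perp, sub_self]
  rw [sub_eq_zero.1 (inner_self_eq_zero.1 h0)]
  exact hn₀F

end Tangent

end GroupChart.IsSmoothRep

/-! ### The rank inequality for two summands -/

theorem Representation.mem_fixator_singleton {G V : Type*} [Group G] [AddCommGroup V] [Module ℝ V]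
    {ρ : Representation ℝ G V} {v : V} {g : G} : g ∈ ρ.fixator {v} ↔ ρ g v = v := by
  simp [Representation.mem_fixator]

/-- `v` has the maximum orbit type within `N`. -/
def Representation.IsPrincipalIn {G V : Type*} [Group G] [AddCommGroup V] [Module ℝ V]
    (ρ : Representation ℝ G V) (N : Submodule ℝ V) (v : V) : Prop :=
  v ∈ N ∧ ∀ w ∈ N, ∃ g, ∀ k ∈ ρ.fixator {v}, g * k * g⁻¹ ∈ ρ.fixator {w}

namespace GroupChart.IsSmoothRep

variable {G E V : Type*} [Group G] [TopologicalSpace G] [IsTopologicalGroup G]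
  [NormedAddCommGroup E] [NormedSpace ℝ E] [FiniteDimensional ℝ E]
  [NormedAddCommGroup V] [InnerProductSpace ℝ V] [FiniteDimensional ℝ V]
  {C : GroupChart G E} {ρ : Representation ℝ G V}

omit [IsTopologicalGroup G] [FiniteDimensional ℝ E] [FiniteDimensional ℝ V] in
theorem mem_lieFix_empty (h : C.IsSmoothRep ρ) (X : E) : X ∈ h.lieFix ∅ := by
  simp [mem_lieFix]

theorem finrank_lieFix_le_of_conj (h : C.IsSmoothRep ρ) {v w : V} (g : G)
    (hg : ∀ k ∈ ρ.fixator {v}, g * k * g⁻¹ ∈ ρ.fixator {w}) :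
    Module.finrank ℝ (h.lieFix {v}) ≤ Module.finrank ℝ (h.lieFix {w}) := by
  have hinj : Function.Injective (C.Ad g) :=
    Function.LeftInverse.injective (g := C.Ad g⁻¹) fun X => by simp
  have h1 : (h.lieFix {v}).map (C.Ad g) ≤ h.lieFix {w} := by
    rintro _ ⟨X, hX, rfl⟩ s rfl
    have h2 : h.diff X (ρ g⁻¹ s) = 0 := by
      refine h.diff_eq_zero_of_fixed hX fun k hk => ?_
      have h3 := Representation.mem_fixator_singleton.1 (hg k hk)
      simp only [map_mul, Module.End.mul_apply] at h3
      have h4 := congrArg (ρ g⁻¹) h3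
      simpa using h4
    have h5 := h.diff_Ad g X (ρ g⁻¹ s)
    rw [h2, map_zero] at h5
    simpa using h5
  rw [(Submodule.equivMapOfInjective (C.Ad g) hinj (h.lieFix {v})).finrank_eq]
  exact Submodule.finrank_mono h1

/-- If `g v` is the point of the orbit closest to `w`, then `g⁻¹ w` is normal to the orbit at `v`,
hence fixed by the isotropy group of `v`. -/
theorem IsNice.isPrincipalIn [CompactSpace G] {h : C.IsSmoothRep ρ}
    (hρ : ∀ g v w, inner ℝ (ρ g v) (ρ g w) = inner ℝ v w) {N : Submodule ℝ V}
    (hN : ∀ g, ∀ v ∈ N, ρ g v ∈ N) {v : V} (hv : h.IsNice ∅ N v) : ρ.IsPrincipalIn N v := by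
  refine ⟨hv.mem, fun w hw => ?_⟩
  obtain ⟨g, -, hg⟩ := isCompact_univ.exists_isMaxOn (Set.univ_nonempty (α := G))
    (f := fun k => inner ℝ (ρ k v) w) ((h.continuous v).inner continuous_const).continuousOn
  have hmove : ∀ u, inner ℝ u (ρ g⁻¹ w) = inner ℝ (ρ g u) w := by
    intro u
    rw [← hρ g u (ρ g⁻¹ w)]
    simp
  have hperp : ∀ X ∈ h.lieFix ∅, inner ℝ (h.diff X v) (ρ g⁻¹ w) = 0 := by
    intro X hX
    refine h.inner_diff_eq_zero_of_max (fun k _ => ?_) hX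
    rw [hmove, hmove, ← Module.End.mul_apply, ← map_mul]
    exact hg (Set.mem_univ _)
  refine ⟨g, fun k hk => ?_⟩
  have h1 := hv.fixed _ (hN _ _ hw) hperp k (by rwa [insert_empty_eq])
  rw [Representation.mem_fixator_singleton, map_mul, map_mul, Module.End.mul_apply,
    Module.End.mul_apply, h1]
  simp

omit [FiniteDimensional ℝ E] in
theorem IsNice.translate {h : C.IsSmoothRep ρ}
    (hρ : ∀ g v w, inner ℝ (ρ g v) (ρ g w) = inner ℝ v w) {N : Submodule ℝ V}
    (hN : ∀ g, ∀ v ∈ N, ρ g v ∈ N) {v : V} (hv : h.IsNice ∅ N v) (g : G) :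
    h.IsNice ∅ N (ρ g v) := by
  refine ⟨hN g v hv.mem, fun m hm hperp k hk => ?_⟩
  rw [insert_empty_eq, Representation.mem_fixator_singleton] at hk
  have h1 := hv.fixed (ρ g⁻¹ m) (hN _ m hm) (fun X _ => by
    rw [← hρ g, Representation.self_inv_apply, ← h.diff_Ad]
    exact hperp _ (h.mem_lieFix_empty _)) (g⁻¹ * k * g) (by
      rw [insert_empty_eq, Representation.mem_fixator_singleton]
      simp only [map_mul, Module.End.mul_apply, hk]
      simp)
  simp only [map_mul, Module.End.mul_apply, Representation.self_inv_apply] at h1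
  simpa using congrArg (ρ g) h1

theorem finrank_lieFix_translate_le (h : C.IsSmoothRep ρ) (v : V) (g : G) :
    Module.finrank ℝ (h.lieFix {v}) ≤ Module.finrank ℝ (h.lieFix {ρ g v}) := by
  refine h.finrank_lieFix_le_of_conj g fun k hk => ?_
  rw [Representation.mem_fixator_singleton] at hk ⊢
  simp [map_mul, Module.End.mul_apply, hk]

/-- The rank inequality for regular points of two orthogonal summands and of their sum. -/
theorem IsNice.torusRank_add_torusRank_le [T2Space G] [CompactSpace G] {h : C.IsSmoothRep ρ}
    (hρ : ∀ g v w, inner ℝ (ρ g v) (ρ g w) = inner ℝ v w) {N₁ N₂ : Submodule ℝ V}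
    (hN₁ : ∀ g, ∀ v ∈ N₁, ρ g v ∈ N₁) (hN₂ : ∀ g, ∀ v ∈ N₂, ρ g v ∈ N₂)
    (horth : ∀ a ∈ N₁, ∀ b ∈ N₂, inner ℝ a b = 0)
    (hdim : Module.finrank ℝ N₁ + Module.finrank ℝ N₂ = Module.finrank ℝ V) {v₁ v₂ y : V}
    (hv₁ : h.IsNice ∅ N₁ v₁) (hv₂ : h.IsNice ∅ N₂ v₂) (hy : h.IsNice ∅ ⊤ y) :
    torusRank (ρ.fixator {v₁}) + torusRank (ρ.fixator {v₂}) + Module.finrank ℝ (h.lieFix {v₁}) +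
        Module.finrank ℝ (h.lieFix {v₂}) ≤
      torusRank G + torusRank (ρ.fixator {y}) + Module.finrank ℝ E +
        Module.finrank ℝ (h.lieFix {y}) := by
  have horth' : ∀ a ∈ N₁, ∀ b ∈ N₂, inner ℝ b a = 0 := fun a ha b hb => by
    rw [real_inner_comm]; exact horth a ha b hb
  obtain ⟨g, hg⟩ := exists_torusRank_add_le C (ρ.fixator {v₁}) (ρ.fixator {v₂})
  set x₀ := ρ g v₁ + v₂ with hx₀
  -- `x₀` is replaced by the point of its orbit closest to the regular point `y`, in order to pass
  -- from `y` to the slice there.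
  obtain ⟨k, -, hk⟩ := isCompact_univ.exists_isMaxOn (Set.univ_nonempty (α := G))
    (f := fun k => inner ℝ (ρ k x₀) y) ((h.continuous x₀).inner continuous_const).continuousOn
  set x₁ := ρ k (ρ g v₁) with hx₁
  set x₂ := ρ k v₂ with hx₂
  set x := ρ k x₀ with hx
  have hxadd : x = x₁ + x₂ := by rw [hx, hx₀, map_add]
  have hn₁ : h.IsNice ∅ N₁ x₁ := (hv₁.translate hρ hN₁ g).translate hρ hN₁ k
  have hn₂ : h.IsNice ∅ N₂ x₂ := hv₂.translate hρ hN₂ k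
  have hmax : ∀ a ∈ ρ.fixator ∅, inner ℝ (ρ a x) y ≤ inner ℝ x y := by
    intro a _
    have : inner ℝ (ρ (a * k) x₀) y ≤ inner ℝ (ρ k x₀) y := hk (Set.mem_univ (a * k))
    simpa only [map_mul, Module.End.mul_apply] using this
  have hfix : ∀ a, ρ a x = x → ρ a x₁ = x₁ ∧ ρ a x₂ = x₂ := by
    intro a ha
    rw [hxadd, map_add] at ha
    have h1 : ρ a x₁ - x₁ = x₂ - ρ a x₂ := by
      rw [sub_eq_sub_iff_add_eq_add, ha, add_comm]
    have h2 : ρ a x₁ - x₁ ∈ N₁ := N₁.sub_mem (hN₁ a _ hn₁.mem) hn₁.mem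
    have h3 : ρ a x₁ - x₁ ∈ N₂ := h1 ▸ N₂.sub_mem hn₂.mem (hN₂ a _ hn₂.mem)
    have h4 : ρ a x₁ - x₁ = 0 := inner_self_eq_zero.1 (horth _ h2 _ h3)
    refine ⟨sub_eq_zero.1 h4, ?_⟩
    rw [h4] at h1
    exact (sub_eq_zero.1 h1.symm).symm
  have hrank₀ := hg (ρ.fixator {x₀}) (fun a ha hga => by
    rw [Representation.mem_fixator_singleton] at ha hga ⊢
    rw [hx₀, map_add, hga]
    simp [map_mul, Module.End.mul_apply, ha])
  have hrank₁ : torusRank (ρ.fixator {x₀}) ≤ torusRank (ρ.fixator {x}) :=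
    torusRank_le_of_conj C k fun a ha => by
      rw [Representation.mem_fixator_singleton] at ha ⊢
      simp [hx, map_mul, Module.End.mul_apply, ha]
  let A : Submodule ℝ V → V → Submodule ℝ V := fun N n => (h.tangent ∅ n)ᗮ ⊓ N
  have hA : ∀ {N : Submodule ℝ V} {n a : V}, a ∈ A N n →
      a ∈ N ∧ ∀ X, inner ℝ (h.diff X n) a = 0 := fun {N n a} ha =>
    ⟨ha.2, fun X => (Submodule.mem_orthogonal _ _).1 ha.1 _ ⟨X, h.mem_lieFix_empty X, rfl⟩⟩
  have hAdim : ∀ {N : Submodule ℝ V} {n : V}, (∀ g, ∀ v ∈ N, ρ g v ∈ N) → n ∈ N →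
      Module.finrank ℝ (A N n) + Module.finrank ℝ E =
        Module.finrank ℝ N + Module.finrank ℝ (h.lieFix {n}) := by
    intro N n hN hn
    have h1 : h.tangent ∅ n ≤ N := by
      rintro _ ⟨X, hX, rfl⟩
      exact h.diff_mem_of_invariant (fun g _ => hN g) hX hn
    have h2 : Module.finrank ℝ (h.tangent ∅ n) + Module.finrank ℝ (A N n) = _ :=
      Submodule.finrank_add_inf_finrank_orthogonal h1
    have h3 := h.finrank_tangent_add ∅ n
    have h4 : h.lieFix ∅ = ⊤ := eq_top_iff.2 fun X _ => h.mem_lieFix_empty X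
    rw [insert_empty_eq, h4, finrank_top] at h3
    omega
  have hd₁ := hAdim hN₁ hn₁.mem
  have hd₂ := hAdim hN₂ hn₂.mem
  have hdA : Module.finrank ℝ (A N₁ x₁ ⊔ A N₂ x₂ : Submodule ℝ V) =
      Module.finrank ℝ (A N₁ x₁) + Module.finrank ℝ (A N₂ x₂) := by
    have h1 := Submodule.finrank_sup_add_finrank_inf_eq (A N₁ x₁) (A N₂ x₂)
    have h2 : A N₁ x₁ ⊓ A N₂ x₂ = ⊥ := by
      rw [eq_bot_iff]
      rintro a ⟨ha₁, ha₂⟩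
      exact inner_self_eq_zero.1 (horth a (hA ha₁).1 a (hA ha₂).1)
    rwa [h2, finrank_bot, add_zero] at h1
  -- The isotropy group of `x` fixes both components, so by their regularity it fixes both normal
  -- spaces pointwise; their sum is split off from the slice.
  obtain ⟨N', n', hn', hN', hfix', hdim'⟩ := hy.slice hρ (fun _ _ _ _ => Submodule.mem_top)
    Submodule.mem_top hmax (A := A N₁ x₁ ⊔ A N₂ x₂) le_top
    (fun a ha b hb => by
      obtain ⟨b₁, hb₁, b₂, hb₂, rfl⟩ := Submodule.mem_sup.1 hb
      obtain ⟨h1, h2⟩ := hfix a (ρ.mem_fixator_insert.1 ha).1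
      rw [map_add, hn₁.fixed b₁ (hA hb₁).1 (fun X _ => (hA hb₁).2 X) a
        (by rwa [insert_empty_eq, Representation.mem_fixator_singleton]),
        hn₂.fixed b₂ (hA hb₂).1 (fun X _ => (hA hb₂).2 X) a
        (by rwa [insert_empty_eq, Representation.mem_fixator_singleton])])
    (fun X hX b hb => by
      obtain ⟨b₁, hb₁, b₂, hb₂, rfl⟩ := Submodule.mem_sup.1 hb
      rw [hxadd, map_add, inner_add_left, inner_add_right, inner_add_right, (hA hb₁).2 X,
        (hA hb₂).2 X, horth _ (h.diff_mem_of_invariant (fun g _ => hN₁ g) hX hn₁.mem) _ (hA hb₂).1,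
        horth' _ (hA hb₁).1 _ (h.diff_mem_of_invariant (fun g _ => hN₂ g) hX hn₂.mem)]
      simp)
  have hmain := hn'.torusRank_add_le hρ hN'
  have hle := Submodule.finrank_mono (h.lieFix_le_of_fixator_le hfix'.le)
  rw [hfix'] at hmain
  have htop : h.lieFix ∅ = ⊤ := eq_top_iff.2 fun X _ => h.mem_lieFix_empty X
  rw [htop, finrank_top, finrank_top] at hdim'
  have hins : ∀ v : V, (insert v ∅ : Set V) = {v} := fun v => insert_empty_eq v
  rw [hins y, hins x] at hmain
  rw [hins x] at hdim'
  rw [hins y, hins x] at hle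
  have ht₁ : _ ≤ Module.finrank ℝ (h.lieFix {x₁}) := (h.finrank_lieFix_translate_le v₁ g).trans
    (h.finrank_lieFix_translate_le _ k)
  have ht₂ : _ ≤ Module.finrank ℝ (h.lieFix {x₂}) := h.finrank_lieFix_translate_le v₂ k
  omega

/-- The rank inequality for points of maximum orbit type. -/
theorem torusRank_add_torusRank_le [T2Space G] [CompactSpace G] (h : C.IsSmoothRep ρ)
    (hρ : ∀ g v w, inner ℝ (ρ g v) (ρ g w) = inner ℝ v w) {N₁ N₂ : Submodule ℝ V}
    (hN₁ : ∀ g, ∀ v ∈ N₁, ρ g v ∈ N₁) (hN₂ : ∀ g, ∀ v ∈ N₂, ρ g v ∈ N₂)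
    (horth : ∀ a ∈ N₁, ∀ b ∈ N₂, inner ℝ a b = 0)
    (hdim : Module.finrank ℝ N₁ + Module.finrank ℝ N₂ = Module.finrank ℝ V) {v₁ v₂ y : V}
    (hv₁ : ρ.IsPrincipalIn N₁ v₁) (hv₂ : ρ.IsPrincipalIn N₂ v₂) (hy : ρ.IsPrincipalIn ⊤ y) :
    torusRank (ρ.fixator {v₁}) + torusRank (ρ.fixator {v₂}) + Module.finrank ℝ (h.lieFix {v₁}) +
        Module.finrank ℝ (h.lieFix {v₂}) ≤
      torusRank G + torusRank (ρ.fixator {y}) + Module.finrank ℝ E +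
        Module.finrank ℝ (h.lieFix {y}) := by
  have hle : ∀ {N : Submodule ℝ V} {v n : V}, ρ.IsPrincipalIn N v → n ∈ N →
      torusRank (ρ.fixator {v}) ≤ torusRank (ρ.fixator {n}) ∧
        Module.finrank ℝ (h.lieFix {v}) ≤ Module.finrank ℝ (h.lieFix {n}) := by
    intro N v n hv hn
    obtain ⟨g, hg⟩ := hv.2 n hn
    exact ⟨torusRank_le_of_conj C g hg, h.finrank_lieFix_le_of_conj g hg⟩
  -- Regular points replace the given ones: the isotropy groups of `v₁`, `v₂` embed by conjugation
  -- in those of `n₁`, `n₂`, and that of `n` in that of `y`, which are the directions the inequality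
  -- needs.
  obtain ⟨n₁, hn₁⟩ := h.exists_isNice hρ hN₁
  obtain ⟨n₂, hn₂⟩ := h.exists_isNice hρ hN₂
  obtain ⟨n, hn⟩ := h.exists_isNice hρ (N := ⊤) fun _ _ _ => Submodule.mem_top
  have h1 := hle hv₁ hn₁.mem
  have h2 := hle hv₂ hn₂.mem
  have h3 := hle (hn.isPrincipalIn hρ fun _ _ _ => Submodule.mem_top) hy.1
  have h4 := hn₁.torusRank_add_torusRank_le hρ hN₁ hN₂ horth hdim hn₂ hn
  omega

end GroupChart.IsSmoothRep

/-! ### Charts of Lie groups -/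

section LieGroupChart

variable {E H G : Type*} [NormedAddCommGroup E] [NormedSpace ℝ E]
  [TopologicalSpace H] (I : ModelWithCorners ℝ E H) [I.Boundaryless]
  [Group G] [TopologicalSpace G] [ChartedSpace H G]

/-- The preferred chart at the identity, translated to map the identity to the origin. -/
noncomputable def centeredChart : OpenPartialHomeomorph G E :=
  ((chartAt H (1 : G)).transHomeomorph I.toHomeomorph).transHomeomorph
    (Homeomorph.subRight (extChartAt I (1 : G) 1))

theorem centeredChart_apply (g : G) :
    centeredChart I g = extChartAt I (1 : G) g - extChartAt I (1 : G) 1 := rfl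

theorem centeredChart_symm_apply (x : E) :
    (centeredChart I).symm x = (extChartAt I (1 : G)).symm (x + extChartAt I (1 : G) 1) := rfl

theorem one_mem_centeredChart_source : (1 : G) ∈ (centeredChart (G := G) I).source :=
  mem_chart_source H (1 : G)

theorem centeredChart_one : centeredChart I (1 : G) = 0 := by
  rw [centeredChart_apply, sub_self]

theorem centeredChart_symm_zero : (centeredChart I).symm 0 = (1 : G) := by
  rw [centeredChart_symm_apply, zero_add, extChartAt_to_inv]

theorem contMDiffAt_centeredChart : ContMDiffAt I 𝓘(ℝ, E) ∞ (centeredChart (G := G) I) 1 := by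
  have h1 : ContMDiffAt I 𝓘(ℝ, E) ∞ (extChartAt I (1 : G)) 1 := contMDiffAt_extChartAt
  exact h1.sub contMDiffAt_const

variable [LieGroup I ∞ G]

theorem contMDiffAt_centeredChart_symm :
    ContMDiffAt 𝓘(ℝ, E) I ∞ (centeredChart (G := G) I).symm 0 := by
  have h1 : ContMDiffAt 𝓘(ℝ, E) I ∞ (extChartAt I (1 : G)).symm (0 + extChartAt I (1 : G) 1) := by
    rw [zero_add]
    exact (contMDiffOn_extChartAt_symm (1 : G)).contMDiffAt (extChartAt_target_mem_nhds 1)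
  have h2 : ContMDiffAt 𝓘(ℝ, E) 𝓘(ℝ, E) ∞ (fun x : E => x + extChartAt I (1 : G) 1) 0 :=
    (contDiff_id.add contDiff_const).contMDiff.contMDiffAt
  exact ContMDiffAt.comp (f := fun x : E => x + extChartAt I (1 : G) 1) (0 : E) h1 h2

/-- The chart at the identity of a Lie group. -/
noncomputable def lieGroupChart (G : Type*) [Group G] [TopologicalSpace G] [ChartedSpace H G]
    [LieGroup I ∞ G] : GroupChart G E where
  chart := centeredChart I
  one_mem_source := one_mem_centeredChart_source I
  map_one := centeredChart_one I
  contDiffAt_mul := by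
    have hs := contMDiffAt_centeredChart_symm (G := G) I
    have h1 : ContMDiffAt 𝓘(ℝ, E × E) I ∞ (fun p : E × E => (centeredChart (G := G) I).symm p.1) 0 :=
      ContMDiffAt.comp (0 : E × E) hs contDiff_fst.contMDiff.contMDiffAt
    have h2 : ContMDiffAt 𝓘(ℝ, E × E) I ∞ (fun p : E × E => (centeredChart (G := G) I).symm p.2) 0 :=
      ContMDiffAt.comp (0 : E × E) hs contDiff_snd.contMDiff.contMDiffAt
    have h3 := ContMDiffAt.comp_of_eq (contMDiffAt_centeredChart (G := G) I) (h1.mul h2) (by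
      simp [centeredChart_symm_zero])
    exact h3.contDiffAt.of_le (WithTop.coe_le_coe.2 (le_top : (2 : ℕ∞) ≤ ⊤))
  contDiffAt_conj₂ := by
    have hs := contMDiffAt_centeredChart_symm (G := G) I
    have h1 : ContMDiffAt 𝓘(ℝ, E × E) I ∞ (fun p : E × E => (centeredChart (G := G) I).symm p.1) 0 :=
      ContMDiffAt.comp (0 : E × E) hs contDiff_fst.contMDiff.contMDiffAt
    have h2 : ContMDiffAt 𝓘(ℝ, E × E) I ∞ (fun p : E × E => (centeredChart (G := G) I).symm p.2) 0 :=
      ContMDiffAt.comp (0 : E × E) hs contDiff_snd.contMDiff.contMDiffAt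
    have h3 := ContMDiffAt.comp_of_eq (contMDiffAt_centeredChart (G := G) I)
      ((h1.mul h2).mul h1.inv) (by simp [centeredChart_symm_zero])
    exact h3.contDiffAt.of_le (WithTop.coe_le_coe.2 (le_top : (2 : ℕ∞) ≤ ⊤))
  contDiffAt_conj g := by
    have hs := contMDiffAt_centeredChart_symm (G := G) I
    have h3 := ContMDiffAt.comp_of_eq (contMDiffAt_centeredChart (G := G) I)
      (((contMDiffAt_const (c := g)).mul hs).mul (contMDiffAt_const (c := g⁻¹)))
      (by simp [centeredChart_symm_zero])
    exact h3.contDiffAt.of_le (by exact_mod_cast le_top)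

variable {V : Type*} [NormedAddCommGroup V] [NormedSpace ℝ V] {σ : Representation ℝ G V}

theorem Representation.IsSmooth.isSmoothRep (hσ : σ.IsSmooth I) :
    (lieGroupChart I G).IsSmoothRep σ := by
  intro v
  have h1 := ContMDiffAt.comp (0 : E) (hσ v).contMDiffAt (contMDiffAt_centeredChart_symm (G := G) I)
  exact h1.contDiffAt.of_le (by exact_mod_cast le_top)

theorem Representation.IsSmooth.orbitTangentSpace_eq (hσ : σ.IsSmooth I) (v : V) :
    σ.orbitTangentSpace I v = ((hσ.isSmoothRep I).diff.flip v).range := by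
  have h1 : MDifferentiableAt I 𝓘(ℝ, V) (fun g : G => σ g v) 1 :=
    (hσ v).contMDiffAt.mdifferentiableAt (by simp)
  have h2 : (mfderiv I 𝓘(ℝ, V) (fun g : G => σ g v) 1 : E →L[ℝ] V) =
      fderiv ℝ (fun x : E => σ ((centeredChart I).symm x) v) 0 := by
    rw [h1.mfderiv, I.range_eq_univ, fderivWithin_univ]
    simp only [centeredChart_symm_apply]
    rw [fderiv_comp_add_right (f := fun y => σ ((extChartAt I (1 : G)).symm y) v), zero_add]
    rfl
  rw [Representation.orbitTangentSpace, h2]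
  rfl

end LieGroupChart

/-! ### Transport to one Euclidean space and conclusion -/

/-- The representation transported along a linear equivalence. -/
def Representation.transport {G V W : Type*} [Group G] [AddCommGroup V] [Module ℝ V]
    [AddCommGroup W] [Module ℝ W] (σ : Representation ℝ G V) (e : V ≃ₗ[ℝ] W) :
    Representation ℝ G W where
  toFun g := e.toLinearMap ∘ₗ σ g ∘ₗ e.symm.toLinearMap
  map_one' := by ext; simp
  map_mul' g h := by ext; simp

theorem Representation.transport_apply {G V W : Type*} [Group G] [AddCommGroup V] [Module ℝ V]
    [AddCommGroup W] [Module ℝ W] (σ : Representation ℝ G V) (e : V ≃ₗ[ℝ] W) (g : G) (w : W) :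
    σ.transport e g w = e (σ g (e.symm w)) := rfl

theorem GroupChart.IsSmoothRep.transport {G E V W : Type*} [Group G] [TopologicalSpace G]
    [NormedAddCommGroup E] [NormedSpace ℝ E]
    [NormedAddCommGroup V] [NormedSpace ℝ V] [FiniteDimensional ℝ V]
    [NormedAddCommGroup W] [NormedSpace ℝ W]
    {C : GroupChart G E} {σ : Representation ℝ G V} (h : C.IsSmoothRep σ) (e : V ≃ₗ[ℝ] W) :
    C.IsSmoothRep (σ.transport e) := fun w =>
  (LinearMap.toContinuousLinearMap e.toLinearMap).contDiff.contDiffAt.comp (0 : E) (h (e.symm w))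

theorem GroupChart.IsSmoothRep.diff_equivariant {G E V W : Type*} [Group G] [TopologicalSpace G]
    [NormedAddCommGroup E] [NormedSpace ℝ E]
    [NormedAddCommGroup V] [NormedSpace ℝ V] [FiniteDimensional ℝ V]
    [NormedAddCommGroup W] [NormedSpace ℝ W]
    {C : GroupChart G E} {σ : Representation ℝ G V} {ρ : Representation ℝ G W}
    (hσ : C.IsSmoothRep σ) (hρ : C.IsSmoothRep ρ) {j : V →ₗ[ℝ] W}
    (hj : ∀ g v, j (σ g v) = ρ g (j v)) (X : E) (v : V) :
    hρ.diff X (j v) = j (hσ.diff X v) := by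
  have h1 := (LinearMap.toContinuousLinearMap j).hasFDerivAt.comp 0 (hσ.hasFDerivAt v)
  have h2 : HasFDerivAt (fun x : E => ρ (C.chart.symm x) (j v)) _ 0 :=
    h1.congr_of_eventuallyEq (Eventually.of_forall fun x => (hj _ v).symm)
  rw [hρ.diff_apply, h2.fderiv]
  rfl

theorem Representation.isPrincipalIn_range_iff {G V W : Type*} [Group G] [AddCommGroup V]
    [Module ℝ V] [AddCommGroup W] [Module ℝ W] {σ : Representation ℝ G V}
    {ρ : Representation ℝ G W} {j : V →ₗ[ℝ] W} (hinj : Function.Injective j)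
    (hj : ∀ g v, j (σ g v) = ρ g (j v)) {v : V} :
    ρ.IsPrincipalIn j.range (j v) ↔ σ.IsPrincipalPoint v := by
  have hmem : ∀ g v, g ∈ ρ.fixator {j v} ↔ g ∈ σ.isotropy v := by
    intro g v
    rw [Representation.mem_fixator_singleton, ← hj, hinj.eq_iff]
    rfl
  constructor
  · rintro ⟨-, h⟩ w
    obtain ⟨g, hg⟩ := h (j w) ⟨w, rfl⟩
    refine ⟨g, ?_⟩
    rintro _ ⟨k, hk, rfl⟩
    exact (hmem _ _).1 (hg k ((hmem _ _).2 hk))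
  · refine fun h => ⟨⟨v, rfl⟩, ?_⟩
    rintro _ ⟨w, rfl⟩
    obtain ⟨g, hg⟩ := h w
    exact ⟨g, fun k hk => (hmem _ _).2 (hg ⟨k, (hmem _ _).1 hk, rfl⟩)⟩

theorem Representation.isotropy_eq_fixator {G V W : Type*} [Group G] [AddCommGroup V]
    [Module ℝ V] [AddCommGroup W] [Module ℝ W] {σ : Representation ℝ G V}
    {ρ : Representation ℝ G W} {j : V →ₗ[ℝ] W} (hinj : Function.Injective j)
    (hj : ∀ g v, j (σ g v) = ρ g (j v)) (v : V) : σ.isotropy v = ρ.fixator {j v} := by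
  ext g
  rw [Representation.mem_fixator_singleton, ← hj, hinj.eq_iff]
  rfl

section Lie

variable {E H G V W : Type*} [NormedAddCommGroup E] [NormedSpace ℝ E] [FiniteDimensional ℝ E]
  [TopologicalSpace H] (I : ModelWithCorners ℝ E H) [I.Boundaryless]
  [Group G] [TopologicalSpace G] [ChartedSpace H G] [LieGroup I ∞ G] [T2Space G] [CompactSpace G]
  [NormedAddCommGroup V] [NormedSpace ℝ V] [FiniteDimensional ℝ V]
  [NormedAddCommGroup W] [InnerProductSpace ℝ W] [FiniteDimensional ℝ W]
  {σ : Representation ℝ G V} {ρ : Representation ℝ G W} {j : V →ₗ[ℝ] W}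

-- Rank-nullity for the infinitesimal action: the kernel at `v` is the Lie algebra of the isotropy
-- group, computed after the equivariant embedding `j`.
omit [T2Space G] [CompactSpace G] [FiniteDimensional ℝ W] in
theorem finrank_orbitTangentSpace_add (hσ : σ.IsSmooth I)
    (h : (lieGroupChart I G).IsSmoothRep ρ) (hinj : Function.Injective j)
    (hj : ∀ g v, j (σ g v) = ρ g (j v)) (v : V) :
    Module.finrank ℝ (σ.orbitTangentSpace I v) + Module.finrank ℝ (h.lieFix {j v}) =
      Module.finrank ℝ E := by
  rw [hσ.orbitTangentSpace_eq I]
  have h1 : h.lieFix {j v} = ((hσ.isSmoothRep I).diff.flip v).ker := by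
    ext X
    rw [GroupChart.IsSmoothRep.mem_lieFix, LinearMap.mem_ker, LinearMap.flip_apply]
    simp only [Set.mem_singleton_iff, forall_eq]
    rw [(hσ.isSmoothRep I).diff_equivariant h hj, map_eq_zero_iff j hinj]
  rw [h1]
  exact LinearMap.finrank_range_add_finrank_ker _

-- Existence of regular points in the image of `j` guarantees that the choice made by
-- `Classical.epsilon` is a genuine principal point.
omit [FiniteDimensional ℝ V] in
theorem isPrincipalPoint_principalPoint (h : (lieGroupChart I G).IsSmoothRep ρ)
    (hρ : ∀ g v w, inner ℝ (ρ g v) (ρ g w) = inner ℝ v w) (hinj : Function.Injective j)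
    (hj : ∀ g v, j (σ g v) = ρ g (j v)) : σ.IsPrincipalPoint σ.principalPoint := by
  have := topologicalGroup_of_lieGroup I ∞ (G := G)
  have hN : ∀ g, ∀ v ∈ j.range, ρ g v ∈ j.range := by
    rintro g _ ⟨v, rfl⟩
    exact ⟨σ g v, hj g v⟩
  obtain ⟨n, hn⟩ := h.exists_isNice hρ hN
  obtain ⟨v, rfl⟩ := hn.mem
  exact Classical.epsilon_spec ⟨v, (Representation.isPrincipalIn_range_iff hinj hj).1
    (hn.isPrincipalIn hρ hN)⟩

end Lie

theorem lemma2p2 {E H G V₁ V₂ : Type*}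
    [NormedAddCommGroup E] [NormedSpace ℝ E] [FiniteDimensional ℝ E]
    [TopologicalSpace H] (I : ModelWithCorners ℝ E H) [I.Boundaryless]
    [Group G] [TopologicalSpace G] [ChartedSpace H G] [LieGroup I ∞ G]
    [T2Space G] [CompactSpace G]
    [NormedAddCommGroup V₁] [NormedSpace ℝ V₁] [FiniteDimensional ℝ V₁]
    [NormedAddCommGroup V₂] [NormedSpace ℝ V₂] [FiniteDimensional ℝ V₂]
    (ρ₁ : Representation ℝ G V₁) (ρ₂ : Representation ℝ G V₂)
    (h₁ : ρ₁.IsSmooth I) (h₂ : ρ₂.IsSmooth I) :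
    (ρ₁.prod ρ₂).hrk I ≤ ρ₁.hrk I + ρ₂.hrk I := by
  have := topologicalGroup_of_lieGroup I ∞ (G := G)
  have h₁₂ : (ρ₁.prod ρ₂).IsSmooth I := fun v => (h₁ v.1).prodMk_space (h₂ v.2)
  obtain ⟨e₁, he₁⟩ := ρ₁.exists_linearEquiv_euclidean fun v => (h₁ v).continuous
  obtain ⟨e₂, he₂⟩ := ρ₂.exists_linearEquiv_euclidean fun v => (h₂ v).continuous
  -- The Euclidean product norm makes the two summands orthogonal and the inner product invariant.
  -- All three representations are then studied inside this one space.
  let e : (V₁ × V₂) ≃ₗ[ℝ] WithLp 2 (EuclideanSpace ℝ (Fin (Module.finrank ℝ V₁)) ×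
      EuclideanSpace ℝ (Fin (Module.finrank ℝ V₂))) :=
    (e₁.prodCongr e₂).trans (WithLp.linearEquiv 2 ℝ _).symm
  have he : ∀ v w, inner ℝ (e v) (e w) =
      inner ℝ (e₁ v.1) (e₁ w.1) + inner ℝ (e₂ v.2) (e₂ w.2) := fun v w =>
    WithLp.prod_inner_apply _ _
  let ρ := (ρ₁.prod ρ₂).transport e
  have hρe : ∀ g v, e (ρ₁.prod ρ₂ g v) = ρ g (e v) := fun g v => by
    rw [Representation.transport_apply, e.symm_apply_apply]
  have hρ : ∀ g v w, inner ℝ (ρ g v) (ρ g w) = inner ℝ v w := by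
    intro g v w
    obtain ⟨v, rfl⟩ := e.surjective v
    obtain ⟨w, rfl⟩ := e.surjective w
    rw [← hρe, ← hρe, he, he]
    exact congrArg₂ (· + ·) (he₁ g v.1 w.1) (he₂ g v.2 w.2)
  have h : (lieGroupChart I G).IsSmoothRep ρ := (h₁₂.isSmoothRep I).transport e
  let j₁ := e.toLinearMap ∘ₗ LinearMap.inl ℝ V₁ V₂
  let j₂ := e.toLinearMap ∘ₗ LinearMap.inr ℝ V₁ V₂
  have hinj₁ : Function.Injective j₁ := e.injective.comp LinearMap.inl_injective
  have hinj₂ : Function.Injective j₂ := e.injective.comp LinearMap.inr_injective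
  have hinj : Function.Injective e.toLinearMap := e.injective
  have hj₁ : ∀ g v, j₁ (ρ₁ g v) = ρ g (j₁ v) := fun g v =>
    (congrArg e (by ext <;> simp [Representation.prod])).trans (hρe g (v, 0))
  have hj₂ : ∀ g v, j₂ (ρ₂ g v) = ρ g (j₂ v) := fun g v =>
    (congrArg e (by ext <;> simp [Representation.prod])).trans (hρe g (0, v))
  have hp₁ := isPrincipalPoint_principalPoint I h hρ hinj₁ hj₁
  have hp₂ := isPrincipalPoint_principalPoint I h hρ hinj₂ hj₂
  have hp := isPrincipalPoint_principalPoint I h hρ hinj hρe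
  rw [← Representation.isPrincipalIn_range_iff hinj₁ hj₁] at hp₁
  rw [← Representation.isPrincipalIn_range_iff hinj₂ hj₂] at hp₂
  rw [← Representation.isPrincipalIn_range_iff hinj hρe, LinearEquiv.range] at hp
  have hinv₁ : ∀ g, ∀ v ∈ j₁.range, ρ g v ∈ j₁.range := by
    rintro g _ ⟨v, rfl⟩
    exact ⟨_, hj₁ g v⟩
  have hinv₂ : ∀ g, ∀ v ∈ j₂.range, ρ g v ∈ j₂.range := by
    rintro g _ ⟨v, rfl⟩
    exact ⟨_, hj₂ g v⟩
  have horth : ∀ a ∈ j₁.range, ∀ b ∈ j₂.range, inner ℝ a b = 0 := by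
    rintro _ ⟨a, rfl⟩ _ ⟨b, rfl⟩
    exact (he (a, 0) (0, b)).trans (by simp)
  have hdim : Module.finrank ℝ j₁.range + Module.finrank ℝ j₂.range = Module.finrank ℝ
      (WithLp 2 (EuclideanSpace ℝ (Fin (Module.finrank ℝ V₁)) ×
        EuclideanSpace ℝ (Fin (Module.finrank ℝ V₂)))) := by
    rw [LinearMap.finrank_range_of_inj hinj₁, LinearMap.finrank_range_of_inj hinj₂,
      ← e.finrank_eq, Module.finrank_prod]
  have key := h.torusRank_add_torusRank_le hρ hinv₁ hinv₂ horth hdim hp₁ hp₂ hp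
  rw [← Representation.isotropy_eq_fixator hinj₁ hj₁,
    ← Representation.isotropy_eq_fixator hinj₂ hj₂,
    ← Representation.isotropy_eq_fixator hinj hρe] at key
  have t₁ := finrank_orbitTangentSpace_add I h₁ h hinj₁ hj₁ ρ₁.principalPoint
  have t₂ := finrank_orbitTangentSpace_add I h₂ h hinj₂ hj₂ ρ₂.principalPoint
  have t := finrank_orbitTangentSpace_add I h₁₂ h hinj hρe (ρ₁.prod ρ₂).principalPoint
  -- By `t₁`, `t₂` and `t` the orbit dimensions are `dim G` minus those of the isotropy algebras, so
  -- `key` is the claim; the dimensions of `V₁` and `V₂` cancel.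
  simp only [Representation.hrk, Representation.cohomogeneity, Module.finrank_prod]
  omega
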